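/- Let $G=T^n=(S^1)^n$, and let $(M,\omega)$ be a compact connected symplectic manifold of dimension $2d$ with a Hamiltonian action $\tau$ of $G$. Let $\sigma:M\to M$ be a smooth anti-symplectic involution (that is, $\sigma^2=\mathrm{id}$ and $\sigma^*\omega=-\omega$) such that $\sigma\circ\tau_g=\tau_{g^{-1}}\circ\sigma$ for all $g\in G$. Let $X=M^\sigma$ be the real locus, and let $G_{\mathbb R}=\{g\in G : g^2=1\}\cong(\mathbb Z/2\mathbb Z)^n$, which acts on $X$. Define the one-skeleta $$M^{(1)}=\{p\in M : \dim(G\cdot p)\le 1\},\qquad X^{(1)}=\{x\in X : \#(G_{\mathbb R}\cdot x)\le 2\}.$$ Suppose that the fixed point set $M^G$ is finite and that $\dim M^{(1)}\le 2$. For $p\in M^G$ let $\tilde\alpha_{1,p},\dots,\tilde\alpha_{d,p}\in\mathbb Z_G^*\cong\mathbb Z^n$ be the weights, listed with multiplicity, of the isotropy representation of $G$ on the symplectic vector space $T_pM$, and let $\alpha_{i,p}$ be the image of $\tilde\alpha_{i,p}$ in $\mathbb Z_G^*/2\mathbb Z_G^*$. Then the two conditions $$X^{G_{\mathbb R}}=M^G\qquad\text{and}\qquad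 X^{(1)}=X\cap M^{(1)}$$ both hold if and only if, for every $p\in M^G$, the reduced weights $\alpha_{1,p},\dots,\alpha_{d,p}$ are pairwise distinct and all non-zero. -/

import Mathlib

open scoped Manifold ContDiff

noncomputable section

namespace RealGKM

/-- The compact torus `G = T^n`, the `n`-fold product of circles, with Mathlib's product group,
product topology and product charts. -/
abbrev Torus (n : ℕ) : Type := Fin n → Circle

/-- The smooth structure of `T^n`: the product of the smooth structures of the circles. -/
abbrev torusModel (n : ℕ) :
    ModelWithCorners ℝ (Fin n → EuclideanSpace ℝ (Fin 1))
      (ModelPi fun _ : Fin n => EuclideanSpace ℝ (Fin 1)) :=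
  ModelWithCorners.pi fun _ : Fin n => 𝓡 1

/-- The exponential map `𝔤 = ℝ^n → T^n`, `ξ ↦ (e^{i ξ_1}, …, e^{i ξ_n})`. -/
def torusExp {n : ℕ} (ξ : Fin n → ℝ) : Torus n := fun j => Circle.exp (ξ j)

/-- The value at `g ∈ T^n` of the character with weight `a ∈ ℤ^n`: `g_1 ^ a_1 ⋯ g_n ^ a_n`. Thus
`ℤ^n` is the weight lattice of `T^n`. -/
def character {n : ℕ} (a : Fin n → ℤ) (g : Torus n) : Circle := ∏ j, g j ^ a j

/-- The image of a weight in `ℤ^n / 2 ℤ^n = (ℤ/2)^n`. -/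
def mod2Reduction {n : ℕ} (a : Fin n → ℤ) : Fin n → ZMod 2 := fun j => (a j : ZMod 2)

/-- The subgroup `G_ℝ = {g ∈ G | g² = 1}`, isomorphic to `(ℤ/2)^n`. -/
def realTorus (n : ℕ) : Subgroup (Torus n) := (powMonoidHom 2).ker

section Manifold

variable {E : Type*} [NormedAddCommGroup E] [NormedSpace ℝ E]
variable (M : Type*) [TopologicalSpace M] [ChartedSpace E M]

/-- The expression in the preferred chart around `c` of a differential 2-form `Ω`, that is, of a
family of alternating bilinear forms on the tangent spaces: the pullback of `Ω` under the inverse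
of the chart. -/
def localForm {M : Type*} [TopologicalSpace M] [ChartedSpace E M]
    (Ω : ∀ x : M, TangentSpace 𝓘(ℝ, E) x [⋀^Fin 2]→L[ℝ] ℝ) (c : M) (y : E) :
    E [⋀^Fin 2]→L[ℝ] ℝ :=
  (Ω ((extChartAt 𝓘(ℝ, E) c).symm y)).compContinuousLinearMap
    (mfderiv 𝓘(ℝ, E) 𝓘(ℝ, E) (extChartAt 𝓘(ℝ, E) c).symm y)

variable (E) in
/-- A symplectic form on `M`: a smooth, closed and nondegenerate differential 2-form. -/
structure SymplecticForm where
  form : ∀ x : M, TangentSpace 𝓘(ℝ, E) x [⋀^Fin 2]→L[ℝ] ℝ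
  smooth : ∀ c : M,
    ContDiffOn ℝ ∞ (localForm form c) (extChartAt 𝓘(ℝ, E) c).target
  closed : ∀ c : M, ∀ y ∈ (extChartAt 𝓘(ℝ, E) c).target,
    extDeriv (localForm form c) y = 0
  nondegenerate : ∀ (x : M) (v : TangentSpace 𝓘(ℝ, E) x),
    (∀ w : TangentSpace 𝓘(ℝ, E) x, form x ![v, w] = 0) → v = 0

variable {M} {n : ℕ} [MulAction (Torus n) M]

/-- The infinitesimal action `𝔤 → T_p M`, `ξ ↦ ξ_M(p) = d/dt|_{t=0} exp(tξ) • p`: the differential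
at `0` of `ξ ↦ exp(ξ) • p`. (The target is literally the tangent space at `exp(0) • p = p`.) -/
def infinitesimalAction (n : ℕ) [MulAction (Torus n) M] (p : M) :
    (Fin n → ℝ) →L[ℝ] TangentSpace 𝓘(ℝ, E) p :=
  mfderiv 𝓘(ℝ, Fin n → ℝ) 𝓘(ℝ, E) (fun ξ : Fin n → ℝ => torusExp ξ • p) 0

/-- The action of `T^n` on the symplectic manifold `(M, Ω)` is Hamiltonian: it is smooth,
preserves `Ω`, and has a moment map, a smooth invariant map `Φ : M → 𝔤^*` whose component `Φ^ξ`
is a Hamiltonian function of the vector field `ξ_M`, for every `ξ ∈ 𝔤`. -/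
structure IsHamiltonianAction (Ω : SymplecticForm E M) (n : ℕ) [MulAction (Torus n) M] :
    Prop where
  smooth : ContMDiffSMul (torusModel n) 𝓘(ℝ, E) ∞ (Torus n) M
  symplectic : ∀ (g : Torus n) (x : M) (v w : TangentSpace 𝓘(ℝ, E) x),
    Ω.form (g • x) ![mfderiv 𝓘(ℝ, E) 𝓘(ℝ, E) (fun y : M => g • y) x v,
      mfderiv 𝓘(ℝ, E) 𝓘(ℝ, E) (fun y : M => g • y) x w] = Ω.form x ![v, w]
  exists_momentMap : ∃ Φ : M → ((Fin n → ℝ) →L[ℝ] ℝ),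
    ContMDiff 𝓘(ℝ, E) 𝓘(ℝ, (Fin n → ℝ) →L[ℝ] ℝ) ∞ Φ ∧
    (∀ (g : Torus n) (x : M), Φ (g • x) = Φ x) ∧
    ∀ (ξ : Fin n → ℝ) (x : M) (v : TangentSpace 𝓘(ℝ, E) x),
      mfderiv 𝓘(ℝ, E) 𝓘(ℝ, ℝ) (fun y : M => Φ y ξ) x v
        = Ω.form x ![infinitesimalAction n x ξ, v]

/-- `σ` is an anti-symplectic involution of `(M, Ω)` compatible with the action of `T^n`:
`σ^* Ω = -Ω`, `σ ∘ σ = id` and `σ ∘ τ_g = τ_{g⁻¹} ∘ σ`. -/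
structure IsCompatibleAntisymplecticInvolution (Ω : SymplecticForm E M) (n : ℕ)
    [MulAction (Torus n) M] (σ : M → M) : Prop where
  smooth : ContMDiff 𝓘(ℝ, E) 𝓘(ℝ, E) ∞ σ
  involutive : Function.Involutive σ
  antisymplectic : ∀ (x : M) (v w : TangentSpace 𝓘(ℝ, E) x),
    Ω.form (σ x) ![mfderiv 𝓘(ℝ, E) 𝓘(ℝ, E) σ x v, mfderiv 𝓘(ℝ, E) 𝓘(ℝ, E) σ x w]
      = -Ω.form x ![v, w]
  compatible : ∀ (g : Torus n) (x : M), σ (g • x) = g⁻¹ • σ x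

/-- The dimension of the orbit `G • p`: the dimension of its tangent space
`T_p (G • p) = {ξ_M(p) | ξ ∈ 𝔤}`. -/
def orbitDim (E : Type*) [NormedAddCommGroup E] [NormedSpace ℝ E]
    {M : Type*} [TopologicalSpace M] [ChartedSpace E M]
    (n : ℕ) [MulAction (Torus n) M] (p : M) : ℕ :=
  Module.finrank ℝ (infinitesimalAction (E := E) n p).range

variable (E M) in
/-- The one-skeleton `M^{(1)} = {p ∈ M | dim (G • p) ≤ 1}`. -/
def oneSkeleton (n : ℕ) [MulAction (Torus n) M] : Set M := {p | orbitDim E n p ≤ 1}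

/-- The dimension of a subset of a manifold: the supremum over the charts of the Hausdorff
dimension of its part in the chart. For a countable union of submanifolds this is the
largest of their dimensions. -/
def subsetDim (E : Type*) [NormedAddCommGroup E] [NormedSpace ℝ E]
    {M : Type*} [TopologicalSpace M] [ChartedSpace E M] (S : Set M) : ENNReal :=
  ⨆ c : M, dimH (extChartAt 𝓘(ℝ, E) c '' (S ∩ (extChartAt 𝓘(ℝ, E) c).source))

/-- The real locus `X = M^σ`. -/
def realLocus {M : Type*} (σ : M → M) : Set M := Function.fixedPoints σ

/-- The fixed point set `X^{G_ℝ}` of the residual action of `G_ℝ` on the real locus. -/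
def realFixedPoints {M : Type*} (n : ℕ) [MulAction (Torus n) M] (σ : M → M) : Set M :=
  realLocus σ ∩ MulAction.fixedPoints (realTorus n) M

/-- The one-skeleton `X^{(1)} = {x ∈ X | #(G_ℝ • x) ≤ 2}` of the real locus. -/
def realOneSkeleton {M : Type*} (n : ℕ) [MulAction (Torus n) M] (σ : M → M) : Set M :=
  {x ∈ realLocus σ | (MulAction.orbit (realTorus n) x).encard ≤ 2}

/-- The linear isotropy action of `g ∈ G` on `T_p M`, for a fixed point `p` of `G`: the
differential at `p` of `x ↦ g • x`. (Its target is literally the tangent space at `g • p = p`.) -/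
def isotropyAction (n : ℕ) [MulAction (Torus n) M] (p : M) (g : Torus n) :
    TangentSpace 𝓘(ℝ, E) p →L[ℝ] TangentSpace 𝓘(ℝ, E) p :=
  mfderiv 𝓘(ℝ, E) 𝓘(ℝ, E) (fun x : M => g • x) p

/-- `α_1, …, α_d ∈ ℤ^n` are the weights (with multiplicity) of the isotropy representation of `G`
on the symplectic vector space `T_p M`, at a fixed point `p`: there is an isomorphism of `T_p M`
with `ℂ^d` which carries the symplectic form to the standard one `∑ Im (z̄_i w_i)` and the isotropy
action to the diagonal action of `G` in which the `i`-th coordinate is acted on through the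
character with weight `α_i`. -/
def IsIsotropyWeights {d : ℕ} (Ω : SymplecticForm E M) (n : ℕ) [MulAction (Torus n) M] (p : M)
    (α : Fin d → Fin n → ℤ) : Prop :=
  ∃ φ : TangentSpace 𝓘(ℝ, E) p ≃ₗ[ℝ] (Fin d → ℂ),
    (∀ v w : TangentSpace 𝓘(ℝ, E) p,
      Ω.form p ![v, w] = ∑ i, (starRingEnd ℂ (φ v i) * φ w i).im) ∧
    ∀ (g : Torus n) (v : TangentSpace 𝓘(ℝ, E) p) (i : Fin d),
      φ (isotropyAction n p g v) i = (character (α i) g : ℂ) * φ v i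

end Manifold

end RealGKM

end

/-!
# Reduced weights and the one-skeleton of the real locus

Let `ξ` generate a dense one-parameter subgroup of the torus. The critical points of the component
`f` of the moment map along `ξ` are the fixed points of the torus, and near such a point, in a chart
that linearizes the action of a finite subgroup `K` of `G_ℝ`, the Hessian of `f` is, on the plane of
weight `α`, the standard form times a nonzero multiple of the pairing of `α` with `ξ`
(`hessian_momentMap_chart`). The negative directions therefore come in planes. Hence on a component
`Y` of the fixed set of `K` every point is either a strict local minimum of `f` or a point at which
the set of smaller values is, locally, nonempty and connected
(`isLocalPass_and_isStrictMin_of_mem_fixedPoints`, `isLocalPass_of_infinitesimalAction_ne_zero`). A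
mountain pass argument, `IsStrictMin.unique`, then shows that `f` has at most one strict local
minimum on `Y`.

**From the weights to the skeleta.** First, `σ` fixes every fixed point `p` of the torus
(`involution_eq_of_mem_fixedPoints`): among the points of `M^G` moved by `σ` let `f` be least at
`p`. If no direction at `p` is decreasing, `p` and `σ p` are two strict minima on `M`, since `f` is
invariant under `σ`. Otherwise there is a weight plane on which `f` decreases; since the reduced
weights are distinct, this plane is the tangent space of a component `Y` of the fixed set of the
kernel of that reduced weight. The minimum of `f` on `Y` is a point of `M^G` below `p`, hence fixed
by `σ`; so `σ` preserves `Y`, and `p` and `σ p` are two strict maxima on `Y`. Secondly, every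
component of a fixed set contains a point of `M^G`, at which its dimension can be read from the
weights. For `K = G_ℝ` the components are points (`mem_fixedPoints_of_mem_fixedSet_realTorus`). If
`x` has at most two translates under `G_ℝ`, its stabilizer in `G_ℝ` has index at most two, so the
component has dimension at most two; as orbits are isotropic, the orbit of `x` has dimension at most
one (`orbitDim_le_one_of_encard_orbit`). The inclusion of `X ∩ M^(1)` in `X^(1)` holds without any
hypothesis on the weights, because the stabilizers on a line are closed subgroups of `ℝ`
(`realLocus_inter_oneSkeleton_subset`).

**From the skeleta to the weights.** The weights exist: averaging an inner product over the torus
turns the symplectic form into an invertible operator commuting with the representation, and joint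
eigenvectors give the weight planes (`exists_isIsotropyWeights`). If a reduced weight is zero at
`p`, the fixed set of `G_ℝ` and `σ` has positive dimension at `p`
(`mod2Reduction_ne_zero_of_realFixedPoints`). If two reduced weights agree and `K` is the kernel of
their common value, the points fixed by `K` and `σ` near `p` form a submanifold of dimension at
least two, contained in `X^(1)` and so in `M^(1)`. As `M^(1)` is invariant under the torus and the
direction of the action at a real point is reversed by `dσ`, the orbits of these points sweep out a
subset of `M^(1)` of dimension at least three (`injective_mod2Reduction_of_realOneSkeleton`).
-/

noncomputable section

namespace RealGKM

open Set Filter Topology Metric MeasureTheory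

/-! ### Uniqueness of local minima -/

section MountainPass

variable {Y : Type*} [TopologicalSpace Y]

/-- `y` is a strict local minimum of `f`. -/
def IsStrictMin (f : Y → ℝ) (y : Y) : Prop :=
  ∃ V ∈ 𝓝 y, ∀ z ∈ V, z ≠ y → f y < f z

/-- The sublevel set `{f < f y}` accumulates at `y`, and near `y` it lies in one connected piece
of itself. This holds at the regular points of a smooth function, and at its nondegenerate critical
points of index at least two. -/
def IsPass (f : Y → ℝ) (y : Y) : Prop :=
  y ∈ closure {z | f z < f y} ∧
    ∃ V ∈ 𝓝 y, ∃ C ⊆ {z | f z < f y}, IsPreconnected C ∧ V ∩ {z | f z < f y} ⊆ C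

lemma IsPass.not_isStrictMin {f : Y → ℝ} {y : Y} (h : IsPass f y) : ¬ IsStrictMin f y := by
  rintro ⟨V, hV, hVf⟩
  obtain ⟨z, hzV, hz⟩ := mem_closure_iff_nhds.1 h.1 V hV
  have hz' : f z < f y := hz
  have : z ≠ y := by rintro rfl; exact lt_irrefl _ hz'
  exact lt_asymm hz' (hVf z hzV this)

lemma IsPass.exists_lt {f : Y → ℝ} {y : Y} (h : IsPass f y) : ∃ z, f z < f y := by
  obtain ⟨z, -, hz⟩ := mem_closure_iff_nhds.1 h.1 univ univ_mem
  exact ⟨z, hz⟩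

lemma lt_of_mem_component {f : Y → ℝ} {c : ℝ} {p q : Y}
    (h : q ∈ connectedComponentIn {y | f y < c} p) : f q < c := by
  have := connectedComponentIn_subset _ _ h
  exact this

lemma lt_of_component_nonempty {f : Y → ℝ} {c : ℝ} {p q : Y}
    (h : q ∈ connectedComponentIn {y | f y < c} p) : f p < c := by
  by_contra hn
  have hn' : p ∉ {y | f y < c} := hn
  rw [connectedComponentIn_eq_empty hn'] at h
  exact h

lemma component_mono (f : Y → ℝ) {c c' : ℝ} (h : c ≤ c') (p : Y) :
    connectedComponentIn {y | f y < c} p ⊆ connectedComponentIn {y | f y < c'} p :=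
  connectedComponentIn_mono p fun _ hw => lt_of_lt_of_le hw h

/-- If every point is a strict local minimum or a pass, then a connected component `A` of the open
sublevel set `{f < c}` does not touch the rest of `{f ≤ c}`: its closure is relatively open there. -/
lemma isClosed_diff_closure_component [T2Space Y] [LocallyConnectedSpace Y] {f : Y → ℝ}
    (hf : Continuous f) (hfin : {y | IsStrictMin f y}.Finite)
    (h : ∀ y, IsStrictMin f y ∨ IsPass f y) (c : ℝ) (p : Y) :
    IsClosed ({y | f y ≤ c} \ closure (connectedComponentIn {y | f y < c} p)) := by
  set A := connectedComponentIn {y | f y < c} p with hA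
  have hopen : IsOpen {y | f y < c} := isOpen_lt hf continuous_const
  have hAc : A ⊆ {y | f y < c} := connectedComponentIn_subset _ _
  have hcl : closure A ⊆ {y | f y ≤ c} :=
    by
    refine closure_minimal (fun y hy => ?_) (isClosed_le hf continuous_const)
    have hlt : f y < c := hAc hy
    exact hlt.le
  -- a point of `closure A` has a neighbourhood whose part in `{f ≤ c}` lies in `closure A`
  have key : ∀ y ∈ closure A, ∃ V ∈ 𝓝 y, V ∩ {y | f y ≤ c} ⊆ closure A := by
    intro y hy
    rcases lt_or_eq_of_le (show f y ≤ c from hcl hy) with hlt | heq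
    · have hB : connectedComponentIn {y | f y < c} y ∈ 𝓝 y :=
        hopen.connectedComponentIn.mem_nhds (mem_connectedComponentIn hlt)
      obtain ⟨z, hz1, hz2⟩ := mem_closure_iff_nhds.1 hy _ hB
      have e1 := connectedComponentIn_eq hz1
      have e2 := connectedComponentIn_eq hz2
      refine ⟨_, hB, fun w hw => subset_closure ?_⟩
      rw [hA, e2, ← e1]
      exact hw.1
    · rcases h y with ⟨V, hV, hVf⟩ | ⟨-, V, hV, C, hCf, hC, hVC⟩
      · obtain ⟨z, hz1, hz2⟩ := mem_closure_iff_nhds.1 hy V hV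
        have hzc : f z < c := hAc hz2
        have hne : z ≠ y := by rintro rfl; exact absurd heq hzc.ne
        have := hVf z hz1 hne
        linarith
      · rw [heq] at hCf hVC
        have hW : V ∩ ({y | IsStrictMin f y} \ {y})ᶜ ∈ 𝓝 y := by
          refine inter_mem hV ((hfin.subset sdiff_subset).isClosed.isOpen_compl.mem_nhds ?_)
          simp
        obtain ⟨z, hz1, hz2⟩ := mem_closure_iff_nhds.1 hy V hV
        have hCA : C ⊆ A := by
          have hzC : z ∈ C := hVC ⟨hz1, hAc hz2⟩
          have := hC.subset_connectedComponentIn hzC hCf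
          rwa [hA, connectedComponentIn_eq hz2]
        refine ⟨_, interior_mem_nhds.2 hW, ?_⟩
        rintro w ⟨hw, hwc⟩
        rcases lt_or_eq_of_le (show f w ≤ c from hwc) with hlt | heqw
        · exact subset_closure (hCA (hVC ⟨(interior_subset hw).1, hlt⟩))
        · by_cases hwy : w = y
          · exact hwy ▸ hy
          · have hns : ¬ IsStrictMin f w := fun hm => (interior_subset hw).2 ⟨hm, hwy⟩
            have hp : IsPass f w := (h w).resolve_left hns
            have : w ∈ closure (interior (V ∩ ({y | IsStrictMin f y} \ {y})ᶜ) ∩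
                {z | f z < f w}) :=
              isOpen_interior.inter_closure ⟨hw, hp.1⟩
            refine closure_mono ?_ this
            rintro v ⟨hv, hvf⟩
            rw [heqw] at hvf
            exact hCA (hVC ⟨(interior_subset hv).1, hvf⟩)
  rw [← isOpen_compl_iff, isOpen_iff_mem_nhds]
  intro y hy
  by_cases hyc : f y ≤ c
  · have hyA : y ∈ closure A := by
      by_contra hn
      exact hy ⟨hyc, hn⟩
    obtain ⟨V, hV, hVs⟩ := key y hyA
    filter_upwards [hV] with w hw hw'
    exact hw'.2 (hVs ⟨hw, hw'.1⟩)
  · filter_upwards [(isOpen_lt continuous_const hf).mem_nhds (not_le.1 hyc)] with w hw hw'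
    exact absurd hw'.1 (not_le.2 hw)

/-- Disjoint closed pieces of `{f ≤ c}` stay in different components of `{f < c'}` for `c'` slightly
above `c`. -/
lemma exists_gt_not_mem_component [CompactSpace Y] [T2Space Y] {f : Y → ℝ} (hf : Continuous f)
    {c : ℝ} {D D' : Set Y} (hD : IsClosed D) (hD' : IsClosed D') (hdisj : Disjoint D D')
    (hcov : {y | f y ≤ c} ⊆ D ∪ D') {p q : Y} (hp : p ∈ D) (hq : q ∈ D') :
    ∃ c' > c, ∀ c'' < c', q ∉ connectedComponentIn {y | f y < c''} p := by
  obtain ⟨U, U', hU, hU', hDU, hDU', hUU⟩ :=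
    SeparatedNhds.of_isCompact_isCompact hD.isCompact hD'.isCompact hdisj
  have hK : IsCompact (U ∪ U')ᶜ := (hU.union hU').isClosed_compl.isCompact
  have hgt : ∀ y ∈ (U ∪ U')ᶜ, c < f y := by
    intro y hy
    by_contra hn
    exact hy ((union_subset_union hDU hDU') (hcov (not_lt.1 hn)))
  have hex : ∃ c' > c, ∀ y ∈ (U ∪ U')ᶜ, c' ≤ f y := by
    rcases (U ∪ U')ᶜ.eq_empty_or_nonempty with he | hne
    · exact ⟨c + 1, by linarith, by simp [he]⟩
    · obtain ⟨m, hm, hmin⟩ := hK.exists_isMinOn hne hf.continuousOn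
      exact ⟨f m, hgt m hm, fun y hy => hmin hy⟩
  obtain ⟨c', hc', hmin⟩ := hex
  refine ⟨c', hc', fun c'' hc'' hmem => ?_⟩
  have hsub : connectedComponentIn {y | f y < c''} p ⊆ U ∪ U' := by
    intro y hy
    by_contra hn
    have h1 := hmin y hn
    have h2 : f y < c'' := lt_of_mem_component hy
    linarith
  have hpm : p ∈ connectedComponentIn {y | f y < c''} p :=
    mem_connectedComponentIn (lt_of_component_nonempty hmem)
  have := isPreconnected_connectedComponentIn.subset_left_of_subset_union hU hU' hUU hsub
    ⟨p, hpm, hDU hp⟩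
  exact hUU.le_bot ⟨this hmem, hDU' hq⟩

/-- A component of `{f < c}` is exhausted by components of the smaller sublevel sets. -/
lemma exists_lt_mem_component [LocallyConnectedSpace Y] {f : Y → ℝ} (hf : Continuous f)
    {c : ℝ} {p q : Y} (hq : q ∈ connectedComponentIn {y | f y < c} p) :
    ∃ c' < c, q ∈ connectedComponentIn {y | f y < c'} p := by
  have hopen : ∀ c, IsOpen {y | f y < c} := fun c => isOpen_lt hf continuous_const
  have hp : f p < c := lt_of_component_nonempty hq
  have := isPreconnected_connectedComponentIn.induction₂ (s := connectedComponentIn {y | f y < c} p)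
    (fun x y => ∃ c' < c, y ∈ connectedComponentIn {y | f y < c'} x) ?_ ?_ ?_
    (mem_connectedComponentIn hp) hq
  · exact this
  · intro x hx
    have hxc : f x < c := lt_of_mem_component hx
    obtain ⟨c', h1, h2⟩ := exists_between hxc
    filter_upwards [mem_nhdsWithin_of_mem_nhds
      ((hopen c').connectedComponentIn.mem_nhds (mem_connectedComponentIn h1))] with y hy
    exact ⟨c', h2, hy⟩
  · rintro x y z - - - ⟨c1, h1, hy⟩ ⟨c2, h2, hz⟩
    refine ⟨max c1 c2, max_lt h1 h2, ?_⟩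
    rw [connectedComponentIn_eq (component_mono f (le_max_left c1 c2) x hy)]
    exact component_mono f (le_max_right c1 c2) y hz
  · rintro x y - - ⟨c1, h1, hy⟩
    refine ⟨c1, h1, ?_⟩
    rw [← connectedComponentIn_eq hy]
    exact mem_connectedComponentIn (lt_of_component_nonempty hy)

/-- On a compact connected space, a continuous function all of whose points are strict local minima
or passes has at most one strict local minimum. -/
theorem IsStrictMin.unique [CompactSpace Y] [T2Space Y] [ConnectedSpace Y]
    [LocallyConnectedSpace Y] {f : Y → ℝ} (hf : Continuous f)
    (hfin : {y | IsStrictMin f y}.Finite) (h : ∀ y, IsStrictMin f y ∨ IsPass f y)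
    {p q : Y} (hp : IsStrictMin f p) (hq : IsStrictMin f q) : p = q := by
  wlog hpq : f p ≤ f q generalizing p q
  · exact (this hq hp (not_le.1 hpq).le).symm
  by_contra hne
  -- `c₀` is the lowest level at which `p` and `q` become connected in the sublevel set.
  set S : Set ℝ := {c | q ∈ connectedComponentIn {y | f y < c} p} with hS
  have hSlow : ∀ c ∈ S, f q < c := fun c hc => lt_of_mem_component hc
  obtain ⟨m, -, hm⟩ := isCompact_univ.exists_isMaxOn ⟨p, mem_univ p⟩ hf.continuousOn
  have hSne : S.Nonempty := by
    refine ⟨f m + 1, ?_⟩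
    have : {y | f y < f m + 1} = univ := by
      refine eq_univ_of_forall fun y => ?_
      have : f y ≤ f m := hm (mem_univ y)
      simp only [mem_ofPred_eq]; linarith
    rw [hS, mem_ofPred_eq, this, connectedComponentIn_univ, PreconnectedSpace.connectedComponent_eq_univ]
    trivial
  have hSbdd : BddBelow S := ⟨f q, fun c hc => (hSlow c hc).le⟩
  set c₀ := sInf S with hc₀
  have hqc : f q ≤ c₀ := le_csInf hSne fun c hc => (hSlow c hc).le
  have hSup : ∀ c > c₀, c ∈ S := by
    intro c hc
    obtain ⟨c', hc', hlt⟩ := exists_lt_of_csInf_lt hSne hc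
    exact component_mono f hlt.le p hc'
  have contra : ∀ D D' : Set Y, IsClosed D → IsClosed D' → Disjoint D D' →
      {y | f y ≤ c₀} ⊆ D ∪ D' → p ∈ D → q ∈ D' → False := by
    intro D D' h1 h2 h3 h4 h5 h6
    obtain ⟨c', hc', hno⟩ := exists_gt_not_mem_component hf h1 h2 h3 h4 h5 h6
    obtain ⟨c, hc1, hc2⟩ := exists_between hc'
    exact hno c hc2 (hSup c hc1)
  have hle : IsClosed {y | f y ≤ c₀} := isClosed_le hf continuous_const
  rcases eq_or_lt_of_le hqc with heq | hlt
  · obtain ⟨V, hV, hVf⟩ := hq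
    refine contra ({y | f y ≤ c₀} \ interior V) {q} (hle.sdiff isOpen_interior) isClosed_singleton ?_ ?_ ?_
      rfl
    · rw [disjoint_singleton_right]
      exact fun hh => hh.2 (mem_interior_iff_mem_nhds.2 hV)
    · intro y hy
      by_cases hyq : y = q
      · exact Or.inr hyq
      · refine Or.inl ⟨hy, fun hyV => ?_⟩
        have h1 := hVf y (interior_subset hyV) hyq
        have h2 : f y ≤ c₀ := hy
        linarith
    · refine ⟨hpq.trans hqc, fun hpV => ?_⟩
      have := hVf p (interior_subset hpV) hne
      linarith
  · by_cases hqA : q ∈ connectedComponentIn {y | f y < c₀} p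
    · obtain ⟨c', hc', hmem⟩ := exists_lt_mem_component hf hqA
      exact absurd (csInf_le hSbdd hmem) (not_le.2 hc')
    · have hopen : IsOpen {y | f y < c₀} := isOpen_lt hf continuous_const
      refine contra _ _ isClosed_closure (isClosed_diff_closure_component hf hfin h c₀ p)
        disjoint_sdiff_right ?_ (subset_closure (mem_connectedComponentIn (hpq.trans_lt hlt)))
        ⟨hqc, fun hcl => hqA ?_⟩
      · intro y hy
        by_cases hyA : y ∈ closure (connectedComponentIn {y | f y < c₀} p)
        · exact Or.inl hyA
        · exact Or.inr ⟨hy, hyA⟩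
      · obtain ⟨z, hz1, hz2⟩ := mem_closure_iff_nhds.1 hcl _
          (hopen.connectedComponentIn.mem_nhds (mem_connectedComponentIn hlt))
        rw [connectedComponentIn_eq hz2, ← connectedComponentIn_eq hz1]
        exact mem_connectedComponentIn hlt

end MountainPass

/-! ### Sublevel sets near regular points and nondegenerate critical points -/

section LocalPass

/-- The local form of `IsPass`: the connected pieces of `{f < f y}` can be found inside any given
neighbourhood of `y`. -/
def IsLocalPass {Y : Type*} [TopologicalSpace Y] (f : Y → ℝ) (y : Y) : Prop :=
  y ∈ closure {z | f z < f y} ∧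
    ∀ U ∈ 𝓝 y, ∃ V ∈ 𝓝 y, ∃ C ⊆ U ∩ {z | f z < f y}, IsPreconnected C ∧ V ∩ {z | f z < f y} ⊆ C

lemma IsLocalPass.isPass {Y : Type*} [TopologicalSpace Y] {f : Y → ℝ} {y : Y}
    (h : IsLocalPass f y) : IsPass f y := by
  obtain ⟨V, hV, C, hC, h1, h2⟩ := h.2 univ univ_mem
  exact ⟨h.1, V, hV, C, hC.trans inter_subset_right, h1, h2⟩

variable {N Y : Type*} [TopologicalSpace N] [TopologicalSpace Y]

lemma IsLocalPass.of_comp {f : Y → ℝ} {ψ : N → Y} {x : N}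
    (hcont : ∀ᶠ z in 𝓝 x, ContinuousAt ψ z) (hmap : map ψ (𝓝 x) = 𝓝 (ψ x))
    (h : IsLocalPass (f ∘ ψ) x) : IsLocalPass f (ψ x) := by
  refine ⟨?_, fun U hU => ?_⟩
  · rw [mem_closure_iff_nhds]
    intro W hW
    rw [← hmap] at hW
    obtain ⟨z, hz1, hz2⟩ := mem_closure_iff_nhds.1 h.1 _ hW
    exact ⟨ψ z, hz1, hz2⟩
  · have hU' : ψ ⁻¹' U ∩ {z | ContinuousAt ψ z} ∈ 𝓝 x := by
      refine inter_mem ?_ hcont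
      rw [← hmap] at hU
      exact hU
    obtain ⟨V, hV, C, hC, h1, h2⟩ := h.2 _ hU'
    refine ⟨ψ '' V, ?_, ψ '' C, ?_, h1.image _ fun z hz => (hC hz).1.2.continuousWithinAt, ?_⟩
    · rw [← hmap]
      exact image_mem_map hV
    · rintro _ ⟨z, hz, rfl⟩
      exact ⟨(hC hz).1.1, (hC hz).2⟩
    · rintro _ ⟨⟨z, hz, rfl⟩, hlt⟩
      exact mem_image_of_mem _ (h2 ⟨hz, hlt⟩)

lemma IsStrictMin.of_comp {f : Y → ℝ} {ψ : N → Y} {x : N}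
    (hmap : map ψ (𝓝 x) = 𝓝 (ψ x)) (h : IsStrictMin (f ∘ ψ) x) : IsStrictMin f (ψ x) := by
  obtain ⟨V, hV, hVf⟩ := h
  refine ⟨ψ '' V, ?_, ?_⟩
  · rw [← hmap]
    exact image_mem_map hV
  · rintro _ ⟨z, hz, rfl⟩ hne
    exact hVf z hz (by rintro rfl; exact hne rfl)

/-- A union of preconnected sets, one through each point of a set `P`, all meeting the preconnected
set `C₀`. -/
lemma isPreconnected_union_biUnion {P : Set N} {s : N → Set N} {C₀ : Set N}
    (h0 : IsPreconnected C₀) (hs : ∀ x ∈ P, IsPreconnected (s x))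
    (hm : ∀ x ∈ P, (s x ∩ C₀).Nonempty) : IsPreconnected (C₀ ∪ ⋃ x ∈ P, s x) := by
  rcases C₀.eq_empty_or_nonempty with he | ⟨c, hc⟩
  · have hP : P = ∅ := by
      rw [eq_empty_iff_forall_notMem]
      intro x hx
      have := hm x hx
      simp [he] at this
    simp [he, hP, isPreconnected_empty]
  · refine isPreconnected_of_forall c fun y hy => ?_
    rcases hy with hy | hy
    · exact ⟨C₀, subset_union_left, hc, hy, h0⟩
    · simp only [mem_iUnion] at hy
      obtain ⟨x, hx, hy⟩ := hy
      obtain ⟨m, hm1, hm2⟩ := hm x hx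
      exact ⟨C₀ ∪ s x, union_subset_union_right _ (subset_biUnion_of_mem hx), Or.inl hc, Or.inr hy,
        h0.union m hm2 hm1 (hs x hx)⟩

end LocalPass

section NormedSpace

variable {N : Type*} [NormedAddCommGroup N] [NormedSpace ℝ N]

/-- A regular point of a function is a pass: near it, every point of the sublevel set can be moved
in a descending direction into a fixed small ball contained in the sublevel set. -/
lemma isLocalPass_of_hasStrictFDerivAt {h : N → ℝ} {ℓ : N →L[ℝ] ℝ}
    (hd : HasStrictFDerivAt h ℓ 0) (hℓ : ℓ ≠ 0) : IsLocalPass h 0 := by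
  obtain ⟨u, hu⟩ : ∃ u, ℓ u = -1 := by
    obtain ⟨w, hw⟩ : ∃ w, ℓ w ≠ 0 := by
      by_contra hn
      push Not at hn
      exact hℓ (ContinuousLinearMap.ext hn)
    exact ⟨(-(ℓ w)⁻¹) • w, by simp [hw]⟩
  have hu0 : u ≠ 0 := by rintro rfl; simp at hu
  have hun : 0 < ‖u‖ := norm_pos_iff.2 hu0
  have hb := (hd.isLittleO.def (show (0:ℝ) < 1 / (2 * ‖u‖) by positivity))
  obtain ⟨r, hr, hball⟩ := Metric.eventually_nhds_iff.1 hb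
  -- moving along `u` decreases `h`
  have hdec : ∀ x s, 0 ≤ s → ‖x‖ < r → ‖x + s • u‖ < r → h (x + s • u) ≤ h x - s / 2 := by
    intro x s hs hx hxs
    have := @hball (x + s • u, x) (by
      rw [Prod.dist_eq, dist_zero_right, dist_zero_right]
      exact max_lt hxs hx)
    simp only [add_sub_cancel_left, map_smul, hu, norm_smul, Real.norm_eq_abs, smul_eq_mul,
      abs_of_nonneg hs] at this
    have e : 1 / (2 * ‖u‖) * (s * ‖u‖) = s / 2 := by field_simp
    rw [e] at this
    linarith [(abs_le.1 this).2]
  refine ⟨?_, fun U hU => ?_⟩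
  · rw [mem_closure_iff_nhds]
    intro W hW
    have hcont : Tendsto (fun s : ℝ => (0 : N) + s • u) (𝓝[>] 0) (𝓝 0) := by
      have : Continuous fun s : ℝ => (0 : N) + s • u := by fun_prop
      have h2 := this.tendsto 0
      simp only [zero_smul, add_zero] at h2
      exact h2.mono_left nhdsWithin_le_nhds
    have h1 := hcont.eventually hW
    have h2 := hcont.eventually (Metric.ball_mem_nhds (0 : N) hr)
    obtain ⟨s, ⟨hs1, hs2⟩, hs3⟩ := ((h1.and h2).and self_mem_nhdsWithin).exists
    refine ⟨_, hs1, ?_⟩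
    have hs3' : (0 : ℝ) < s := hs3
    have := hdec 0 s hs3'.le (by simpa using hr) (by simpa using hs2)
    show h _ < h 0
    linarith
  · obtain ⟨ρ, hρ, hρU⟩ := Metric.mem_nhds_iff.1 (inter_mem hU (Metric.ball_mem_nhds (0:N) hr))
    -- the length `s₀` of the move, and the radius `δ` of the ball to be moved
    set s₀ := ρ / (2 * ‖u‖) with hs₀
    have hs₀p : 0 < s₀ := by positivity
    have hsu : s₀ * ‖u‖ = ρ / 2 := by rw [hs₀]; field_simp
    have hc : ContinuousAt h 0 := hd.hasFDerivAt.continuousAt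
    obtain ⟨δ, hδ, hδh⟩ := Metric.continuousAt_iff.1 hc (s₀ / 2) (by positivity)
    set δ' := min δ (ρ / 2) with hδ'
    have hδ'p : 0 < δ' := by positivity
    have hin : ∀ x ∈ ball (0:N) δ', ∀ s ∈ Icc 0 s₀, ‖x + s • u‖ < ρ := by
      intro x hx s hs
      rw [mem_ball_zero_iff] at hx
      have h1 : ‖s • u‖ ≤ ρ / 2 := by
        rw [norm_smul, Real.norm_eq_abs, abs_of_nonneg hs.1, ← hsu]
        exact mul_le_mul_of_nonneg_right hs.2 hun.le
      have h2 := norm_add_le x (s • u)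
      have h3 : δ' ≤ ρ / 2 := min_le_right _ _
      linarith
    have hmem : ∀ z : N, ‖z‖ < ρ → z ∈ U ∧ ‖z‖ < r := by
      intro z hz
      have := hρU (mem_ball_zero_iff.2 hz)
      exact ⟨this.1, by simpa using this.2⟩
    have hxr : ∀ x ∈ ball (0:N) δ', ‖x‖ < r := by
      intro x hx
      have := hin x hx 0 ⟨le_rfl, hs₀p.le⟩
      rw [zero_smul, add_zero] at this
      exact (hmem _ this).2
    refine ⟨ball 0 δ', ball_mem_nhds _ hδ'p, ((fun x => x + s₀ • u) '' ball 0 δ') ∪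
      ⋃ x ∈ ball (0:N) δ' ∩ {z | h z < h 0}, (fun s : ℝ => x + s • u) '' Icc 0 s₀, ?_, ?_, ?_⟩
    · rintro z (⟨x, hx, rfl⟩ | hz)
      · have h1 := hin x hx s₀ ⟨hs₀p.le, le_rfl⟩
        refine ⟨(hmem _ h1).1, ?_⟩
        have h2 := hdec x s₀ hs₀p.le (hxr x hx) (hmem _ h1).2
        have h3 : dist (h x) (h 0) < s₀ / 2 := by
          refine hδh ?_
          exact lt_of_lt_of_le hx (min_le_left _ _)
        rw [Real.dist_eq] at h3
        show h _ < h 0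
        linarith [(abs_lt.1 h3).2]
      · simp only [mem_iUnion] at hz
        obtain ⟨x, ⟨hx, hx0⟩, s, hs, rfl⟩ := hz
        have h1 := hin x hx s hs
        refine ⟨(hmem _ h1).1, ?_⟩
        have h2 := hdec x s hs.1 (hxr x hx) (hmem _ h1).2
        have h3 : h x < h 0 := hx0
        show h _ < h 0
        linarith [hs.1]
    · refine isPreconnected_union_biUnion ?_ ?_ ?_
      · exact (convex_ball (0:N) δ').isPreconnected.image _ (by fun_prop)
      · intro x _
        exact isPreconnected_Icc.image _ (by fun_prop)
      · rintro x ⟨hx, -⟩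
        exact ⟨x + s₀ • u, ⟨s₀, ⟨hs₀p.le, le_rfl⟩, rfl⟩, ⟨x, hx, rfl⟩⟩
    · rintro x ⟨hx, hx0⟩
      refine Or.inr ?_
      simp only [mem_iUnion]
      exact ⟨x, ⟨hx, hx0⟩, 0, ⟨le_rfl, hs₀p.le⟩, by simp⟩

/-- Near a critical point, increments of a function are close to those of its quadratic part. -/
lemma exists_abs_sub_quadratic_le {h : N → ℝ} {D : N → N →L[ℝ] ℝ} {B : N →L[ℝ] N →L[ℝ] ℝ}
    (hD : ∀ᶠ z in 𝓝 0, HasFDerivAt h (D z) z) (hD0 : D 0 = 0) (hB : HasFDerivAt D B 0)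
    (hsymm : ∀ z v, B z v = B v z) {ε : ℝ} (hε : 0 < ε) :
    ∃ r > 0, ∀ x y : N, ‖x‖ < r → ‖y‖ < r →
      |h x - h y - (B x x - B y y) / 2| ≤ ε * max ‖x‖ ‖y‖ * ‖x - y‖ := by
  have hb := hB.isLittleO.def hε
  obtain ⟨r, hr, hball⟩ := Metric.eventually_nhds_iff.1 (hb.and hD)
  refine ⟨r, hr, fun x y hx hy => ?_⟩
  have hder : ∀ z : N, ‖z‖ < r → HasFDerivAt (fun z => h z - B z z / 2) (D z - B z) z := by
    intro z hz
    have h1 := (hball (by simpa using hz)).2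
    have h2 : HasFDerivAt (fun z => B z z / 2) (B z) z := by
      have := (B.hasFDerivAt (x := z)).clm_apply (hasFDerivAt_id z)
      have := this.mul_const (1 / 2 : ℝ)
      refine (this.congr_fderiv ?_).congr_of_eventuallyEq (Eventually.of_forall fun z => by
        simp [div_eq_mul_inv])
      ext v
      simp [hsymm v z]
      ring
    exact h1.sub h2
  have hconv : Convex ℝ (closedBall (0:N) (max ‖x‖ ‖y‖)) := convex_closedBall _ _
  have := hconv.norm_image_sub_le_of_norm_hasFDerivWithin_le (f := fun z => h z - B z z / 2)
    (f' := fun z => D z - B z) (C := ε * max ‖x‖ ‖y‖) (x := y) (y := x) ?_ ?_ ?_ ?_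
  · rw [Real.norm_eq_abs] at this
    convert this using 2
    ring
  · intro z hz
    rw [mem_closedBall_zero_iff] at hz
    exact (hder z (hz.trans_lt (max_lt hx hy))).hasFDerivWithinAt
  · intro z hz
    rw [mem_closedBall_zero_iff] at hz
    have h1 := (hball (by simpa using hz.trans_lt (max_lt hx hy))).1
    rw [hD0] at h1
    simp only [sub_zero] at h1
    exact h1.trans (by gcongr)
  · simp
  · simp

end NormedSpace

section Saddle

variable {A B : Type*} [NormedAddCommGroup A] [NormedSpace ℝ A]
  [NormedAddCommGroup B] [NormedSpace ℝ B]

/-- A nondegenerate critical point of index `≥ 2`, in coordinates `(a, b)` in which the Hessian is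
`‖b‖² - ‖a‖²`, is a pass: the points of the sublevel set are moved away from the origin in the
`a`-direction, until they reach the product of a sphere and a small ball. -/
lemma isLocalPass_of_saddle {h : A × B → ℝ} {D : A × B → A × B →L[ℝ] ℝ}
    {H : A × B →L[ℝ] A × B →L[ℝ] ℝ}
    (hD : ∀ᶠ z in 𝓝 0, HasFDerivAt h (D z) z) (hD0 : D 0 = 0) (hH : HasFDerivAt D H 0)
    (hsymm : ∀ z v, H z v = H v z) (hQ : ∀ z, H z z = 2 * (‖z.2‖ ^ 2 - ‖z.1‖ ^ 2))
    (hA : 1 < Module.rank ℝ A) : IsLocalPass h 0 := by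
  obtain ⟨r, hr, hest⟩ := exists_abs_sub_quadratic_le hD hD0 hH hsymm (show (0:ℝ) < 1/8 by norm_num)
  have hest0 : ∀ x : A × B, ‖x‖ < r →
      |h x - h 0 - (‖x.2‖ ^ 2 - ‖x.1‖ ^ 2)| ≤ 1 / 8 * ‖x‖ ^ 2 := by
    intro x hx
    have := hest x 0 hx (by simpa using hr)
    rw [hQ x] at this
    simp only [map_zero, sub_zero, norm_zero] at this
    rw [max_eq_left (norm_nonneg x)] at this
    have e : 2 * (‖x.2‖ ^ 2 - ‖x.1‖ ^ 2) / 2 = ‖x.2‖ ^ 2 - ‖x.1‖ ^ 2 := by ring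
    rw [e] at this
    linarith
  -- points with `‖b‖ ≤ ‖a‖ / 2` lie in the sublevel set
  have hneg : ∀ a : A, ∀ b : B, a ≠ 0 → ‖a‖ < r → ‖b‖ ≤ ‖a‖ / 2 → h (a, b) < h 0 := by
    intro a b ha har hba
    have hap : 0 < ‖a‖ := norm_pos_iff.2 ha
    have hn : ‖(a, b)‖ = ‖a‖ := by
      rw [Prod.norm_def]; exact max_eq_left (by simp only; linarith)
    have := hest0 (a, b) (by rw [hn]; exact har)
    rw [hn] at this
    have h1 := (abs_le.1 this).2
    have h2 : ‖b‖ ^ 2 ≤ (‖a‖ / 2) ^ 2 := by gcongr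
    simp only at h1
    nlinarith
  have hcone : ∀ a : A, ∀ b : B, ‖(a, b)‖ < r → h (a, b) < h 0 → ‖b‖ ≤ 2 * ‖a‖ := by
    intro a b hab hlt
    by_contra hn
    push Not at hn
    have hna := norm_nonneg a
    have hn' : ‖(a, b)‖ = ‖b‖ := by
      rw [Prod.norm_def]; exact max_eq_right (by simp only; linarith)
    have := hest0 (a, b) hab
    rw [hn'] at this
    have h1 := (abs_le.1 this).1
    simp only at h1
    nlinarith
  have hmove : ∀ a : A, ∀ b : B, ∀ s : ℝ, 1 ≤ s → ‖(a, b)‖ < r → ‖(s • a, b)‖ < r →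
      h (a, b) < h 0 → h (s • a, b) < h 0 := by
    intro a b s hs hab hsab hlt
    have hb := hcone a b hab hlt
    have hna := norm_nonneg a
    have hsa : ‖s • a‖ = s * ‖a‖ := by
      rw [norm_smul, Real.norm_eq_abs, abs_of_nonneg (by linarith)]
    have key := hest (s • a, b) (a, b) hsab hab
    rw [hQ, hQ] at key
    have h1 : ‖(s • a, b) - (a, b)‖ = (s - 1) * ‖a‖ := by
      rw [Prod.mk_sub_mk, sub_self, Prod.norm_def]
      simp only [norm_zero]
      rw [max_eq_left (norm_nonneg _)]
      have : s • a - a = (s - 1) • a := by rw [sub_smul, one_smul]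
      rw [this, norm_smul, Real.norm_eq_abs, abs_of_nonneg (by linarith)]
    have h2 : max ‖(s • a, b)‖ ‖(a, b)‖ ≤ 2 * s * ‖a‖ := by
      simp only [Prod.norm_def, hsa]
      have : ‖a‖ ≤ s * ‖a‖ := le_mul_of_one_le_left hna hs
      refine max_le (max_le ?_ ?_) (max_le ?_ ?_) <;> nlinarith
    rw [h1] at key
    have h3 : 1 / 8 * max ‖(s • a, b)‖ ‖(a, b)‖ * ((s - 1) * ‖a‖) ≤
        1 / 8 * (2 * s * ‖a‖) * ((s - 1) * ‖a‖) := by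
      have : 0 ≤ (s - 1) * ‖a‖ := mul_nonneg (by linarith) hna
      gcongr
    have h4 := (abs_le.1 (key.trans h3)).2
    simp only [hsa] at h4
    nlinarith [mul_nonneg (sub_nonneg.2 hs) (sq_nonneg ‖a‖),
      mul_nonneg (mul_nonneg (sub_nonneg.2 hs) (sub_nonneg.2 hs)) (sq_nonneg ‖a‖)]
  have hnt : ∃ a : A, a ≠ 0 := by
    by_contra hn
    push Not at hn
    have : Subsingleton A := ⟨fun x y => by rw [hn x, hn y]⟩
    rw [rank_subsingleton'] at hA
    exact absurd hA (by simp)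
  refine ⟨?_, fun U hU => ?_⟩
  · obtain ⟨a, ha⟩ := hnt
    rw [mem_closure_iff_nhds]
    intro W hW
    have hcont : Tendsto (fun s : ℝ => ((s • a, 0) : A × B)) (𝓝[>] 0) (𝓝 0) := by
      have : Continuous fun s : ℝ => ((s • a, 0) : A × B) := by fun_prop
      have h2 := this.tendsto 0
      simp only [zero_smul] at h2
      exact h2.mono_left nhdsWithin_le_nhds
    have h1 := hcont.eventually hW
    have h2 := hcont.eventually (Metric.ball_mem_nhds (0 : A × B) hr)
    obtain ⟨s, ⟨hs1, hs2⟩, hs3⟩ := ((h1.and h2).and self_mem_nhdsWithin).exists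
    have hs3' : (0 : ℝ) < s := hs3
    refine ⟨_, hs1, hneg _ _ (smul_ne_zero hs3'.ne' ha) ?_ (by rw [norm_zero]; positivity)⟩
    rw [dist_zero_right] at hs2
    exact (le_max_left _ _).trans_lt hs2
  · obtain ⟨ρ, hρ, hρU⟩ := Metric.mem_nhds_iff.1
      (inter_mem hU (Metric.ball_mem_nhds (0 : A × B) hr))
    have hmem : ∀ z : A × B, ‖z‖ < ρ → z ∈ U ∧ ‖z‖ < r := by
      intro z hz
      have := hρU (mem_ball_zero_iff.2 hz)
      exact ⟨this.1, by simpa using this.2⟩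
    set δ := ρ / 2 with hδ
    have hδp : 0 < δ := by positivity
    have hx0 : ∀ x ∈ ball (0 : A × B) (δ / 2) ∩ {z | h z < h 0},
        0 < ‖x.1‖ ∧ ‖x.1‖ < δ / 2 ∧ ‖x.2‖ < δ / 2 := by
      rintro ⟨a, b⟩ ⟨hx, hlt⟩
      rw [mem_ball_zero_iff] at hx
      have hb := hcone a b (hmem _ (by linarith)).2 hlt
      refine ⟨?_, (le_max_left _ _).trans_lt hx, (le_max_right _ _).trans_lt hx⟩
      rw [norm_pos_iff]
      rintro rfl
      have : b = 0 := by simpa using hb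
      rw [this] at hlt
      exact lt_irrefl (h 0) hlt
    refine ⟨ball 0 (δ / 2), ball_mem_nhds _ (by positivity), (sphere (0:A) δ ×ˢ ball (0:B) (δ / 2)) ∪
      ⋃ x ∈ ball (0 : A × B) (δ / 2) ∩ {z | h z < h 0},
        (fun s : ℝ => (s • x.1, x.2)) '' Icc 1 (δ / ‖x.1‖), ?_, ?_, ?_⟩
    · rintro z (⟨hz1, hz2⟩ | hz)
      · rw [mem_sphere_zero_iff_norm] at hz1
        rw [mem_ball_zero_iff] at hz2
        have hzn : ‖z‖ < ρ := by
          rw [Prod.norm_def]; exact max_lt (by linarith) (by linarith)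
        refine ⟨(hmem z hzn).1, ?_⟩
        refine hneg z.1 z.2 ?_ ?_ (by rw [hz1]; exact hz2.le)
        · rw [← norm_pos_iff, hz1]; exact hδp
        · exact (le_max_left _ _).trans_lt (hmem z hzn).2
      · simp only [mem_iUnion] at hz
        obtain ⟨x, hx, s, hs, rfl⟩ := hz
        obtain ⟨h1, h2, h3⟩ := hx0 x hx
        have hsn : ‖s • x.1‖ ≤ δ := by
          rw [norm_smul, Real.norm_eq_abs, abs_of_nonneg (by linarith [hs.1])]
          exact (le_div_iff₀ h1).1 hs.2
        have hzn : ‖(s • x.1, x.2)‖ < ρ := by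
          rw [Prod.norm_def]; exact max_lt (by simp only; linarith) (by simp only; linarith)
        refine ⟨(hmem _ hzn).1, ?_⟩
        refine hmove x.1 x.2 s hs.1 ?_ (hmem _ hzn).2 hx.2
        have := hx.1
        rw [mem_ball_zero_iff] at this
        exact (hmem x (by linarith)).2
    · refine isPreconnected_union_biUnion ?_ ?_ ?_
      · exact (isPreconnected_sphere hA 0 δ).prod (convex_ball (0:B) (δ / 2)).isPreconnected
      · intro x _
        exact isPreconnected_Icc.image _ (by fun_prop)
      · intro x hx
        obtain ⟨h1, h2, h3⟩ := hx0 x hx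
        have hge : 1 ≤ δ / ‖x.1‖ := by rw [le_div_iff₀ h1]; linarith
        refine ⟨((δ / ‖x.1‖) • x.1, x.2), ⟨_, ⟨hge, le_rfl⟩, rfl⟩, ?_, ?_⟩
        · rw [mem_sphere_zero_iff_norm, norm_smul, Real.norm_eq_abs, abs_of_nonneg (by positivity)]
          field_simp
        · rw [mem_ball_zero_iff]; exact h3
    · intro x hx
      obtain ⟨h1, h2, h3⟩ := hx0 x hx
      have hge : 1 ≤ δ / ‖x.1‖ := by rw [le_div_iff₀ h1]; linarith
      refine Or.inr ?_
      simp only [mem_iUnion]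
      exact ⟨x, hx, 1, ⟨le_rfl, hge⟩, by simp⟩

/-- A critical point with positive definite Hessian is a strict local minimum. The first factor `A`
is trivial; it is kept so that the coordinates are those of `isLocalPass_of_saddle`. -/
lemma isStrictMin_of_hessian {h : A × B → ℝ} {D : A × B → A × B →L[ℝ] ℝ}
    {H : A × B →L[ℝ] A × B →L[ℝ] ℝ}
    (hD : ∀ᶠ z in 𝓝 0, HasFDerivAt h (D z) z) (hD0 : D 0 = 0) (hH : HasFDerivAt D H 0)
    (hsymm : ∀ z v, H z v = H v z) (hQ : ∀ z, H z z = 2 * (‖z.2‖ ^ 2 - ‖z.1‖ ^ 2))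
    [Subsingleton A] : IsStrictMin h 0 := by
  obtain ⟨r, hr, hest⟩ := exists_abs_sub_quadratic_le hD hD0 hH hsymm (show (0:ℝ) < 1/8 by norm_num)
  refine ⟨ball 0 r, ball_mem_nhds _ hr, fun z hz hne => ?_⟩
  rw [mem_ball_zero_iff] at hz
  have := hest z 0 hz (by simpa using hr)
  have hz1 : z.1 = 0 := Subsingleton.elim _ _
  have hzn : ‖z‖ = ‖z.2‖ := by rw [Prod.norm_def, hz1, norm_zero, max_eq_right (norm_nonneg _)]
  have hp : 0 < ‖z‖ := norm_pos_iff.2 hne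
  rw [hQ z] at this
  simp only [map_zero, sub_zero, norm_zero] at this
  rw [max_eq_left (norm_nonneg z), hz1, norm_zero, ← hzn] at this
  have h1 := (abs_le.1 this).1
  nlinarith

end Saddle

/-! ### The torus, its characters and its two-torsion -/

section Torus

variable {n : ℕ}

@[simp] lemma torusExp_zero : torusExp (0 : Fin n → ℝ) = 1 := by
  ext j; simp [torusExp]

lemma torusExp_add (ξ η : Fin n → ℝ) : torusExp (ξ + η) = torusExp ξ * torusExp η := by
  ext j; simp [torusExp, Circle.exp_add]

lemma torusExp_neg (ξ : Fin n → ℝ) : torusExp (-ξ) = (torusExp ξ)⁻¹ := by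
  ext j; simp [torusExp, Circle.exp_neg]

lemma torusExp_surjective : Function.Surjective (torusExp (n := n)) := by
  intro g
  refine ⟨fun j => (g j : ℂ).arg, ?_⟩
  ext j
  simp [torusExp]

lemma continuous_torusExp : Continuous (torusExp (n := n)) :=
  continuous_pi fun j => Circle.exp.continuous.comp (continuous_apply j)

lemma torusExp_eq_one_of_int (k : Fin n → ℤ) :
    torusExp (fun j => k j * (2 * Real.pi)) = (1 : Torus n) := by
  ext j; simp [torusExp]

lemma torusExp_nsmul (m : ℕ) (ξ : Fin n → ℝ) : torusExp ((m : ℝ) • ξ) = torusExp ξ ^ m := by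
  induction m with
  | zero => simp
  | succ k ih => rw [pow_succ, ← ih, ← torusExp_add]; congr 1; push_cast; module

lemma contMDiff_torusExp :
    ContMDiff 𝓘(ℝ, Fin n → ℝ) (torusModel n) ∞ (torusExp (n := n)) := by
  intro ξ
  rw [contMDiffAt_iff]
  refine ⟨continuous_torusExp.continuousAt, ?_⟩
  rw [contDiffWithinAt_pi]
  intro j
  have h := contMDiffAt_iff.1 ((contMDiff_circleExp (m := ∞)).contMDiffAt (x := ξ j))
  have h2 := h.2
  simp only [extChartAt_model_space_eq_id, modelWithCornersSelf_coe, range_id,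
    contDiffWithinAt_univ] at h2 ⊢
  exact h2.comp ξ (f := fun ξ : Fin n → ℝ => ξ j) (contDiff_apply ℝ ℝ j).contDiffAt

lemma character_torusExp (a : Fin n → ℤ) (ξ : Fin n → ℝ) :
    character a (torusExp ξ) = Circle.exp (∑ j, a j * ξ j) := by
  have hs : ∀ s : Finset (Fin n), ∏ j ∈ s, Circle.exp (ξ j) ^ a j =
      Circle.exp (∑ j ∈ s, a j * ξ j) := by
    intro s
    induction s using Finset.induction_on with
    | empty => simp
    | insert i s hi ih =>
      rw [Finset.prod_insert hi, Finset.sum_insert hi, Circle.exp_add, ih]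
      congr 1
      exact (Circle.exp_intCast_mul _ _).symm
  exact hs Finset.univ

lemma continuous_character (a : Fin n → ℤ) : Continuous (character a) :=
  continuous_finsetProd _ fun j _ => (continuous_apply j).zpow _

lemma character_mul (a : Fin n → ℤ) (g h : Torus n) :
    character a (g * h) = character a g * character a h := by
  simp [character, mul_zpow, Finset.prod_mul_distrib]

lemma character_one (a : Fin n → ℤ) : character a (1 : Torus n) = 1 := by
  simp [character]

lemma circle_exp_pi_ne_one : Circle.exp Real.pi ≠ 1 := by
  rw [Ne, Circle.exp_eq_one]
  rintro ⟨m, hm⟩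
  have hpi := Real.pi_pos
  have : (1 : ℝ) = m * 2 := by
    have h2 : Real.pi * 1 = Real.pi * (m * 2) := by linarith
    exact mul_left_cancel₀ hpi.ne' h2
  have h3 : (1 : ℤ) = m * 2 := by exact_mod_cast this
  omega

lemma eq_zero_of_character_eq_one {a : Fin n → ℤ} (h : ∀ g, character a g = 1) : a = 0 := by
  by_contra hne
  obtain ⟨j, hj⟩ := Function.ne_iff.1 hne
  have h1 := h (torusExp (Pi.single j (Real.pi / a j)))
  rw [character_torusExp] at h1
  have h2 : ∑ i, (a i : ℝ) * (Pi.single j (Real.pi / a j) : Fin n → ℝ) i = Real.pi := by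
    rw [Finset.sum_eq_single j]
    · have : (a j : ℝ) ≠ 0 := by exact_mod_cast hj
      simp; field_simp
    · intro i _ hi; simp [hi]
    · simp
  rw [h2] at h1
  exact circle_exp_pi_ne_one h1

/-- `ξ` generates a dense one-parameter subgroup of the torus. -/
def IsGenerator (ξ : Fin n → ℝ) : Prop := Dense (range fun t : ℝ => torusExp (t • ξ))

/-- The torus has a dense one-parameter subgroup: for each nonempty open set `U` the elements with a
power in `U` form a dense open set, since large powers of a small cube cover the torus; apply the
Baire category theorem. -/
lemma exists_isGenerator (n : ℕ) : ∃ ξ : Fin n → ℝ, IsGenerator ξ := by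
  obtain ⟨b, hbc, hbe, hb⟩ := TopologicalSpace.exists_countable_basis (Torus n)
  have : Countable b := hbc.to_subtype
  have hd : Dense (⋂ U : b, ⋃ m : ℕ, (fun g : Torus n => g ^ m) ⁻¹' (U : Set (Torus n))) := by
    refine dense_iInter_of_isOpen
      (fun U => isOpen_iUnion fun m => (hb.isOpen U.2).preimage (continuous_pow m)) ?_
    intro U
    rw [dense_iff_inter_open]
    rintro W hW ⟨w, hw⟩
    obtain ⟨ξ₀, rfl⟩ := torusExp_surjective w
    obtain ⟨u, hu⟩ : (U : Set (Torus n)).Nonempty :=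
      nonempty_iff_ne_empty.2 fun he => hbe (he ▸ U.2)
    obtain ⟨η, rfl⟩ := torusExp_surjective u
    obtain ⟨δ, hδ, hball⟩ := Metric.mem_nhds_iff.1
      ((hW.preimage continuous_torusExp).mem_nhds hw)
    obtain ⟨m, hm⟩ := exists_nat_gt (Real.pi / δ)
    have hmp : (0 : ℝ) < m := lt_trans (by positivity) hm
    have hpi := Real.pi_pos
    let k : Fin n → ℤ := fun j => round ((m * ξ₀ j - η j) / (2 * Real.pi))
    let ζ : Fin n → ℝ := fun j => (η j + k j * (2 * Real.pi)) / m
    have hζ : ζ ∈ ball ξ₀ δ := by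
      rw [mem_ball, dist_pi_lt_iff hδ]
      intro j
      have h1 := abs_sub_round ((m * ξ₀ j - η j) / (2 * Real.pi))
      have e : ζ j - ξ₀ j = -((m * ξ₀ j - η j) / (2 * Real.pi) - k j) * (2 * Real.pi) / m := by
        simp only [ζ]
        field_simp
        ring
      rw [Real.dist_eq, e, abs_div, abs_mul, abs_neg, abs_of_pos hmp,
        abs_of_pos (show 0 < 2 * Real.pi by positivity), div_lt_iff₀ hmp]
      rw [div_lt_iff₀ hδ] at hm
      calc _ ≤ 1 / 2 * (2 * Real.pi) := by gcongr
        _ = Real.pi := by ring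
        _ < _ := by linarith
    refine ⟨torusExp ζ, hball hζ, mem_iUnion.2 ⟨m, ?_⟩⟩
    have e : (m : ℝ) • ζ = η + fun j => k j * (2 * Real.pi) := by
      ext j
      simp only [ζ, Pi.smul_apply, smul_eq_mul, Pi.add_apply]
      field_simp
    show torusExp ζ ^ m ∈ (U : Set (Torus n))
    rw [← torusExp_nsmul, e, torusExp_add, torusExp_eq_one_of_int, mul_one]
    exact hu
  obtain ⟨g, hg⟩ := hd.nonempty
  obtain ⟨ξ, rfl⟩ := torusExp_surjective g
  refine ⟨ξ, ?_⟩
  rw [IsGenerator, hb.dense_iff]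
  rintro U hU -
  obtain ⟨m, hm⟩ := mem_iUnion.1 (mem_iInter.1 hg ⟨U, hU⟩)
  exact ⟨_, hm, m, torusExp_nsmul m ξ⟩

lemma IsGenerator.neg {ξ : Fin n → ℝ} (h : IsGenerator ξ) : IsGenerator (-ξ) := by
  refine h.mono ?_
  rintro _ ⟨t, rfl⟩
  exact ⟨-t, by simp⟩

lemma IsGenerator.sum_ne_zero {ξ : Fin n → ℝ} (h : IsGenerator ξ) {a : Fin n → ℤ} (ha : a ≠ 0) :
    ∑ j, a j * ξ j ≠ 0 := by
  intro h0
  refine ha (eq_zero_of_character_eq_one fun g => ?_)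
  refine congrFun (Continuous.ext_on h (continuous_character a) (continuous_const (y := 1)) ?_) g
  rintro _ ⟨t, rfl⟩
  have : ∑ j, (a j : ℝ) * (t • ξ) j = t * ∑ j, a j * ξ j := by
    rw [Finset.mul_sum]
    exact Finset.sum_congr rfl fun j _ => by simp; ring
  show character a (torusExp (t • ξ)) = 1
  rw [character_torusExp, this, h0]
  simp

lemma mem_realTorus_iff {g : Torus n} : g ∈ realTorus n ↔ g ^ 2 = 1 := by
  rw [realTorus, MonoidHom.mem_ker, powMonoidHom_apply]

lemma inv_eq_self_of_mem_realTorus {g : Torus n} (hg : g ∈ realTorus n) : g⁻¹ = g := by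
  rw [mem_realTorus_iff, sq] at hg
  exact inv_eq_of_mul_eq_one_left hg

lemma circle_eq_one_or_of_sq_eq_one {z : Circle} (h : z ^ 2 = 1) :
    z = 1 ∨ z = Circle.exp Real.pi := by
  have h1 : (z : ℂ) ^ 2 = 1 := by
    rw [← Circle.coe_pow, h, Circle.coe_one]
  rcases sq_eq_one_iff.1 h1 with h | h
  · exact Or.inl (Circle.ext (by simpa using h))
  · exact Or.inr (Circle.ext (by simpa using h))

lemma finite_realTorus (n : ℕ) : (realTorus n : Set (Torus n)).Finite := by
  refine (Set.Finite.pi' (t := fun _ : Fin n => ({1, Circle.exp Real.pi} : Set Circle))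
    fun _ => Set.toFinite _).subset ?_
  intro g hg j
  have h := congrFun (mem_realTorus_iff.1 hg) j
  exact circle_eq_one_or_of_sq_eq_one h

/-- The element `exp(π e_j)` of the two-torsion. -/
def signElement (j : Fin n) : Torus n := torusExp (Pi.single j Real.pi)

lemma signElement_mem (j : Fin n) : signElement j ∈ realTorus n := by
  rw [mem_realTorus_iff, sq, signElement, ← torusExp_add, ← torusExp_eq_one_of_int (Pi.single j 1)]
  congr 1
  ext i
  by_cases h : i = j
  · subst h; simp; ring
  · simp [h]

lemma character_signElement (a : Fin n → ℤ) (j : Fin n) :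
    character a (signElement j) = Circle.exp (a j * Real.pi) := by
  rw [signElement, character_torusExp]
  congr 1
  rw [Finset.sum_eq_single j]
  · simp
  · intro i _ hi; simp [hi]
  · simp

lemma mod2Reduction_eq_iff {a b : Fin n → ℤ} :
    mod2Reduction a = mod2Reduction b ↔ ∀ g ∈ realTorus n, character a g = character b g := by
  constructor
  · intro h g hg
    refine Finset.prod_congr rfl fun j _ => ?_
    have h1 : (a j : ZMod 2) = b j := congrFun h j
    rw [ZMod.intCast_eq_intCast_iff_dvd_sub] at h1
    obtain ⟨k, hk⟩ := h1
    have hgj : g j ^ 2 = 1 := congrFun (mem_realTorus_iff.1 hg) j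
    have e : b j = a j + 2 * k := by push_cast at hk; linarith
    have h2 : g j ^ (2 : ℤ) = 1 := by exact_mod_cast hgj
    rw [e, zpow_add, zpow_mul, h2, one_zpow, mul_one]
  · intro h
    ext j
    have h1 := h _ (signElement_mem j)
    rw [character_signElement, character_signElement, Circle.exp_eq_exp] at h1
    obtain ⟨m, hm⟩ := h1
    have h2 : (a j : ℝ) = b j + m * 2 := by
      have hpi := Real.pi_pos
      have : Real.pi * (a j : ℝ) = Real.pi * (b j + m * 2) := by linarith
      exact mul_left_cancel₀ hpi.ne' this
    have h3 : a j = b j + m * 2 := by exact_mod_cast h2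
    show (a j : ZMod 2) = (b j : ZMod 2)
    rw [h3]
    push_cast
    rw [show (2 : ZMod 2) = 0 from rfl]
    simp

lemma mod2Reduction_eq_zero_iff {a : Fin n → ℤ} :
    mod2Reduction a = 0 ↔ ∀ g ∈ realTorus n, character a g = 1 := by
  have h0 : (0 : Fin n → ZMod 2) = mod2Reduction (0 : Fin n → ℤ) := by
    ext j; simp [mod2Reduction]
  rw [h0, mod2Reduction_eq_iff]
  simp [character]

lemma character_sq_of_mem {a : Fin n → ℤ} {g : Torus n} (hg : g ∈ realTorus n) :
    character a g ^ 2 = 1 := by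
  rw [sq, ← character_mul, ← sq, mem_realTorus_iff.1 hg, character_one]

/-- Two nonzero reduced weights which are trivial on the same subgroup of index two coincide. -/
lemma mod2Reduction_eq_of_trivial {K : Subgroup (Torus n)}
    (hK : ∀ g ∈ realTorus n, ∀ h ∈ realTorus n, g ∉ K → h ∉ K → g * h ∈ K)
    {a b : Fin n → ℤ} (ha : ∀ g ∈ K, character a g = 1) (hb : ∀ g ∈ K, character b g = 1)
    (ha0 : mod2Reduction a ≠ 0) (hb0 : mod2Reduction b ≠ 0) :
    mod2Reduction a = mod2Reduction b := by
  have key : ∀ c : Fin n → ℤ, (∀ g ∈ K, character c g = 1) → mod2Reduction c ≠ 0 →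
      ∀ g ∈ realTorus n, g ∉ K → character c g = Circle.exp Real.pi := by
    intro c hc hc0 g hg hgK
    refine (circle_eq_one_or_of_sq_eq_one (character_sq_of_mem hg)).resolve_left fun h1 => hc0 ?_
    rw [mod2Reduction_eq_zero_iff]
    intro h hh
    by_cases hhK : h ∈ K
    · exact hc h hhK
    · have := hc _ (hK g hg h hh hgK hhK)
      rwa [character_mul, h1, one_mul] at this
  rw [mod2Reduction_eq_iff]
  intro g hg
  by_cases hgK : g ∈ K
  · rw [ha g hgK, hb g hgK]
  · rw [key a ha ha0 g hg hgK, key b hb hb0 g hg hgK]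

/-- The kernel of a weight on the two-torsion. -/
def realKernel (a : Fin n → ℤ) : Subgroup (Torus n) where
  carrier := {g | g ∈ realTorus n ∧ character a g = 1}
  mul_mem' := by
    rintro g h ⟨hg, hg1⟩ ⟨hh, hh1⟩
    exact ⟨mul_mem hg hh, by rw [character_mul, hg1, hh1, one_mul]⟩
  one_mem' := ⟨one_mem _, character_one a⟩
  inv_mem' := by
    rintro g ⟨hg, hg1⟩
    exact ⟨inv_mem hg, by rw [inv_eq_self_of_mem_realTorus hg]; exact hg1⟩

lemma mul_mem_realKernel {a : Fin n → ℤ} {g h : Torus n} (hg : g ∈ realTorus n)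
    (hh : h ∈ realTorus n) (hgK : g ∉ realKernel a) (hhK : h ∉ realKernel a) :
    g * h ∈ realKernel a := by
  have h1 := (circle_eq_one_or_of_sq_eq_one (character_sq_of_mem (a := a) hg)).resolve_left
    fun h => hgK ⟨hg, h⟩
  have h2 := (circle_eq_one_or_of_sq_eq_one (character_sq_of_mem (a := a) hh)).resolve_left
    fun h => hhK ⟨hh, h⟩
  refine ⟨mul_mem hg hh, ?_⟩
  rw [character_mul, h1, h2, ← h1, ← sq, character_sq_of_mem hg]

end Torus

/-! ### Smooth torus actions -/

section LocallyConstant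

variable {E : Type*} [NormedAddCommGroup E] [NormedSpace ℝ E]
  {M : Type*} [TopologicalSpace M] [ChartedSpace E M] [IsManifold 𝓘(ℝ, E) ∞ M]
  {F : Type*} [NormedAddCommGroup F] [NormedSpace ℝ F]
  {N : Type*} [TopologicalSpace N] [ChartedSpace F N] [IsManifold 𝓘(ℝ, F) ∞ N]

lemma isLocallyConstant_of_mfderiv_eq_zero {f : N → M} (hf : MDifferentiable 𝓘(ℝ, F) 𝓘(ℝ, E) f)
    (h0 : ∀ x, mfderiv 𝓘(ℝ, F) 𝓘(ℝ, E) f x = 0) : IsLocallyConstant f := by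
  rw [IsLocallyConstant.iff_eventually_eq]
  intro x
  set ϕ := extChartAt 𝓘(ℝ, F) x with hϕ
  set ψ := extChartAt 𝓘(ℝ, E) (f x) with hψ
  have hfc : Continuous f := hf.continuous
  have hop : IsOpen (ϕ.target ∩ ϕ.symm ⁻¹' (f ⁻¹' ψ.source)) :=
    (continuousOn_extChartAt_symm x).isOpen_inter_preimage (isOpen_extChartAt_target x)
      ((isOpen_extChartAt_source (f x)).preimage hfc)
  have hmem : ϕ x ∈ ϕ.target ∩ ϕ.symm ⁻¹' (f ⁻¹' ψ.source) := by
    refine ⟨mem_extChartAt_target x, ?_⟩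
    simp only [mem_preimage]
    rw [extChartAt_to_inv]
    exact mem_extChartAt_source (f x)
  obtain ⟨r, hr, hball⟩ := Metric.isOpen_iff.1 hop _ hmem
  have hder : ∀ z ∈ ball (ϕ x) r, HasFDerivAt (ψ ∘ f ∘ ϕ.symm) (0 : F →L[ℝ] E) z := by
    intro z hz
    obtain ⟨hz1, hz2⟩ := hball hz
    have e1 : MDifferentiableAt 𝓘(ℝ, F) 𝓘(ℝ, F) ϕ.symm z := by
      have := mdifferentiableWithinAt_extChartAt_symm (I := 𝓘(ℝ, F)) hz1
      rwa [modelWithCornersSelf_coe, range_id, mdifferentiableWithinAt_univ] at this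
    have e2 : MDifferentiableAt 𝓘(ℝ, E) 𝓘(ℝ, E) ψ (f (ϕ.symm z)) :=
      mdifferentiableAt_extChartAt (by rwa [← extChartAt_source 𝓘(ℝ, E)])
    have e3 := (e2.hasMFDerivAt.comp (ϕ.symm z) (hf (ϕ.symm z)).hasMFDerivAt).comp z
      e1.hasMFDerivAt
    rw [h0] at e3
    have e4 := e3.hasFDerivAt
    convert! e4 using 1
    ext v
    simp
    rfl
  have hconst : ∀ z ∈ ball (ϕ x) r, (ψ ∘ f ∘ ϕ.symm) z = (ψ ∘ f ∘ ϕ.symm) (ϕ x) := by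
    intro z hz
    refine (convex_ball (ϕ x) r).is_const_of_fderivWithin_eq_zero (𝕜 := ℝ)
      (fun w hw => (hder w hw).differentiableAt.differentiableWithinAt) ?_ hz (mem_ball_self hr)
    intro w hw
    exact ((hder w hw).hasFDerivWithinAt).fderivWithin (isOpen_ball.uniqueDiffWithinAt hw)
  have hnb : ϕ ⁻¹' ball (ϕ x) r ∩ ϕ.source ∈ 𝓝 x :=
    inter_mem ((continuousAt_extChartAt x).preimage_mem_nhds (ball_mem_nhds _ hr))
      (extChartAt_source_mem_nhds x)
  filter_upwards [hnb] with y hy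
  have h1 := hconst (ϕ y) hy.1
  have h2 := (hball hy.1).2
  simp only [Function.comp_apply, mem_preimage] at h1 h2
  rw [ϕ.left_inv hy.2] at h1 h2
  rw [hϕ, extChartAt_to_inv] at h1
  exact ψ.injOn h2 (mem_extChartAt_source (f x)) h1

end LocallyConstant

section Action

variable {E : Type*} [NormedAddCommGroup E] [NormedSpace ℝ E]
  {M : Type*} [TopologicalSpace M] [ChartedSpace E M]
  {n : ℕ} [MulAction (Torus n) M]

lemma contMDiff_torusExp_smul (hA : ContMDiffSMul (torusModel n) 𝓘(ℝ, E) ∞ (Torus n) M) :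
    ContMDiff (𝓘(ℝ, Fin n → ℝ).prod 𝓘(ℝ, E)) 𝓘(ℝ, E) ∞
      (fun z : (Fin n → ℝ) × M => torusExp z.1 • z.2) :=
  (contMDiff_torusExp.comp contMDiff_fst).smul contMDiff_snd

lemma contMDiff_const_smul' (hA : ContMDiffSMul (torusModel n) 𝓘(ℝ, E) ∞ (Torus n) M)
    (g : Torus n) : ContMDiff 𝓘(ℝ, E) 𝓘(ℝ, E) ∞ (fun x : M => g • x) :=
  contMDiff_const.smul (I := torusModel n) contMDiff_id

lemma contMDiff_orbitMap (hA : ContMDiffSMul (torusModel n) 𝓘(ℝ, E) ∞ (Torus n) M) (x : M) :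
    ContMDiff 𝓘(ℝ, Fin n → ℝ) 𝓘(ℝ, E) ∞ (fun η : Fin n → ℝ => torusExp η • x) :=
  contMDiff_torusExp.smul contMDiff_const

lemma continuousSMul_torus (hA : ContMDiffSMul (torusModel n) 𝓘(ℝ, E) ∞ (Torus n) M) :
    ContinuousSMul (Torus n) M := ⟨hA.contMDiff_smul.continuous⟩

lemma mdifferentiableAt_smul (hA : ContMDiffSMul (torusModel n) 𝓘(ℝ, E) ∞ (Torus n) M)
    (g : Torus n) (x : M) : MDifferentiableAt 𝓘(ℝ, E) 𝓘(ℝ, E) (fun x : M => g • x) x :=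
  (contMDiff_const_smul' hA g).mdifferentiable (by simp) x

lemma hasMFDerivAt_orbitMap (hA : ContMDiffSMul (torusModel n) 𝓘(ℝ, E) ∞ (Torus n) M) (x : M) :
    HasMFDerivAt 𝓘(ℝ, Fin n → ℝ) 𝓘(ℝ, E) (fun η : Fin n → ℝ => torusExp η • x) 0
      (infinitesimalAction n x) :=
  ((contMDiff_orbitMap hA x).mdifferentiable (by simp) 0).hasMFDerivAt

/-- The differential of a map which intertwines the orbit maps of `x` and `y` up to a linear
reparametrization `L` of the Lie algebra carries the infinitesimal action at `x` to that at `y`. -/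
lemma mfderiv_infinitesimalAction (hA : ContMDiffSMul (torusModel n) 𝓘(ℝ, E) ∞ (Torus n) M)
    {f : M → M} {x y : M} (hf : MDifferentiableAt 𝓘(ℝ, E) 𝓘(ℝ, E) f x)
    (L : (Fin n → ℝ) →L[ℝ] (Fin n → ℝ))
    (h : ∀ η, f (torusExp η • x) = torusExp (L η) • y) (ξ : Fin n → ℝ) :
    (mfderiv 𝓘(ℝ, E) 𝓘(ℝ, E) f x (infinitesimalAction n x ξ) : E)
      = infinitesimalAction (E := E) n y (L ξ) := by
  have hx : torusExp (0 : Fin n → ℝ) • x = x := by simp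
  have h1 : HasMFDerivAt 𝓘(ℝ, Fin n → ℝ) 𝓘(ℝ, E) (fun η : Fin n → ℝ => f (torusExp η • x)) 0
      ((mfderiv 𝓘(ℝ, E) 𝓘(ℝ, E) f (torusExp (0 : Fin n → ℝ) • x)).comp
        (infinitesimalAction (E := E) n x)) := by
    refine HasMFDerivAt.comp (g := f) 0 ?_ (hasMFDerivAt_orbitMap hA x)
    refine MDifferentiableAt.hasMFDerivAt ?_
    rw [hx]; exact hf
  have h2 : HasMFDerivAt 𝓘(ℝ, Fin n → ℝ) 𝓘(ℝ, E) (fun η : Fin n → ℝ => torusExp (L η) • y) 0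
      ((infinitesimalAction (E := E) n y).comp L) := by
    refine HasMFDerivAt.comp (g := fun η : Fin n → ℝ => torusExp η • y) (f := L) 0 ?_ L.hasMFDerivAt
    rw [map_zero]
    exact hasMFDerivAt_orbitMap hA y
  have h3 := hasMFDerivAt_unique h1 (h2.congr_of_eventuallyEq (Eventually.of_forall h))
  have h4 := congrArg (fun T : (Fin n → ℝ) →L[ℝ] E => T ξ) h3
  rw [hx] at h4
  exact h4

lemma mfderiv_smul_infinitesimalAction
    (hA : ContMDiffSMul (torusModel n) 𝓘(ℝ, E) ∞ (Torus n) M) (g : Torus n) (x : M)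
    (ξ : Fin n → ℝ) :
    (mfderiv 𝓘(ℝ, E) 𝓘(ℝ, E) (fun y : M => g • y) x (infinitesimalAction n x ξ) : E)
      = infinitesimalAction (E := E) n (g • x) ξ :=
  mfderiv_infinitesimalAction hA (mdifferentiableAt_smul hA g x) (ContinuousLinearMap.id ℝ _)
    (fun η => by simp [smul_smul, mul_comm]) ξ

lemma mfderiv_involution_infinitesimalAction
    (hA : ContMDiffSMul (torusModel n) 𝓘(ℝ, E) ∞ (Torus n) M) {σ : M → M}
    (hσ : ContMDiff 𝓘(ℝ, E) 𝓘(ℝ, E) ∞ σ) (hc : ∀ (g : Torus n) (x : M), σ (g • x) = g⁻¹ • σ x)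
    (x : M) (ξ : Fin n → ℝ) :
    (mfderiv 𝓘(ℝ, E) 𝓘(ℝ, E) σ x (infinitesimalAction n x ξ) : E)
      = -infinitesimalAction (E := E) n (σ x) ξ := by
  have := mfderiv_infinitesimalAction hA (hσ.mdifferentiable (by simp) x)
    (-ContinuousLinearMap.id ℝ _) (y := σ x) (fun η => by simp [hc, torusExp_neg]) ξ
  rw [this]
  exact map_neg (infinitesimalAction (E := E) n (σ x)) ξ

/-- A zero of the vector field generated by `ξ` is fixed by the one-parameter group of `ξ`. -/
lemma smul_eq_of_infinitesimalAction_eq_zero [IsManifold 𝓘(ℝ, E) ∞ M]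
    (hA : ContMDiffSMul (torusModel n) 𝓘(ℝ, E) ∞ (Torus n) M) {x : M} {ξ : Fin n → ℝ}
    (h0 : (infinitesimalAction (E := E) n x ξ : E) = 0) (t : ℝ) : torusExp (t • ξ) • x = x := by
  have hsm : ContMDiff 𝓘(ℝ, ℝ) 𝓘(ℝ, E) ∞ (fun t : ℝ => torusExp (t • ξ) • x) :=
    (contMDiff_orbitMap hA x).comp
      (ContDiff.contMDiff (f := fun t : ℝ => t • ξ) (by fun_prop))
  have hlc : IsLocallyConstant (fun t : ℝ => torusExp (t • ξ) • x) := by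
    refine isLocallyConstant_of_mfderiv_eq_zero (hsm.mdifferentiable (by simp)) fun t₀ => ?_
    -- near `t₀` the curve is `t ↦ exp(t₀ ξ) • exp((t - t₀) ξ) • x`
    have e1 : HasMFDerivAt 𝓘(ℝ, ℝ) 𝓘(ℝ, Fin n → ℝ) (fun t : ℝ => (t - t₀) • ξ) t₀
        (ContinuousLinearMap.toSpanSingleton ℝ ξ) := by
      refine HasFDerivAt.hasMFDerivAt ?_
      have := ((hasDerivAt_id t₀).sub_const t₀).smul_const ξ
      convert! this.hasFDerivAt using 1
      simp
      rfl
    have e2 : HasMFDerivAt 𝓘(ℝ, ℝ) 𝓘(ℝ, E) (fun t : ℝ => torusExp ((t - t₀) • ξ) • x) t₀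
        ((infinitesimalAction (E := E) n x).comp (ContinuousLinearMap.toSpanSingleton ℝ ξ)) := by
      refine HasMFDerivAt.comp (g := fun η : Fin n → ℝ => torusExp η • x) t₀ ?_ e1
      rw [sub_self, zero_smul]
      exact hasMFDerivAt_orbitMap hA x
    have e3 : (infinitesimalAction (E := E) n x).comp (ContinuousLinearMap.toSpanSingleton ℝ ξ)
        = (0 : ℝ →L[ℝ] E) := by
      ext
      simp only [ContinuousLinearMap.comp_apply, ContinuousLinearMap.toSpanSingleton_apply,
        one_smul]
      exact h0
    have e2' : HasMFDerivAt 𝓘(ℝ, ℝ) 𝓘(ℝ, E) (fun t : ℝ => torusExp ((t - t₀) • ξ) • x) t₀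
        (0 : ℝ →L[ℝ] E) := e2.congr_mfderiv e3
    have e4 := (mdifferentiableAt_smul hA (torusExp (t₀ • ξ))
      (torusExp ((t₀ - t₀) • ξ) • x)).hasMFDerivAt.comp t₀ e2'
    have e5 : (fun t : ℝ => torusExp (t • ξ) • x) =
        (fun y : M => torusExp (t₀ • ξ) • y) ∘ fun t : ℝ => torusExp ((t - t₀) • ξ) • x := by
      ext t
      simp only [Function.comp_apply, smul_smul, ← torusExp_add]
      congr 2
      module
    rw [e5]
    rw [e4.mfderiv]
    exact ContinuousLinearMap.comp_zero _
  have := hlc.apply_eq_of_preconnectedSpace t 0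
  simpa using this

lemma mem_fixedPoints_of_infinitesimalAction_eq_zero [IsManifold 𝓘(ℝ, E) ∞ M] [T2Space M]
    (hA : ContMDiffSMul (torusModel n) 𝓘(ℝ, E) ∞ (Torus n) M) {x : M} {ξ : Fin n → ℝ}
    (hξ : IsGenerator ξ) (h0 : (infinitesimalAction (E := E) n x ξ : E) = 0) :
    x ∈ MulAction.fixedPoints (Torus n) M := by
  have := continuousSMul_torus hA
  intro g
  refine congrFun (Continuous.ext_on hξ (f := fun g : Torus n => g • x) (g := fun _ => x)
    (by fun_prop) continuous_const ?_) g
  rintro _ ⟨t, rfl⟩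
  exact smul_eq_of_infinitesimalAction_eq_zero hA h0 t

lemma infinitesimalAction_eq_zero_of_mem_fixedPoints
    {x : M} (hx : x ∈ MulAction.fixedPoints (Torus n) M) :
    infinitesimalAction (E := E) n x = 0 := by
  have : (fun η : Fin n → ℝ => torusExp η • x) = fun _ => x := funext fun η => hx _
  have h2 : mfderiv 𝓘(ℝ, Fin n → ℝ) 𝓘(ℝ, E) (fun η : Fin n → ℝ => torusExp η • x) 0 = 0 := by
    rw [this]
    exact mfderiv_const
  exact h2

end Action

/-! ### Linearization of finite group actions at a fixed point -/

section Linearization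

variable {E : Type*} [NormedAddCommGroup E] [NormedSpace ℝ E]
  {M : Type*} [TopologicalSpace M] [ChartedSpace E M]

lemma two_le_infty : (2 : ℕ∞ω) ≤ ∞ := ENat.LEInfty.out

/-- The differential of a self-map at a point, as an endomorphism of the model space. It is
meant for a map that fixes the point. -/
def endDeriv (f : M → M) (p : M) : E →L[ℝ] E := mfderiv 𝓘(ℝ, E) 𝓘(ℝ, E) f p

lemma endDeriv_comp {f g : M → M} {p : M} (hg : MDifferentiableAt 𝓘(ℝ, E) 𝓘(ℝ, E) g p)
    (hf : MDifferentiableAt 𝓘(ℝ, E) 𝓘(ℝ, E) f p) (hp : g p = p) :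
    endDeriv (E := E) (f ∘ g) p = (endDeriv f p).comp (endDeriv g p) := by
  have hf' : MDifferentiableAt 𝓘(ℝ, E) 𝓘(ℝ, E) f (g p) := by rwa [hp]
  have := mfderiv_comp p hf' hg
  unfold endDeriv
  rw [this, hp]
  rfl

lemma endDeriv_id (p : M) : endDeriv (E := E) (id : M → M) p = ContinuousLinearMap.id ℝ E :=
  mfderiv_id

/-- Near a fixed point, a map read in the preferred chart is differentiable with derivative the
differential of the map. -/
lemma hasFDerivAt_chart {f : M → M} {p : M} (hf : MDifferentiableAt 𝓘(ℝ, E) 𝓘(ℝ, E) f p)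
    (hp : f p = p) :
    HasFDerivAt (extChartAt 𝓘(ℝ, E) p ∘ f ∘ (extChartAt 𝓘(ℝ, E) p).symm) (endDeriv f p)
      (extChartAt 𝓘(ℝ, E) p p) := by
  have : HasFDerivWithinAt (E := E) (F := E) (writtenInExtChartAt 𝓘(ℝ, E) 𝓘(ℝ, E) p f)
    (endDeriv f p) (range 𝓘(ℝ, E)) (extChartAt 𝓘(ℝ, E) p p) := hf.hasMFDerivAt.2
  rw [modelWithCornersSelf_coe, range_id, hasFDerivWithinAt_univ, writtenInExtChartAt, hp] at this
  exact this

lemma contDiffAt_chart {f : M → M} {p : M} {k : ℕ∞ω} (hf : ContMDiffAt 𝓘(ℝ, E) 𝓘(ℝ, E) k f p)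
    (hp : f p = p) :
    ContDiffAt ℝ k (extChartAt 𝓘(ℝ, E) p ∘ f ∘ (extChartAt 𝓘(ℝ, E) p).symm)
      (extChartAt 𝓘(ℝ, E) p p) := by
  have := (contMDiffAt_iff.1 hf).2
  rw [modelWithCornersSelf_coe, range_id, contDiffWithinAt_univ, hp] at this
  exact this

variable [IsManifold 𝓘(ℝ, E) ∞ M] [CompleteSpace E]

/-- Bochner's linearization theorem for a finite group: near a fixed point there is an invariant
chart in which the group acts linearly, through its differentials at the point. The chart is the
average of the translates of an arbitrary chart. -/
theorem exists_linearizing_chart {Γ : Type*} [Group Γ] [Finite Γ] (ρ : Γ →* Equiv.Perm M)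
    (hρ : ∀ γ, ContMDiff 𝓘(ℝ, E) 𝓘(ℝ, E) ∞ (ρ γ)) {p : M} (hp : ∀ γ, ρ γ p = p) :
    ∃ e : OpenPartialHomeomorph M E, p ∈ e.source ∧ e p = 0 ∧
      ContMDiffOn 𝓘(ℝ, E) 𝓘(ℝ, E) 2 e e.source ∧
      ContMDiffOn 𝓘(ℝ, E) 𝓘(ℝ, E) 2 e.symm e.target ∧
      (∀ γ, ∀ x ∈ e.source, ρ γ x ∈ e.source ∧ e (ρ γ x) = endDeriv (ρ γ) p (e x)) ∧
      HasMFDerivAt 𝓘(ℝ, E) 𝓘(ℝ, E) e p (ContinuousLinearMap.id ℝ E) := by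
  have := Fintype.ofFinite Γ
  set ϕ := extChartAt 𝓘(ℝ, E) p with hϕ
  set z₀ := ϕ p with hz₀
  have hmd : ∀ γ, MDifferentiableAt 𝓘(ℝ, E) 𝓘(ℝ, E) (ρ γ) p :=
    fun γ => (hρ γ).mdifferentiable (by simp) p
  let D : Γ → E →L[ℝ] E := fun γ => endDeriv (ρ γ) p
  have hDmul : ∀ γ γ', D (γ * γ') = (D γ).comp (D γ') := by
    intro γ γ'
    have : (ρ (γ * γ') : M → M) = ρ γ ∘ ρ γ' := by rw [map_mul]; rfl
    show endDeriv (ρ (γ * γ')) p = _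
    rw [this]
    exact endDeriv_comp (hmd γ') (hmd γ) (hp γ')
  have hD1 : D 1 = ContinuousLinearMap.id ℝ E := by
    have : (ρ 1 : M → M) = id := by rw [map_one]; rfl
    show endDeriv (ρ 1) p = _
    rw [this]
    exact endDeriv_id p
  let c : ℝ := (Fintype.card Γ : ℝ)⁻¹
  have hc : (Fintype.card Γ : ℝ) * c = 1 := mul_inv_cancel₀ (by simp)
  let F : M → E := fun x => c • ∑ γ, D γ⁻¹ (ϕ (ρ γ x) - z₀)
  let G : E → E := fun z => c • ∑ γ, D γ⁻¹ ((ϕ ∘ ρ γ ∘ ϕ.symm) z - z₀)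
  have hFequiv : ∀ γ x, F (ρ γ x) = D γ (F x) := by
    intro γ x
    simp only [F, map_smul, map_sum]
    congr 1
    rw [← Equiv.sum_comp (Equiv.mulRight γ⁻¹)]
    refine Finset.sum_congr rfl fun γ' _ => ?_
    have h1 : ρ (γ' * γ⁻¹) (ρ γ x) = ρ γ' x := by
      rw [← Equiv.Perm.mul_apply, ← map_mul, inv_mul_cancel_right]
    simp only [Equiv.coe_mulRight]
    rw [h1, mul_inv_rev, inv_inv, hDmul, ContinuousLinearMap.comp_apply]
  have hG2 : ContDiffAt ℝ 2 G z₀ := by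
    refine ContDiffAt.const_smul c (ContDiffAt.sum fun γ _ => ?_)
    refine (D γ⁻¹).contDiff.contDiffAt.comp z₀ (ContDiffAt.sub ?_ contDiffAt_const)
    exact (contDiffAt_chart (hρ γ).contMDiffAt (hp γ)).of_le two_le_infty
  have hGd : HasFDerivAt G (ContinuousLinearMap.id ℝ E) z₀ := by
    have h1 : HasFDerivAt G (c • ∑ γ : Γ, (D γ⁻¹).comp (D γ)) z₀ := by
      refine HasFDerivAt.const_smul (HasFDerivAt.fun_sum fun γ _ => ?_) c
      exact (D γ⁻¹).hasFDerivAt.comp z₀ ((hasFDerivAt_chart (hmd γ) (hp γ)).sub_const z₀)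
    convert! h1 using 1
    simp only [← hDmul, inv_mul_cancel, hD1, Finset.sum_const, Finset.card_univ]
    rw [← Nat.cast_smul_eq_nsmul ℝ, smul_smul, mul_comm, hc, one_smul]
  have hGd' : HasFDerivAt G (ContinuousLinearEquiv.refl ℝ E : E →L[ℝ] E) z₀ := hGd
  have hG0 : G z₀ = 0 := by
    simp only [G, Function.comp_apply, hz₀, hϕ, extChartAt_to_inv, hp, sub_self, map_zero,
      Finset.sum_const_zero, smul_zero]
  let R := hG2.toOpenPartialHomeomorph G hGd' (by simp)
  have hRG : (R : E → E) = G := hG2.toOpenPartialHomeomorph_coe hGd' (by simp)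
  have hzR : z₀ ∈ R.source := hG2.mem_toOpenPartialHomeomorph_source hGd' (by simp)
  let e₁ : OpenPartialHomeomorph M E := (chartAt E p).trans R
  have he₁ : ∀ x, e₁ x = G (ϕ x) := by
    intro x
    show R (chartAt E p x) = _
    rw [hRG]
    simp [hϕ]
  have hpe₁ : p ∈ e₁.source := by
    rw [OpenPartialHomeomorph.trans_source]
    refine ⟨mem_chart_source E p, ?_⟩
    simpa [hz₀, hϕ] using hzR
  have he₁p : e₁ p = 0 := by rw [he₁]; exact hG0
  -- the open set on which the chart and its inverse are of class `C²`
  have hev1 : ∀ᶠ z in 𝓝 z₀, ContDiffAt ℝ 2 G z := hG2.eventually (by simp)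
  have hev2 : ∀ᶠ w in 𝓝 (0 : E), ContDiffAt ℝ 2 R.symm w := by
    have h1 : ContDiffAt ℝ 2 R.symm (G z₀) := hG2.to_localInverse hGd' (by simp)
    rw [hG0] at h1
    exact h1.eventually (by simp)
  have hnear : ∀ᶠ x in 𝓝 p, x ∈ e₁.source ∧ ContDiffAt ℝ 2 G (ϕ x) ∧
      ContDiffAt ℝ 2 R.symm (e₁ x) := by
    refine (e₁.open_source.eventually_mem hpe₁).and (((continuousAt_extChartAt p).eventually hev1).and ?_)
    have := (e₁.continuousAt hpe₁)
    rw [ContinuousAt, he₁p] at this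
    exact this.eventually hev2
  obtain ⟨U₀, hU₀, hU₀o, hpU₀⟩ := eventually_nhds_iff.1 hnear
  let U : Set M := ⋂ γ, ρ γ ⁻¹' U₀
  have hUo : IsOpen U := isOpen_iInter_of_finite fun γ => hU₀o.preimage (hρ γ).continuous
  have hpU : p ∈ U := mem_iInter.2 fun γ => by rw [mem_preimage, hp]; exact hpU₀
  have hUinv : ∀ γ, ∀ x ∈ U, ρ γ x ∈ U := by
    intro γ x hx
    refine mem_iInter.2 fun γ' => ?_
    have := mem_iInter.1 hx (γ' * γ)
    rw [map_mul] at this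
    exact this
  have hUU₀ : U ⊆ U₀ := by
    intro x hx
    have := mem_iInter.1 hx 1
    rw [map_one] at this
    exact this
  have hUs : U ⊆ e₁.source := fun x hx => (hU₀ x (hUU₀ hx)).1
  have hsrc : ∀ x ∈ U, x ∈ (chartAt E p).source := by
    intro x hx
    have := hUs hx
    rw [OpenPartialHomeomorph.trans_source] at this
    exact this.1
  have hFe : ∀ x ∈ U, e₁ x = F x := by
    intro x hx
    rw [he₁]
    simp only [G, F, Function.comp_apply]
    rw [hϕ, (extChartAt 𝓘(ℝ, E) p).left_inv (by rw [extChartAt_source]; exact hsrc x hx)]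
  let e := e₁.restrOpen U hUo
  have hes : e.source = U := by
    rw [OpenPartialHomeomorph.restrOpen_source]
    exact inter_eq_right.2 hUs
  have hee : ∀ x, e x = e₁ x := fun x => rfl
  have hesymm : ∀ w, e.symm w = (chartAt E p).symm (R.symm w) := fun w => rfl
  have hetarget : ∀ w ∈ e.target, e.symm w ∈ U := fun w hw => hes ▸ e.map_target hw
  refine ⟨e, by rw [hes]; exact hpU, he₁p, ?_, ?_, ?_, ?_⟩
  · intro x hx
    rw [hes] at hx
    have h1 : ContMDiffAt 𝓘(ℝ, E) 𝓘(ℝ, E) 2 (G ∘ ϕ) x := by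
      refine ContMDiffAt.comp x (hU₀ x (hUU₀ hx)).2.1.contMDiffAt ?_
      exact (contMDiffAt_extChartAt' (n := ∞) (hsrc x hx)).of_le two_le_infty
    exact (h1.congr_of_eventuallyEq (Eventually.of_forall he₁)).contMDiffWithinAt
  · intro w hw
    have hx := hetarget w hw
    have h2 : e (e.symm w) = w := e.right_inv hw
    have h3 : ContDiffAt ℝ 2 R.symm w := by
      have := (hU₀ _ (hUU₀ hx)).2.2
      rwa [← hee, h2] at this
    have h4 : ContMDiffAt 𝓘(ℝ, E) 𝓘(ℝ, E) 2 (chartAt E p).symm (R.symm w) := by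
      have hwt : R.symm w ∈ (chartAt E p).target := by
        have hw1 : w ∈ e₁.target := by
          have := e₁.map_source (hUs hx)
          rwa [← hee, h2] at this
        rw [OpenPartialHomeomorph.trans_target] at hw1
        exact hw1.2
      exact ((contMDiffOn_chart_symm (I := 𝓘(ℝ, E)) (n := ∞) (x := p)).contMDiffAt
        ((chartAt E p).open_target.mem_nhds hwt)).of_le two_le_infty
    exact (ContMDiffAt.comp w h4 h3.contMDiffAt).contMDiffWithinAt
  · intro γ x hx
    rw [hes] at hx ⊢
    refine ⟨hUinv γ x hx, ?_⟩
    rw [hee, hee, hFe _ (hUinv γ x hx), hFe x hx, hFequiv]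
  · refine ⟨e.continuousAt (by rw [hes]; exact hpU), ?_⟩
    refine HasFDerivAt.hasFDerivWithinAt (E := E) (F := E) ?_
    refine hGd.congr_of_eventuallyEq ?_
    filter_upwards [(isOpen_extChartAt_target (I := 𝓘(ℝ, E)) p).mem_nhds
      (mem_extChartAt_target p)] with z hz
    simp only [writtenInExtChartAt, Function.comp_apply, extChartAt_model_space_eq_id, PartialEquiv.refl_coe, id]
    rw [hee, he₁, hϕ, (extChartAt 𝓘(ℝ, E) p).right_inv hz]

end Linearization

/-! ### The Hessian of the moment map at a fixed point -/

section Hessian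

variable {E : Type*} [NormedAddCommGroup E] [NormedSpace ℝ E]
  {M : Type*} [TopologicalSpace M] [ChartedSpace E M] {n : ℕ} [MulAction (Torus n) M]

/-- `Φ` is a moment map for the action of `T^n` on `(M, Ω)`. -/
def IsMomentMap (Ω : SymplecticForm E M) (n : ℕ) [MulAction (Torus n) M]
    (Φ : M → ((Fin n → ℝ) →L[ℝ] ℝ)) : Prop :=
  ContMDiff 𝓘(ℝ, E) 𝓘(ℝ, (Fin n → ℝ) →L[ℝ] ℝ) ∞ Φ ∧
    (∀ (g : Torus n) (x : M), Φ (g • x) = Φ x) ∧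
    ∀ (ξ : Fin n → ℝ) (x : M) (v : TangentSpace 𝓘(ℝ, E) x),
      mfderiv 𝓘(ℝ, E) 𝓘(ℝ, ℝ) (fun y : M => Φ y ξ) x v
        = Ω.form x ![infinitesimalAction n x ξ, v]

/-- The value of the symplectic form at `x`, as a function of two vectors of the model space. -/
def SymplecticForm.omega (Ω : SymplecticForm E M) (x : M) (u v : E) : ℝ := Ω.form x ![u, v]

lemma alternating_smul_left (T : E [⋀^Fin 2]→L[ℝ] ℝ) (c : ℝ) (u v : E) :
    T ![c • u, v] = c * T ![u, v] := by
  have h1 := T.map_update_smul ![u, v] 0 c u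
  have h2 : ∀ w, Function.update ![u, v] 0 w = ![w, v] := by
    intro w; ext i; fin_cases i <;> rfl
  rwa [h2, h2] at h1

lemma localForm_apply (Ω : SymplecticForm E M) (p : M) (z : E) (u v : E) :
    localForm Ω.form p z ![u, v] = Ω.omega ((extChartAt 𝓘(ℝ, E) p).symm z)
      (mfderiv 𝓘(ℝ, E) 𝓘(ℝ, E) (extChartAt 𝓘(ℝ, E) p).symm z u)
      (mfderiv 𝓘(ℝ, E) 𝓘(ℝ, E) (extChartAt 𝓘(ℝ, E) p).symm z v) := by
  refine congrArg (Ω.form ((extChartAt 𝓘(ℝ, E) p).symm z)) ?_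
  ext i
  fin_cases i <;> rfl

lemma IsMomentMap.contMDiff {Ω : SymplecticForm E M} {Φ : M → ((Fin n → ℝ) →L[ℝ] ℝ)}
    (h : IsMomentMap Ω n Φ) (ξ : Fin n → ℝ) :
    ContMDiff 𝓘(ℝ, E) 𝓘(ℝ, ℝ) ∞ (fun y : M => Φ y ξ) :=
  (ContinuousLinearMap.contMDiff (ContinuousLinearMap.apply ℝ ℝ ξ)).comp h.1

/-- The flow of the vector field of `ξ`, read in the preferred chart at `p`. -/
def chartFlow (E : Type*) [NormedAddCommGroup E] [NormedSpace ℝ E] {M : Type*} [TopologicalSpace M]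
    [ChartedSpace E M] {n : ℕ} [MulAction (Torus n) M] (p : M) (ξ : Fin n → ℝ) (z : ℝ × E) : E :=
  extChartAt 𝓘(ℝ, E) p (torusExp (z.1 • ξ) • (extChartAt 𝓘(ℝ, E) p).symm z.2)

/-- The vector field of `ξ`, read in the preferred chart at `p`. -/
def chartField (E : Type*) [NormedAddCommGroup E] [NormedSpace ℝ E] {M : Type*} [TopologicalSpace M]
    [ChartedSpace E M] {n : ℕ} [MulAction (Torus n) M] (p : M) (ξ : Fin n → ℝ) (z : E) : E :=
  fderiv ℝ (chartFlow E p ξ) (0, z) (1, 0)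

lemma mfderiv_extChartAt_symm_self (p : M) :
    (mfderiv 𝓘(ℝ, E) 𝓘(ℝ, E) (extChartAt 𝓘(ℝ, E) p).symm (extChartAt 𝓘(ℝ, E) p p) : E →L[ℝ] E)
      = ContinuousLinearMap.id ℝ E := by
  refine HasMFDerivAt.mfderiv (I := 𝓘(ℝ, E)) (I' := 𝓘(ℝ, E)) ?_
  refine ⟨continuousAt_extChartAt_symm p, ?_⟩
  refine HasFDerivAt.hasFDerivWithinAt (E := E) (F := E) ?_
  refine (hasFDerivAt_id _).congr_of_eventuallyEq ?_
  filter_upwards [(isOpen_extChartAt_target (I := 𝓘(ℝ, E)) p).mem_nhds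
    (mem_extChartAt_target p)] with z hz
  simp only [writtenInExtChartAt, Function.comp_apply, extChartAt_model_space_eq_id,
    PartialEquiv.refl_symm, PartialEquiv.refl_coe, id]
  rw [extChartAt_to_inv]
  exact (extChartAt 𝓘(ℝ, E) p).right_inv hz

lemma localForm_self {Ω : SymplecticForm E M} (p : M) (u v : E) :
    localForm Ω.form p (extChartAt 𝓘(ℝ, E) p p) ![u, v] = Ω.omega p u v := by
  have h := mfderiv_extChartAt_symm_self (E := E) p
  rw [localForm_apply, extChartAt_to_inv]
  exact congrArg₂ (Ω.omega p) (congrArg (fun T : E →L[ℝ] E => T u) h)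
    (congrArg (fun T : E →L[ℝ] E => T v) h)

variable [IsManifold 𝓘(ℝ, E) ∞ M]

lemma mdifferentiableAt_extChartAt_symm {p : M} {z : E} (hz : z ∈ (extChartAt 𝓘(ℝ, E) p).target) :
    MDifferentiableAt 𝓘(ℝ, E) 𝓘(ℝ, E) (extChartAt 𝓘(ℝ, E) p).symm z := by
  have := mdifferentiableWithinAt_extChartAt_symm (I := 𝓘(ℝ, E)) hz
  rwa [modelWithCornersSelf_coe, range_id, mdifferentiableWithinAt_univ] at this

lemma contMDiffAt_extChartAt_symm' {p : M} {z : E} (hz : z ∈ (extChartAt 𝓘(ℝ, E) p).target) :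
    ContMDiffAt 𝓘(ℝ, E) 𝓘(ℝ, E) ∞ (extChartAt 𝓘(ℝ, E) p).symm z :=
  (contMDiffOn_extChartAt_symm p).contMDiffAt ((isOpen_extChartAt_target p).mem_nhds hz)

lemma contDiffAt_chartFlow (hA : ContMDiffSMul (torusModel n) 𝓘(ℝ, E) ∞ (Torus n) M) (p : M)
    (ξ : Fin n → ℝ) {z : E} (hz : z ∈ (extChartAt 𝓘(ℝ, E) p).target) :
    ContDiffAt ℝ ∞ (chartFlow E p ξ) (0, z) := by
  rw [← contMDiffAt_iff_contDiffAt]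
  have h1 : ContMDiffAt 𝓘(ℝ, ℝ × E) 𝓘(ℝ, Fin n → ℝ) ∞ (fun w : ℝ × E => w.1 • ξ) (0, z) :=
    ContDiffAt.contMDiffAt (by fun_prop)
  have h2 : ContMDiffAt 𝓘(ℝ, ℝ × E) 𝓘(ℝ, E) ∞
      (fun w : ℝ × E => (extChartAt 𝓘(ℝ, E) p).symm w.2) (0, z) :=
    (contMDiffAt_extChartAt_symm' hz).comp (0, z)
      (ContDiffAt.contMDiffAt (f := fun w : ℝ × E => w.2) (by fun_prop))
  have h3 : ContMDiffAt 𝓘(ℝ, ℝ × E) 𝓘(ℝ, E) ∞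
      (fun w : ℝ × E => torusExp (w.1 • ξ) • (extChartAt 𝓘(ℝ, E) p).symm w.2) (0, z) :=
    ((contMDiff_torusExp_smul hA).contMDiffAt).comp (0, z) (h1.prodMk h2)
  refine ContMDiffAt.comp (g := extChartAt 𝓘(ℝ, E) p) (0, z) ?_ h3
  refine contMDiffAt_extChartAt' ?_
  rw [← extChartAt_source 𝓘(ℝ, E)]
  simpa using (extChartAt 𝓘(ℝ, E) p).map_target hz

/-- The chart expression of the vector field of `ξ` represents the infinitesimal action. -/
lemma mfderiv_symm_chartField (hA : ContMDiffSMul (torusModel n) 𝓘(ℝ, E) ∞ (Torus n) M) (p : M)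
    (ξ : Fin n → ℝ) {z : E} (hz : z ∈ (extChartAt 𝓘(ℝ, E) p).target) :
    (mfderiv 𝓘(ℝ, E) 𝓘(ℝ, E) (extChartAt 𝓘(ℝ, E) p).symm z (chartField E p ξ z) : E)
      = infinitesimalAction (E := E) n ((extChartAt 𝓘(ℝ, E) p).symm z) ξ := by
  set ϕ := extChartAt 𝓘(ℝ, E) p with hϕ
  set x := ϕ.symm z with hx
  have hxs : x ∈ ϕ.source := ϕ.map_target hz
  -- the curve `t ↦ ϕ(exp(tξ) x)` has velocity `chartField` at `t = 0`
  have h1 : HasFDerivAt (fun t : ℝ => chartFlow E p ξ (t, z))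
      ((fderiv ℝ (chartFlow E p ξ) (0, z)).comp (ContinuousLinearMap.inl ℝ ℝ E)) 0 :=
    HasFDerivAt.comp (g := chartFlow E p ξ) (f := fun t : ℝ => (t, z)) (0 : ℝ)
      ((contDiffAt_chartFlow hA p ξ hz).differentiableAt (by simp)).hasFDerivAt
      (hasFDerivAt_prodMk_left (𝕜 := ℝ) (0 : ℝ) z)
  have e1 : HasMFDerivAt 𝓘(ℝ, ℝ) 𝓘(ℝ, Fin n → ℝ) (fun t : ℝ => t • ξ) 0
      (ContinuousLinearMap.toSpanSingleton ℝ ξ) := by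
    refine HasFDerivAt.hasMFDerivAt ?_
    exact (ContinuousLinearMap.toSpanSingleton ℝ ξ).hasFDerivAt
  have e2 : HasMFDerivAt 𝓘(ℝ, ℝ) 𝓘(ℝ, E) (fun t : ℝ => torusExp (t • ξ) • x) 0
      ((infinitesimalAction (E := E) n x).comp (ContinuousLinearMap.toSpanSingleton ℝ ξ)) := by
    refine HasMFDerivAt.comp (g := fun η : Fin n → ℝ => torusExp η • x) (0 : ℝ) ?_ e1
    rw [zero_smul]
    exact hasMFDerivAt_orbitMap hA x
  have h0 : torusExp ((0 : ℝ) • ξ) • x = x := by simp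
  have e3 : MDifferentiableAt 𝓘(ℝ, E) 𝓘(ℝ, E) ϕ (torusExp ((0 : ℝ) • ξ) • x) := by
    rw [h0]
    exact mdifferentiableAt_extChartAt (by rwa [← extChartAt_source 𝓘(ℝ, E)])
  have e4 := (e3.hasMFDerivAt.comp (0 : ℝ) e2).hasFDerivAt
  have e5 := h1.unique e4
  have e6 := congrArg (fun T : ℝ →L[ℝ] E => T 1) e5
  have e7 : chartField E p ξ z = mfderiv 𝓘(ℝ, E) 𝓘(ℝ, E) ϕ x (infinitesimalAction (E := E) n x ξ) := by
    have e8 : (ContinuousLinearMap.toSpanSingleton ℝ ξ) 1 = ξ := by simp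
    rw [h0] at e6
    refine Eq.trans e6 ?_
    show mfderiv 𝓘(ℝ, E) 𝓘(ℝ, E) ϕ x (infinitesimalAction (E := E) n x
      ((ContinuousLinearMap.toSpanSingleton ℝ ξ) 1)) = _
    rw [e8]
  rw [e7]
  have h2 := mfderivWithin_extChartAt_symm_comp_mfderiv_extChartAt (I := 𝓘(ℝ, E)) hz
  rw [modelWithCornersSelf_coe, range_id, mfderivWithin_univ] at h2
  exact congrArg (fun T : E →L[ℝ] E => T (infinitesimalAction (E := E) n x ξ)) h2

/-- The linearization at a fixed point of the vector field of `ξ` is the generator of the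
one-parameter group of isotropy actions of `ξ`. -/
lemma exists_linearized_field (hA : ContMDiffSMul (torusModel n) 𝓘(ℝ, E) ∞ (Torus n) M) {p : M}
    (hp : p ∈ MulAction.fixedPoints (Torus n) M) (ξ : Fin n → ℝ) :
    ∃ A : E →L[ℝ] E, HasFDerivAt (chartField E p ξ) A (extChartAt 𝓘(ℝ, E) p p) ∧
      ∀ u : E, HasDerivAt (fun t : ℝ => endDeriv (E := E) (fun x : M => torusExp (t • ξ) • x) p u)
        (A u) 0 := by
  set ϕ := extChartAt 𝓘(ℝ, E) p with hϕ
  set z₀ := ϕ p with hz₀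
  have hz₀t : z₀ ∈ ϕ.target := mem_extChartAt_target p
  set b := chartFlow E p ξ with hb
  have hbs := contDiffAt_chartFlow hA p ξ hz₀t
  have hsymm : IsSymmSndFDerivAt ℝ b (0, z₀) := hbs.isSymmSndFDerivAt (by
    rw [minSmoothness_of_isRCLikeNormedField]; exact two_le_infty)
  have hd : HasFDerivAt (fderiv ℝ b) (fderiv ℝ (fderiv ℝ b) (0, z₀)) (0, z₀) :=
    ((hbs.fderiv_right (m := 1) (by norm_cast)).differentiableAt (by simp)).hasFDerivAt
  set B := fderiv ℝ (fderiv ℝ b) (0, z₀) with hB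
  let A : E →L[ℝ] E := (B.flip (1, 0)).comp (ContinuousLinearMap.inr ℝ ℝ E)
  refine ⟨A, ?_, fun u => ?_⟩
  · have h1 : HasFDerivAt (fun z : E => fderiv ℝ b ((0 : ℝ), z))
        (B.comp (ContinuousLinearMap.inr ℝ ℝ E)) z₀ :=
      hd.comp z₀ (hasFDerivAt_prodMk_right (𝕜 := ℝ) (0 : ℝ) z₀)
    have h2 := h1.clm_apply (hasFDerivAt_const ((1 : ℝ), (0 : E)) z₀)
    refine h2.congr_fderiv ?_
    ext v
    simp [A]
  · have h1 : HasFDerivAt (fun t : ℝ => fderiv ℝ b (t, z₀))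
        (B.comp (ContinuousLinearMap.inl ℝ ℝ E)) 0 :=
      hd.comp (0 : ℝ) (hasFDerivAt_prodMk_left (𝕜 := ℝ) (0 : ℝ) z₀)
    have h2 := (h1.clm_apply (hasFDerivAt_const ((0 : ℝ), u) (0 : ℝ))).hasDerivAt
    have h3 : HasDerivAt (fun t : ℝ => fderiv ℝ b (t, z₀) ((0 : ℝ), u)) (A u) 0 := by
      convert! h2 using 1
      simp only [A, ContinuousLinearMap.comp_apply, ContinuousLinearMap.flip_apply,
        ContinuousLinearMap.inr_apply, ContinuousLinearMap.inl_apply,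
        add_apply, zero_apply, map_zero, zero_add]
      exact hsymm _ _
    refine h3.congr_of_eventuallyEq ?_
    have hev : ∀ᶠ w in 𝓝 ((0 : ℝ), z₀), DifferentiableAt ℝ b w := by
      have := (hbs.of_le (m := 1) (by norm_cast)).eventually (by simp)
      filter_upwards [this] with w hw using hw.differentiableAt (by simp)
    have hev' : ∀ᶠ t in 𝓝 (0 : ℝ), DifferentiableAt ℝ b (t, z₀) :=
      (Continuous.tendsto (f := fun t : ℝ => (t, z₀)) (by fun_prop) 0).eventually hev
    filter_upwards [hev'] with t ht
    have e1 : HasFDerivAt (fun z : E => b (t, z))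
        ((fderiv ℝ b (t, z₀)).comp (ContinuousLinearMap.inr ℝ ℝ E)) z₀ :=
      ht.hasFDerivAt.comp z₀ (hasFDerivAt_prodMk_right (𝕜 := ℝ) t z₀)
    have e2 := hasFDerivAt_chart (mdifferentiableAt_smul hA (torusExp (t • ξ)) p) (hp _)
    have e3 := e2.unique e1
    rw [e3]
    simp

/-- The differential of a component of the moment map, in the preferred chart at `p`. -/
lemma hasFDerivAt_momentMap_chart {Ω : SymplecticForm E M} {Φ : M → ((Fin n → ℝ) →L[ℝ] ℝ)}
    (hA : ContMDiffSMul (torusModel n) 𝓘(ℝ, E) ∞ (Torus n) M) (hΦ : IsMomentMap Ω n Φ) (p : M)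
    (ξ : Fin n → ℝ) {z : E} (hz : z ∈ (extChartAt 𝓘(ℝ, E) p).target) :
    DifferentiableAt ℝ (fun w => Φ ((extChartAt 𝓘(ℝ, E) p).symm w) ξ) z ∧
    ∀ v : E, fderiv ℝ (fun w => Φ ((extChartAt 𝓘(ℝ, E) p).symm w) ξ) z v =
      localForm Ω.form p z ![chartField E p ξ z, v] := by
  set ϕ := extChartAt 𝓘(ℝ, E) p with hϕ
  have h1 : HasMFDerivAt 𝓘(ℝ, E) 𝓘(ℝ, ℝ) (fun w => Φ (ϕ.symm w) ξ) z _ :=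
    ((hΦ.contMDiff ξ).mdifferentiable (by simp) (ϕ.symm z)).hasMFDerivAt.comp z
      (mdifferentiableAt_extChartAt_symm hz).hasMFDerivAt
  let T : E →L[ℝ] ℝ := ContinuousLinearMap.comp (M₂ := E)
    (mfderiv 𝓘(ℝ, E) 𝓘(ℝ, ℝ) (fun y : M => Φ y ξ) (ϕ.symm z))
    (mfderiv 𝓘(ℝ, E) 𝓘(ℝ, E) ϕ.symm z)
  have h2 : HasFDerivAt (fun w => Φ (ϕ.symm w) ξ) T z := h1.hasFDerivAt
  refine ⟨h2.differentiableAt, fun v => ?_⟩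
  rw [h2.fderiv]
  refine Eq.trans (hΦ.2.2 ξ (ϕ.symm z) (mfderiv 𝓘(ℝ, E) 𝓘(ℝ, E) ϕ.symm z v)) ?_
  rw [localForm_apply, mfderiv_symm_chartField hA p ξ hz]
  rfl

/-- The Hessian of a component of the moment map at a fixed point `p`, in the preferred chart: it
pairs the linearized vector field with the symplectic form. Continuity of the form suffices, since
the vector field vanishes at `p`. -/
lemma hessian_momentMap_chart {Ω : SymplecticForm E M} {Φ : M → ((Fin n → ℝ) →L[ℝ] ℝ)}
    (hA : ContMDiffSMul (torusModel n) 𝓘(ℝ, E) ∞ (Torus n) M) (hΦ : IsMomentMap Ω n Φ) {p : M}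
    (hp : p ∈ MulAction.fixedPoints (Torus n) M) (ξ : Fin n → ℝ) {A : E →L[ℝ] E}
    (hAd : HasFDerivAt (chartField E p ξ) A (extChartAt 𝓘(ℝ, E) p p)) :
    ContDiffAt ℝ ∞ (fun w => Φ ((extChartAt 𝓘(ℝ, E) p).symm w) ξ) (extChartAt 𝓘(ℝ, E) p p) ∧
    fderiv ℝ (fun w => Φ ((extChartAt 𝓘(ℝ, E) p).symm w) ξ) (extChartAt 𝓘(ℝ, E) p p) = 0 ∧
    ∀ u v : E, fderiv ℝ (fderiv ℝ (fun w => Φ ((extChartAt 𝓘(ℝ, E) p).symm w) ξ))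
      (extChartAt 𝓘(ℝ, E) p p) u v = Ω.omega p (A u) v := by
  set ϕ := extChartAt 𝓘(ℝ, E) p with hϕ
  set z₀ := ϕ p with hz₀
  have hz₀t : z₀ ∈ ϕ.target := mem_extChartAt_target p
  set F := fun w => Φ (ϕ.symm w) ξ with hF
  have hFs : ContDiffAt ℝ ∞ F z₀ := by
    rw [← contMDiffAt_iff_contDiffAt]
    exact (hΦ.contMDiff ξ).contMDiffAt.comp z₀ (contMDiffAt_extChartAt_symm' hz₀t)
  have hζ0 : chartField E p ξ z₀ = 0 := by
    have h1 := mfderiv_symm_chartField hA p ξ hz₀t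
    have h2 := mfderiv_extChartAt_symm_self (E := E) p
    have h3 := congrArg (fun T : E →L[ℝ] E => T (chartField E p ξ z₀)) h2
    have h4 : infinitesimalAction (E := E) n (ϕ.symm z₀) = 0 :=
      infinitesimalAction_eq_zero_of_mem_fixedPoints (by rw [hz₀, hϕ, extChartAt_to_inv]; exact hp)
    have h5 := congrArg (fun T : (Fin n → ℝ) →L[ℝ] E => T ξ) h4
    exact (h3.symm.trans h1).trans h5
  have hcz : ∀ (T : E [⋀^Fin 2]→L[ℝ] ℝ) (v : E), T ![0, v] = 0 :=
    fun T v => T.map_coord_zero 0 rfl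
  refine ⟨hFs, ?_, fun u v => ?_⟩
  · ext v
    rw [(hasFDerivAt_momentMap_chart hA hΦ p ξ hz₀t).2 v, hζ0, hcz]
    simp
  · have hd : HasFDerivAt (fderiv ℝ F) (fderiv ℝ (fderiv ℝ F) z₀) z₀ :=
      ((hFs.fderiv_right (m := 1) (by norm_cast)).differentiableAt (by simp)).hasFDerivAt
    have hline : HasDerivAt (fun t : ℝ => z₀ + t • u) u 0 := by
      simpa using ((hasDerivAt_id (0:ℝ)).smul_const u).const_add z₀
    have hline0 : z₀ + (0 : ℝ) • u = z₀ := by simp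
    have h1 : HasDerivAt (fun t : ℝ => fderiv ℝ F (z₀ + t • u) v)
        (fderiv ℝ (fderiv ℝ F) z₀ u v) 0 := by
      have hd' : HasFDerivAt (fderiv ℝ F) (fderiv ℝ (fderiv ℝ F) z₀) (z₀ + (0 : ℝ) • u) := by
        rwa [hline0]
      have := hd'.comp_hasDerivAt (0 : ℝ) hline
      exact ((ContinuousLinearMap.apply ℝ ℝ v).hasFDerivAt).comp_hasDerivAt (0 : ℝ) this
    have h2 : HasDerivAt (fun t : ℝ => chartField E p ξ (z₀ + t • u)) (A u) 0 := by
      have hAd' : HasFDerivAt (chartField E p ξ) A (z₀ + (0 : ℝ) • u) := by rwa [hline0]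
      exact hAd'.comp_hasDerivAt (0 : ℝ) hline
    have hcont : ContinuousAt (fun t : ℝ => localForm Ω.form p (z₀ + t • u)) 0 := by
      have h3 : ContinuousAt (localForm Ω.form p) (z₀ + (0 : ℝ) • u) := by
        rw [hline0]
        exact (Ω.smooth p).continuousOn.continuousAt ((isOpen_extChartAt_target p).mem_nhds hz₀t)
      exact ContinuousAt.comp (f := fun t : ℝ => z₀ + t • u) (x := (0 : ℝ)) h3 hline.continuousAt
    have hev : ∀ᶠ t in 𝓝 (0 : ℝ), z₀ + t • u ∈ ϕ.target := by
      refine hline.continuousAt.eventually_mem ?_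
      rw [hline0]
      exact (isOpen_extChartAt_target p).mem_nhds hz₀t
    have h4 : HasDerivAt (fun t : ℝ => fderiv ℝ F (z₀ + t • u) v)
        (localForm Ω.form p z₀ ![A u, v]) 0 := by
      rw [hasDerivAt_iff_tendsto_slope_zero]
      rw [hasDerivAt_iff_tendsto_slope_zero] at h2
      simp only [zero_add, hline0, hζ0, sub_zero] at h2 ⊢
      have h5 : Tendsto (fun t : ℝ => localForm Ω.form p (z₀ + t • u)) (𝓝[≠] 0)
          (𝓝 (localForm Ω.form p z₀)) := by
        have := hcont.tendsto
        rw [hline0] at this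
        exact this.mono_left nhdsWithin_le_nhds
      have h6 : Tendsto (fun t : ℝ => ![t⁻¹ • chartField E p ξ (z₀ + t • u), v]) (𝓝[≠] 0)
          (𝓝 ![A u, v]) := by
        rw [tendsto_pi_nhds]
        intro i
        fin_cases i
        · exact h2
        · exact tendsto_const_nhds
      have h7 : Tendsto (fun t : ℝ => localForm Ω.form p (z₀ + t • u)
          ![t⁻¹ • chartField E p ξ (z₀ + t • u), v]) (𝓝[≠] 0)
          (𝓝 (localForm Ω.form p z₀ ![A u, v])) := h5.eval h6
      refine h7.congr' ?_
      filter_upwards [mem_nhdsWithin_of_mem_nhds hev] with t ht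
      have e0 : fderiv ℝ F z₀ v = 0 := by
        rw [(hasFDerivAt_momentMap_chart hA hΦ p ξ hz₀t).2 v, hζ0, hcz]
      rw [e0, sub_zero, (hasFDerivAt_momentMap_chart hA hΦ p ξ ht).2 v]
      rw [alternating_smul_left, smul_eq_mul]
    rw [h1.unique h4]
    exact localForm_self p _ _

end Hessian

/-! ### Fixed point sets of finite subgroups -/

section FixedSet

variable {E : Type*} [NormedAddCommGroup E] [NormedSpace ℝ E]
  {M : Type*} [TopologicalSpace M] [ChartedSpace E M] {n : ℕ} [MulAction (Torus n) M]

variable (M) in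
/-- The set of points of `M` fixed by the subgroup `K`. -/
def fixedSet (K : Subgroup (Torus n)) : Set M := {x | ∀ k ∈ K, k • x = x}

variable (E) in
/-- The space of tangent vectors at `x` fixed by the differentials of the elements of `K`. At a
point fixed by `K` it is the tangent space of the fixed point set of `K`. -/
def fixedTangent (K : Subgroup (Torus n)) (x : M) : Submodule ℝ E where
  carrier := {v | ∀ k ∈ K, endDeriv (fun y : M => k • y) x v = v}
  add_mem' := by
    intro u v hu hv k hk
    rw [map_add, hu k hk, hv k hk]
  zero_mem' := fun k _ => map_zero _
  smul_mem' := by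
    intro c v hv k hk
    rw [map_smul, hv k hk]

omit [TopologicalSpace M] in
lemma mem_fixedSet_of_mem_fixedPoints {K : Subgroup (Torus n)} {x : M}
    (hx : x ∈ MulAction.fixedPoints (Torus n) M) : x ∈ fixedSet M K := fun k _ => hx k

/-- A chart at `p`, linear for the action of `K`. -/
structure IsLinearChart (K : Subgroup (Torus n)) (p : M) (e : OpenPartialHomeomorph M E) :
    Prop where
  mem_source : p ∈ e.source
  map_self : e p = 0
  contMDiffOn : ContMDiffOn 𝓘(ℝ, E) 𝓘(ℝ, E) 2 e e.source
  contMDiffOn_symm : ContMDiffOn 𝓘(ℝ, E) 𝓘(ℝ, E) 2 e.symm e.target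
  smul_mem : ∀ k ∈ K, ∀ x ∈ e.source, k • x ∈ e.source
  map_smul : ∀ k ∈ K, ∀ x ∈ e.source, e (k • x) = endDeriv (fun y : M => k • y) p (e x)
  hasMFDerivAt : HasMFDerivAt 𝓘(ℝ, E) 𝓘(ℝ, E) e p (ContinuousLinearMap.id ℝ E)

lemma exists_isLinearChart [IsManifold 𝓘(ℝ, E) ∞ M] [CompleteSpace E]
    (hA : ContMDiffSMul (torusModel n) 𝓘(ℝ, E) ∞ (Torus n) M) (K : Subgroup (Torus n)) [Finite K]
    {p : M} (hp : p ∈ fixedSet M K) :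
    ∃ e : OpenPartialHomeomorph M E, IsLinearChart K p e := by
  obtain ⟨e, h1, h2, h3, h4, h5, h6⟩ := exists_linearizing_chart (E := E)
    (MulAction.toPermHom K M) (fun k => contMDiff_const_smul' hA (k : Torus n))
    (fun k => hp k k.2)
  exact ⟨e, h1, h2, h3, h4, fun k hk x hx => (h5 ⟨k, hk⟩ x hx).1,
    fun k hk x hx => (h5 ⟨k, hk⟩ x hx).2, h6⟩

namespace IsLinearChart

variable {K : Subgroup (Torus n)} {p : M} {e : OpenPartialHomeomorph M E}

lemma mem_fixedSet_iff (he : IsLinearChart K p e) {x : M} (hx : x ∈ e.source) :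
    x ∈ fixedSet M K ↔ e x ∈ fixedTangent E K p := by
  constructor
  · intro h k hk
    rw [← he.map_smul k hk x hx, h k hk]
  · intro h k hk
    refine e.injOn (he.smul_mem k hk x hx) hx ?_
    rw [he.map_smul k hk x hx]
    exact h k hk

lemma mDifferentiable (he : IsLinearChart K p e) : e.MDifferentiable 𝓘(ℝ, E) 𝓘(ℝ, E) :=
  ⟨he.contMDiffOn.mdifferentiableOn (by simp), he.contMDiffOn_symm.mdifferentiableOn (by simp)⟩

/-- The dimension of the fixed tangent space is locally constant on the fixed point set. -/
lemma finrank_fixedTangent (hA : ContMDiffSMul (torusModel n) 𝓘(ℝ, E) ∞ (Torus n) M)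
    (he : IsLinearChart K p e) {x : M} (hx : x ∈ e.source) (hxK : x ∈ fixedSet M K) :
    Module.finrank ℝ (fixedTangent E K x) = Module.finrank ℝ (fixedTangent E K p) := by
  let L : E →L[ℝ] E := mfderiv 𝓘(ℝ, E) 𝓘(ℝ, E) e x
  have hbij : Function.Bijective L := he.mDifferentiable.mfderiv_bijective hx
  have hcomm : ∀ k ∈ K, ∀ v, L (endDeriv (fun y : M => k • y) x v) =
      endDeriv (fun y : M => k • y) p (L v) := by
    intro k hk v
    have hex : HasMFDerivAt 𝓘(ℝ, E) 𝓘(ℝ, E) e x L :=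
      (he.mDifferentiable.mdifferentiableAt hx).hasMFDerivAt
    have hex' : HasMFDerivAt 𝓘(ℝ, E) 𝓘(ℝ, E) e (k • x) L := by rwa [hxK k hk]
    let Dx : E →L[ℝ] E := endDeriv (E := E) (fun y : M => k • y) x
    let Dp : E →L[ℝ] E := endDeriv (E := E) (fun y : M => k • y) p
    have h1 : HasMFDerivAt 𝓘(ℝ, E) 𝓘(ℝ, E) (fun y : M => e (k • y)) x (L.comp Dx) :=
      hex'.comp x (mdifferentiableAt_smul hA k x).hasMFDerivAt
    have h2 : HasMFDerivAt 𝓘(ℝ, E) 𝓘(ℝ, E) (fun y : M => Dp (e y)) x (Dp.comp L) :=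
      (Dp.hasMFDerivAt (x := e x)).comp x hex
    have h3 := h2.congr_of_eventuallyEq (f₁ := fun y : M => e (k • y)) (by
      filter_upwards [e.open_source.mem_nhds hx] with y hy
      exact he.map_smul k hk y hy)
    have h4 := hasMFDerivAt_unique h1 h3
    exact congrArg (fun T : E →L[ℝ] E => T v) h4
  let Le : E ≃ₗ[ℝ] E := LinearEquiv.ofBijective L.toLinearMap hbij
  have hmap : (fixedTangent E K x).map (Le : E →ₗ[ℝ] E) = fixedTangent E K p := by
    ext w
    constructor
    · rintro ⟨v, hv, rfl⟩ k hk
      show endDeriv (fun y : M => k • y) p (L v) = L v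
      rw [← hcomm k hk, hv k hk]
    · intro hw
      obtain ⟨v, rfl⟩ := hbij.2 w
      refine ⟨v, fun k hk => hbij.1 ?_, rfl⟩
      rw [hcomm k hk]
      exact hw k hk
  rw [← hmap]
  exact (LinearEquiv.finrank_map_eq Le _).symm

end IsLinearChart

lemma isClosed_fixedSet [T2Space M] (hA : ContMDiffSMul (torusModel n) 𝓘(ℝ, E) ∞ (Torus n) M)
    (K : Subgroup (Torus n)) : IsClosed (fixedSet M K) := by
  have := continuousSMul_torus hA
  have : fixedSet M K = ⋂ k ∈ K, {x | k • x = x} := by ext; simp [fixedSet]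
  rw [this]
  exact isClosed_biInter fun k _ => isClosed_eq (continuous_const_smul k) continuous_id

variable (M) in
/-- The connected component of `y` in the fixed point set of `K`. -/
def fixedComponent (K : Subgroup (Torus n)) (y : M) : Set M := connectedComponentIn (fixedSet M K) y

lemma isClosed_fixedComponent [T2Space M]
    (hA : ContMDiffSMul (torusModel n) 𝓘(ℝ, E) ∞ (Torus n) M) (K : Subgroup (Torus n)) (y : M) :
    IsClosed (fixedComponent M K y) := by
  by_cases hy : y ∈ fixedSet M K
  · refine isClosed_of_closure_subset ?_
    refine (isPreconnected_connectedComponentIn.closure).subset_connectedComponentIn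
      (subset_closure (mem_connectedComponentIn hy)) ?_
    exact closure_minimal (connectedComponentIn_subset _ _) (isClosed_fixedSet hA K)
  · rw [fixedComponent, connectedComponentIn_eq_empty hy]
    exact isClosed_empty

lemma fixedComponent_subset (K : Subgroup (Torus n)) (y : M) :
    fixedComponent M K y ⊆ fixedSet M K := connectedComponentIn_subset _ _

lemma mem_fixedComponent_self {K : Subgroup (Torus n)} {y : M} (hy : y ∈ fixedSet M K) :
    y ∈ fixedComponent M K y := mem_connectedComponentIn hy

/-- A linear chart at a point `y` of a component `Y` of the fixed point set parametrizes `Y` near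
`y` by the fixed tangent space; here this space is presented as the image of a linear map `ι` with
linear right inverse `r`. -/
lemma IsLinearChart.exists_parametrization {K : Subgroup (Torus n)} {y₀ y : M}
    {e : OpenPartialHomeomorph M E} (he : IsLinearChart K y e) (hy : y ∈ fixedComponent M K y₀)
    {N : Type*} [NormedAddCommGroup N] [NormedSpace ℝ N] (ι : N →L[ℝ] E) (r : E →L[ℝ] N)
    (hι : ∀ v, ι v ∈ fixedTangent E K y) (hr : ∀ w ∈ fixedTangent E K y, ι (r w) = w) :
    ∃ ψ : N → fixedComponent M K y₀, ψ 0 = ⟨y, hy⟩ ∧ (∀ᶠ v in 𝓝 0, ContinuousAt ψ v) ∧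
      map ψ (𝓝 0) = 𝓝 (ψ 0) ∧ ∀ᶠ v in 𝓝 0, (ψ v : M) = e.symm (ι v) := by
  classical
  have h0t : (0 : E) ∈ e.target := by
    rw [← he.map_self]; exact e.map_source he.mem_source
  have hes0 : e.symm 0 = y := by rw [← he.map_self]; exact e.left_inv he.mem_source
  obtain ⟨δ, hδ, hball⟩ := Metric.mem_nhds_iff.1
    ((e.open_target.preimage ι.continuous).mem_nhds (show (0 : N) ∈ ι ⁻¹' e.target by simpa using h0t))
  let ψ : N → fixedComponent M K y₀ := fun v =>
    if h : e.symm (ι v) ∈ fixedComponent M K y₀ then ⟨_, h⟩ else ⟨y, hy⟩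
  have hcont : ∀ v ∈ ball (0 : N) δ, ContinuousAt (fun v => e.symm (ι v)) v := fun v hv =>
    ContinuousAt.comp (g := e.symm) (f := ι) (e.continuousAt_symm (hball hv)) ι.continuous.continuousAt
  have hmem : ∀ v ∈ ball (0 : N) δ, e.symm (ι v) ∈ fixedComponent M K y₀ := by
    have hsub : (fun v => e.symm (ι v)) '' ball (0 : N) δ ⊆ fixedComponent M K y := by
      refine IsPreconnected.subset_connectedComponentIn ?_ ?_ ?_
      · exact (convex_ball (0:N) δ).isPreconnected.image _
          fun v hv => (hcont v hv).continuousWithinAt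
      · exact ⟨0, mem_ball_self hδ, by simpa using hes0⟩
      · rintro _ ⟨v, hv, rfl⟩
        have hs := e.map_target (hball hv)
        rw [he.mem_fixedSet_iff hs, e.right_inv (hball hv)]
        exact hι v
    intro v hv
    have := hsub (mem_image_of_mem _ hv)
    rwa [fixedComponent, ← connectedComponentIn_eq hy] at this
  have hψ : ∀ v ∈ ball (0 : N) δ, (ψ v : M) = e.symm (ι v) := by
    intro v hv
    simp only [ψ, dif_pos (hmem v hv)]
  have hψ0 : ψ 0 = ⟨y, hy⟩ := by
    ext
    rw [hψ 0 (mem_ball_self hδ), map_zero, hes0]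
  have hψc : ∀ v ∈ ball (0 : N) δ, ContinuousAt ψ v := by
    intro v hv
    rw [IsInducing.subtypeVal.continuousAt_iff]
    refine (hcont v hv).congr ?_
    filter_upwards [isOpen_ball.mem_nhds hv] with w hw
    exact (hψ w hw).symm
  refine ⟨ψ, hψ0, ?_, le_antisymm (hψc 0 (mem_ball_self hδ)) ?_, ?_⟩
  · filter_upwards [ball_mem_nhds (0:N) hδ] with v hv using hψc v hv
  · rw [hψ0]
    have hev : ∀ᶠ z : fixedComponent M K y₀ in 𝓝 ⟨y, hy⟩, (z : M) ∈ e.source :=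
      continuousAt_subtype_val.eventually_mem (e.open_source.mem_nhds he.mem_source)
    have ht : Tendsto (fun z : fixedComponent M K y₀ => r (e z)) (𝓝 ⟨y, hy⟩) (𝓝 0) := by
      have h1 : Tendsto (fun z : fixedComponent M K y₀ => e z) (𝓝 ⟨y, hy⟩) (𝓝 0) := by
        have := (e.continuousAt he.mem_source).comp
          (continuousAt_subtype_val (x := (⟨y, hy⟩ : fixedComponent M K y₀)))
        have h2 := this.tendsto
        simp only [Function.comp_apply, he.map_self] at h2
        exact h2
      have := (r.continuous.tendsto 0).comp h1
      rwa [map_zero] at this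
    refine le_map_of_right_inverse ?_ ht
    filter_upwards [hev, ht.eventually_mem (ball_mem_nhds (0:N) hδ)] with z hz hzb
    ext
    simp only [Function.comp_apply, id]
    rw [hψ _ hzb, hr _ ((he.mem_fixedSet_iff hz).1 (fixedComponent_subset _ _ z.2)), e.left_inv hz]
  · filter_upwards [ball_mem_nhds (0:N) hδ] with v hv using hψ v hv

variable [FiniteDimensional ℝ E]

/-- The special case of `IsLinearChart.exists_parametrization` in which the fixed tangent space
itself is the parameter space. -/
lemma IsLinearChart.exists_parametrization_subtype {K : Subgroup (Torus n)} {y₀ y : M}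
    {e : OpenPartialHomeomorph M E} (he : IsLinearChart K y e) (hy : y ∈ fixedComponent M K y₀) :
    ∃ ψ : fixedTangent E K y → fixedComponent M K y₀,
      ψ 0 = ⟨y, hy⟩ ∧ (∀ᶠ v in 𝓝 0, ContinuousAt ψ v) ∧
      map ψ (𝓝 0) = 𝓝 (ψ 0) ∧ ∀ᶠ v in 𝓝 0, (ψ v : M) = e.symm (v : E) := by
  obtain ⟨r, hr⟩ := LinearMap.exists_leftInverse_of_injective (fixedTangent E K y).subtype
    (Submodule.ker_subtype _)
  exact he.exists_parametrization hy (fixedTangent E K y).subtypeL (LinearMap.toContinuousLinearMap r)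
    (fun v => v.2) fun w hw => by
      have := LinearMap.congr_fun hr ⟨w, hw⟩
      simpa using congrArg Subtype.val this

variable [IsManifold 𝓘(ℝ, E) ∞ M]

lemma locallyConnectedSpace_fixedComponent
    (hA : ContMDiffSMul (torusModel n) 𝓘(ℝ, E) ∞ (Torus n) M) (K : Subgroup (Torus n)) [Finite K]
    (y₀ : M) : LocallyConnectedSpace (fixedComponent M K y₀) := by
  rw [locallyConnectedSpace_iff_connected_subsets]
  rintro ⟨y, hy⟩ U hU
  obtain ⟨e, he⟩ := exists_isLinearChart (E := E) hA K (fixedComponent_subset _ _ hy)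
  obtain ⟨ψ, h0, h1, h2, -⟩ := he.exists_parametrization_subtype hy
  rw [← h0, ← h2] at hU
  obtain ⟨δ, hδ, hball⟩ := Metric.mem_nhds_iff.1 (inter_mem hU h1)
  refine ⟨ψ '' ball 0 δ, ?_, ?_, ?_⟩
  · rw [← h0, ← h2]
    exact image_mem_map (ball_mem_nhds _ hδ)
  · exact (convex_ball _ _).isPreconnected.image _ fun v hv => (hball hv).2.continuousWithinAt
  · rintro _ ⟨v, hv, rfl⟩
    exact (hball hv).1

/-- The dimension of the fixed tangent space is constant on a component of the fixed set. -/
lemma finrank_fixedTangent_eq (hA : ContMDiffSMul (torusModel n) 𝓘(ℝ, E) ∞ (Torus n) M)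
    (K : Subgroup (Torus n)) [Finite K] {y₀ x y : M} (hx : x ∈ fixedComponent M K y₀)
    (hy : y ∈ fixedComponent M K y₀) :
    Module.finrank ℝ (fixedTangent E K x) = Module.finrank ℝ (fixedTangent E K y) := by
  refine (isPreconnected_connectedComponentIn (F := fixedSet M K) (x := y₀)).induction₂
    (fun x y => Module.finrank ℝ (fixedTangent E K x) = Module.finrank ℝ (fixedTangent E K y))
    ?_ (fun x y z _ _ _ h1 h2 => h1.trans h2) (fun x y _ _ h => h.symm) hx hy
  intro x hx
  obtain ⟨e, he⟩ := exists_isLinearChart (E := E) hA K (fixedComponent_subset _ _ hx)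
  filter_upwards [mem_nhdsWithin_of_mem_nhds (e.open_source.mem_nhds he.mem_source),
    self_mem_nhdsWithin] with y hy hyY
  exact (he.finrank_fixedTangent hA hy (fixedComponent_subset _ _ hyY)).symm

end FixedSet

/-! ### Regular and critical points of the moment map on a fixed component -/

section Omega

variable {E : Type*} [NormedAddCommGroup E] [NormedSpace ℝ E]
  {M : Type*} [TopologicalSpace M] [ChartedSpace E M] {n : ℕ} [MulAction (Torus n) M]
  (Ω : SymplecticForm E M)

/-- The symplectic form at `x` as a bilinear form on the model space. -/
def SymplecticForm.bilin (x : M) : LinearMap.BilinForm ℝ E :=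
  LinearMap.mk₂ ℝ (Ω.omega x)
    (fun u u' v => by
      let T : E [⋀^Fin 2]→L[ℝ] ℝ := Ω.form x
      have h1 := T.map_update_add ![u, v] 0 u u'
      have h2 : ∀ w, Function.update ![u, v] 0 w = ![w, v] := by
        intro w; ext i; fin_cases i <;> rfl
      rwa [h2, h2, h2] at h1)
    (fun c u v => alternating_smul_left (E := E) (Ω.form x) c u v)
    (fun u v v' => by
      let T : E [⋀^Fin 2]→L[ℝ] ℝ := Ω.form x
      have h1 := T.map_update_add ![u, v] 1 v v'
      have h2 : ∀ w, Function.update ![u, v] 1 w = ![u, w] := by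
        intro w; ext i; fin_cases i <;> rfl
      rwa [h2, h2, h2] at h1)
    (fun c u v => by
      let T : E [⋀^Fin 2]→L[ℝ] ℝ := Ω.form x
      have h1 := T.map_update_smul ![u, v] 1 c v
      have h2 : ∀ w, Function.update ![u, v] 1 w = ![u, w] := by
        intro w; ext i; fin_cases i <;> rfl
      rwa [h2, h2] at h1)

lemma SymplecticForm.bilin_apply (x : M) (u v : E) : Ω.bilin x u v = Ω.omega x u v := rfl

lemma SymplecticForm.omega_self (x : M) (u : E) : Ω.omega x u u = 0 := by
  let T : E [⋀^Fin 2]→L[ℝ] ℝ := Ω.form x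
  exact T.map_eq_zero_of_eq ![u, u] (i := 0) (j := 1) rfl (by decide)

lemma SymplecticForm.exists_omega_ne_zero (x : M) {u : E} (hu : u ≠ 0) :
    ∃ v, Ω.omega x u v ≠ 0 := by
  by_contra hn
  push Not at hn
  exact hu (Ω.nondegenerate x u hn)

variable {Ω}

lemma IsHamiltonianAction.omega_smul (hτ : IsHamiltonianAction Ω n) {g : Torus n} {x : M}
    (hx : g • x = x) (u v : E) :
    Ω.omega x (endDeriv (fun y : M => g • y) x u) (endDeriv (fun y : M => g • y) x v)
      = Ω.omega x u v := by
  have h : Ω.omega (g • x) (endDeriv (fun y : M => g • y) x u)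
      (endDeriv (fun y : M => g • y) x v) = Ω.omega x u v := hτ.symplectic g x u v
  rwa [hx] at h

lemma endDeriv_smul_mul (hA : ContMDiffSMul (torusModel n) 𝓘(ℝ, E) ∞ (Torus n) M)
    (g h : Torus n) {x : M} (hx : h • x = x) :
    endDeriv (E := E) (fun y : M => (g * h) • y) x =
      (endDeriv (fun y : M => g • y) x).comp (endDeriv (fun y : M => h • y) x) := by
  rw [← endDeriv_comp (mdifferentiableAt_smul hA h x) (mdifferentiableAt_smul hA g x) hx]
  congr 1
  funext y
  simp [mul_smul]

lemma endDeriv_one_smul (x : M) :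
    endDeriv (E := E) (fun y : M => (1 : Torus n) • y) x = ContinuousLinearMap.id ℝ E := by
  rw [← endDeriv_id (M := M) x]
  congr 1
  funext y
  simp

lemma endDeriv_smul_infinitesimalAction
    (hA : ContMDiffSMul (torusModel n) 𝓘(ℝ, E) ∞ (Torus n) M) {g : Torus n} {x : M}
    (hx : g • x = x) (ξ : Fin n → ℝ) :
    endDeriv (E := E) (fun y : M => g • y) x (infinitesimalAction (E := E) n x ξ)
      = infinitesimalAction (E := E) n x ξ := by
  have h := mfderiv_smul_infinitesimalAction (E := E) hA g x ξ
  rw [hx] at h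
  exact h

/-- Averaging over `K` shows that `ω(u, ·)` does not vanish on the fixed tangent space if `u` is a
nonzero fixed vector: the fixed tangent space is symplectic. -/
lemma exists_mem_fixedTangent_omega_ne_zero (hτ : IsHamiltonianAction Ω n)
    {K : Subgroup (Torus n)} [Finite K] {x : M} (hx : x ∈ fixedSet M K) {u : E}
    (hu : u ∈ fixedTangent E K x) (hu0 : u ≠ 0) :
    ∃ v ∈ fixedTangent E K x, Ω.omega x u v ≠ 0 := by
  classical
  have := Fintype.ofFinite K
  obtain ⟨w, hw⟩ := Ω.exists_omega_ne_zero x hu0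
  refine ⟨∑ k : K, endDeriv (fun y : M => (k : Torus n) • y) x w, fun h hh => ?_, ?_⟩
  · rw [map_sum]
    refine Fintype.sum_equiv (Equiv.mulLeft (⟨h, hh⟩ : K)) _ _ fun k => ?_
    simp only [Equiv.coe_mulLeft, Subgroup.coe_mul]
    rw [endDeriv_smul_mul hτ.smooth h k (hx k k.2)]
    rfl
  · rw [← Ω.bilin_apply, map_sum]
    have : ∀ k : K, Ω.bilin x u (endDeriv (fun y : M => (k : Torus n) • y) x w)
        = Ω.omega x u w := by
      intro k
      rw [Ω.bilin_apply]
      conv_lhs => rw [← hu k k.2]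
      exact hτ.omega_smul (hx k k.2) u w
    rw [Finset.sum_congr rfl fun k _ => this k, Finset.sum_const, nsmul_eq_mul]
    refine mul_ne_zero ?_ hw
    simp [Fintype.card_ne_zero]

end Omega

section Dichotomy

variable {E : Type*} [NormedAddCommGroup E] [NormedSpace ℝ E]
  {M : Type*} [TopologicalSpace M] [ChartedSpace E M] {n : ℕ} [MulAction (Torus n) M]
  {Ω : SymplecticForm E M} {Φ : M → ((Fin n → ℝ) →L[ℝ] ℝ)} {K : Subgroup (Torus n)}

lemma IsLinearChart.zero_mem_target {p : M} {e : OpenPartialHomeomorph M E}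
    (he : IsLinearChart K p e) : (0 : E) ∈ e.target := by
  rw [← he.map_self]; exact e.map_source he.mem_source

lemma IsLinearChart.symm_zero {p : M} {e : OpenPartialHomeomorph M E}
    (he : IsLinearChart K p e) : e.symm 0 = p := by
  rw [← he.map_self]; exact e.left_inv he.mem_source

/-- The differential at the origin of the inverse of a linear chart is the identity. -/
lemma IsLinearChart.hasMFDerivAt_symm {p : M} {e : OpenPartialHomeomorph M E}
    (he : IsLinearChart K p e) :
    HasMFDerivAt 𝓘(ℝ, E) 𝓘(ℝ, E) e.symm 0 (ContinuousLinearMap.id ℝ E) := by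
  have h1 : HasMFDerivAt 𝓘(ℝ, E) 𝓘(ℝ, E) e.symm 0 _ :=
    ((he.contMDiffOn_symm.contMDiffAt (e.open_target.mem_nhds he.zero_mem_target)).mdifferentiableAt
      (by simp)).hasMFDerivAt
  let T : E →L[ℝ] E := mfderiv 𝓘(ℝ, E) 𝓘(ℝ, E) e.symm 0
  have h2 : HasMFDerivAt 𝓘(ℝ, E) 𝓘(ℝ, E) e (e.symm 0) (ContinuousLinearMap.id ℝ E) := by
    rw [he.symm_zero]; exact he.hasMFDerivAt
  have h3 : HasMFDerivAt 𝓘(ℝ, E) 𝓘(ℝ, E) (e ∘ e.symm) 0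
      ((ContinuousLinearMap.id ℝ E).comp T) := h2.comp 0 h1
  have h4 : HasMFDerivAt 𝓘(ℝ, E) 𝓘(ℝ, E) (e ∘ e.symm) 0 (ContinuousLinearMap.id ℝ E) := by
    refine (hasMFDerivAt_id (I := 𝓘(ℝ, E)) (0 : E)).congr_of_eventuallyEq ?_
    filter_upwards [e.open_target.mem_nhds he.zero_mem_target] with z hz
    exact e.right_inv hz
  have h5 : (ContinuousLinearMap.id ℝ E).comp T = ContinuousLinearMap.id ℝ E :=
    hasMFDerivAt_unique h3 h4
  rw [ContinuousLinearMap.id_comp] at h5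
  exact h1.congr_mfderiv h5

lemma IsLinearChart.contDiffAt_momentMap {p : M} {e : OpenPartialHomeomorph M E}
    (he : IsLinearChart K p e) (hΦ : IsMomentMap Ω n Φ) (ξ : Fin n → ℝ) :
    ContDiffAt ℝ 2 (fun w => Φ (e.symm w) ξ) 0 := by
  rw [← contMDiffAt_iff_contDiffAt]
  exact (((hΦ.contMDiff ξ).of_le two_le_infty).contMDiffAt).comp (0 : E)
    (he.contMDiffOn_symm.contMDiffAt (e.open_target.mem_nhds he.zero_mem_target))

lemma IsLinearChart.hasFDerivAt_momentMap {p : M} {e : OpenPartialHomeomorph M E}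
    (he : IsLinearChart K p e) (hΦ : IsMomentMap Ω n Φ) (ξ : Fin n → ℝ) (v : E) :
    fderiv ℝ (fun w => Φ (e.symm w) ξ) 0 v =
      Ω.omega p (infinitesimalAction (E := E) n p ξ) v := by
  let T : E →L[ℝ] ℝ := mfderiv 𝓘(ℝ, E) 𝓘(ℝ, ℝ) (fun y : M => Φ y ξ) p
  have h0 : HasMFDerivAt 𝓘(ℝ, E) 𝓘(ℝ, ℝ) (fun y : M => Φ y ξ) p T :=
    ((hΦ.contMDiff ξ).mdifferentiable (by simp) p).hasMFDerivAt
  have h1 : HasMFDerivAt 𝓘(ℝ, E) 𝓘(ℝ, ℝ) (fun y : M => Φ y ξ) (e.symm 0) T := by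
    rwa [he.symm_zero]
  have h2 : HasMFDerivAt 𝓘(ℝ, E) 𝓘(ℝ, ℝ) (fun w => Φ (e.symm w) ξ) 0
      (T.comp (ContinuousLinearMap.id ℝ E)) := h1.comp (0 : E) he.hasMFDerivAt_symm
  have h3 : HasFDerivAt (fun w => Φ (e.symm w) ξ) (T.comp (ContinuousLinearMap.id ℝ E)) 0 :=
    h2.hasFDerivAt
  rw [h3.fderiv]
  exact hΦ.2.2 ξ p v

variable [FiniteDimensional ℝ E] [IsManifold 𝓘(ℝ, E) ∞ M]

/-- Away from the zeros of the vector field of `ξ`, the component `Φ^ξ` of the moment map has no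
critical points on a component of a fixed point set. -/
lemma isLocalPass_of_infinitesimalAction_ne_zero (hτ : IsHamiltonianAction Ω n)
    (hΦ : IsMomentMap Ω n Φ) [Finite K] {y₀ y : M} (hy : y ∈ fixedComponent M K y₀)
    {ξ : Fin n → ℝ} (h0 : (infinitesimalAction (E := E) n y ξ : E) ≠ 0) :
    IsLocalPass (fun z : fixedComponent M K y₀ => Φ z ξ) ⟨y, hy⟩ := by
  have hyK := fixedComponent_subset _ _ hy
  obtain ⟨e, he⟩ := exists_isLinearChart (E := E) hτ.smooth K hyK
  obtain ⟨ψ, hψ0, h1, h2, h3⟩ := he.exists_parametrization_subtype hy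
  rw [← hψ0]
  refine IsLocalPass.of_comp h1 h2 ?_
  have hs : HasStrictFDerivAt (fun w => Φ (e.symm w) ξ) (fderiv ℝ (fun w => Φ (e.symm w) ξ) 0)
      ((fixedTangent E K y).subtypeL 0) := by
    rw [map_zero]
    exact (he.contDiffAt_momentMap hΦ ξ).hasStrictFDerivAt (by simp)
  have hs' := hs.comp (0 : fixedTangent E K y) (fixedTangent E K y).subtypeL.hasStrictFDerivAt
  refine isLocalPass_of_hasStrictFDerivAt (hs'.congr_of_eventuallyEq (h₁ := ?_) (f₁ := _)) ?_
  · filter_upwards [h3] with v hv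
    simp only [Function.comp_apply, hv]
    rfl
  · obtain ⟨v, hv, hv0⟩ := exists_mem_fixedTangent_omega_ne_zero (Ω := Ω) hτ hyK
      (u := (infinitesimalAction (E := E) n y ξ : E))
      (fun k hk => endDeriv_smul_infinitesimalAction hτ.smooth (hyK k hk) ξ) h0
    intro hc
    have := congrArg (fun T : fixedTangent E K y →L[ℝ] ℝ => T ⟨v, hv⟩) hc
    exact hv0 ((he.hasFDerivAt_momentMap hΦ ξ v).symm.trans this)

end Dichotomy

section Critical

variable {E : Type*} [NormedAddCommGroup E] [NormedSpace ℝ E]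
  {M : Type*} [TopologicalSpace M] [ChartedSpace E M] {n : ℕ} [MulAction (Torus n) M]
  {Ω : SymplecticForm E M} {Φ : M → ((Fin n → ℝ) →L[ℝ] ℝ)} {K : Subgroup (Torus n)}

/-- The Hessian at the origin of a function in a linear chart agrees with the Hessian in the
preferred chart, because the change of charts has the identity as derivative and the function is
critical. -/
lemma IsLinearChart.hessian_momentMap [IsManifold 𝓘(ℝ, E) ∞ M] {p : M}
    {e : OpenPartialHomeomorph M E}
    (he : IsLinearChart K p e) (hA : ContMDiffSMul (torusModel n) 𝓘(ℝ, E) ∞ (Torus n) M)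
    (hΦ : IsMomentMap Ω n Φ) (hp : p ∈ MulAction.fixedPoints (Torus n) M) (ξ : Fin n → ℝ)
    {A : E →L[ℝ] E} (hAd : HasFDerivAt (chartField E p ξ) A (extChartAt 𝓘(ℝ, E) p p)) (u v : E) :
    fderiv ℝ (fderiv ℝ (fun w => Φ (e.symm w) ξ)) 0 u v = Ω.omega p (A u) v := by
  set ϕ := extChartAt 𝓘(ℝ, E) p with hϕ
  obtain ⟨hF, hF0, hF2⟩ := hessian_momentMap_chart hA hΦ hp ξ hAd
  rw [← hϕ] at hF hF0 hF2
  set F : E → ℝ := fun w => Φ (ϕ.symm w) ξ with hFd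
  set T : E → E := fun w => ϕ (e.symm w) with hT
  have hT0 : T 0 = ϕ p := by rw [hT]; simp only [he.symm_zero]
  have hsc : ContMDiffAt 𝓘(ℝ, E) 𝓘(ℝ, E) 2 e.symm 0 :=
    he.contMDiffOn_symm.contMDiffAt (e.open_target.mem_nhds he.zero_mem_target)
  have hTc : ContDiffAt ℝ 2 T 0 := by
    rw [← contMDiffAt_iff_contDiffAt]
    refine ContMDiffAt.comp (g := ϕ) (0 : E) ?_ hsc
    rw [he.symm_zero]
    exact contMDiffAt_extChartAt.of_le two_le_infty
  have hTd : HasFDerivAt T (ContinuousLinearMap.id ℝ E) 0 := by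
    have : HasFDerivWithinAt (E := E) (F := E) (writtenInExtChartAt 𝓘(ℝ, E) 𝓘(ℝ, E) 0 e.symm)
      (ContinuousLinearMap.id ℝ E) (range 𝓘(ℝ, E)) (extChartAt 𝓘(ℝ, E) (0 : E) 0) :=
      he.hasMFDerivAt_symm.2
    rw [modelWithCornersSelf_coe, range_id, hasFDerivWithinAt_univ, writtenInExtChartAt,
      he.symm_zero, extChartAt_model_space_eq_id] at this
    exact this
  have hFT : (fun w => Φ (e.symm w) ξ) =ᶠ[𝓝 0] fun w => F (T w) := by
    have : ∀ᶠ w in 𝓝 (0 : E), e.symm w ∈ ϕ.source := by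
      refine hsc.continuousAt.eventually_mem ?_
      rw [he.symm_zero]
      exact extChartAt_source_mem_nhds p
    filter_upwards [this] with w hw
    rw [hFd, hT]
    simp only
    rw [ϕ.left_inv hw]
  have hFe : ∀ᶠ w in 𝓝 (ϕ p), DifferentiableAt ℝ F w := by
    filter_upwards [(hF.of_le two_le_infty).eventually (by simp)] with w hw
      using hw.differentiableAt (by simp)
  have hFe' : ∀ᶠ w in 𝓝 (0 : E), DifferentiableAt ℝ F (T w) := by
    refine (hTc.continuousAt.tendsto).eventually ?_
    rwa [hT0]
  have hD : fderiv ℝ (fun w => Φ (e.symm w) ξ) =ᶠ[𝓝 0]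
      fun w => (fderiv ℝ F (T w)).comp (fderiv ℝ T w) := by
    refine hFT.fderiv.trans ?_
    filter_upwards [hFe', hTc.eventually (by simp)] with w h1 h2
    exact fderiv_comp w h1 (h2.differentiableAt (by simp))
  have hd1 : HasFDerivAt (fderiv ℝ F) (fderiv ℝ (fderiv ℝ F) (ϕ p)) (T 0) := by
    rw [hT0]
    exact ((hF.fderiv_right (m := 1) (by norm_cast)).differentiableAt (by simp)).hasFDerivAt
  have hd2 : HasFDerivAt (fderiv ℝ T) (fderiv ℝ (fderiv ℝ T) 0) 0 :=
    ((hTc.fderiv_right (m := 1) (by norm_num)).differentiableAt (by simp)).hasFDerivAt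
  have hd3 := (hd1.comp (0 : E) hTd).clm_comp hd2
  have hd4 := hd3.fderiv
  simp only [Function.comp_apply] at hd4
  rw [hD.fderiv_eq, hd4, hTd.fderiv]
  simp [hT0, hF0, hF2]

variable {d : ℕ} {α : Fin d → Fin n → ℤ}

/-- The pairing of an integral weight with an element of the Lie algebra. -/
def weightPairing {n : ℕ} (a : Fin n → ℤ) (ξ : Fin n → ℝ) : ℝ := ∑ j, a j * ξ j

lemma IsIsotropyWeights.exists_equiv {p : M} (h : IsIsotropyWeights Ω n p α) :
    ∃ φ : E ≃ₗ[ℝ] (Fin d → ℂ),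
      (∀ v w : E, Ω.omega p v w = ∑ i, (starRingEnd ℂ (φ v i) * φ w i).im) ∧
      ∀ (g : Torus n) (v : E) (i : Fin d),
        φ (endDeriv (fun y : M => g • y) p v) i = (character (α i) g : ℂ) * φ v i := h

/-- In weight coordinates the fixed tangent space is a coordinate subspace. -/
lemma mem_fixedTangent_iff {p : M} {φ : E ≃ₗ[ℝ] (Fin d → ℂ)}
    (hφ : ∀ (g : Torus n) (v : E) (i : Fin d),
        φ (endDeriv (fun y : M => g • y) p v) i = (character (α i) g : ℂ) * φ v i) {v : E} :
    v ∈ fixedTangent E K p ↔ ∀ i, (¬ ∀ k ∈ K, character (α i) k = 1) → φ v i = 0 := by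
  constructor
  · intro hv i hi
    push Not at hi
    obtain ⟨k, hk, hk1⟩ := hi
    have h1 := hφ k v i
    rw [hv k hk] at h1
    have h2 : ((character (α i) k : ℂ) - 1) * φ v i = 0 := by
      rw [sub_mul, ← h1]; ring
    rcases mul_eq_zero.1 h2 with h3 | h3
    · exact absurd (Circle.ext (by simpa using sub_eq_zero.1 h3)) hk1
    · exact h3
  · intro h k hk
    apply φ.injective
    ext i
    rw [hφ]
    by_cases hi : ∀ k ∈ K, character (α i) k = 1
    · simp [hi k hk]
    · simp [h i hi]

variable [FiniteDimensional ℝ E]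

lemma map_linearized_field {p : M} {φ : E ≃ₗ[ℝ] (Fin d → ℂ)}
    (hφ : ∀ (g : Torus n) (v : E) (i : Fin d),
        φ (endDeriv (fun y : M => g • y) p v) i = (character (α i) g : ℂ) * φ v i)
    {ξ : Fin n → ℝ} {u u' : E}
    (h : HasDerivAt (fun t : ℝ => endDeriv (E := E) (fun x : M => torusExp (t • ξ) • x) p u) u' 0)
    (i : Fin d) : φ u' i = Complex.I * weightPairing (α i) ξ * φ u i := by
  let L : E →L[ℝ] ℂ := LinearMap.toContinuousLinearMap
    ((LinearMap.proj i : (Fin d → ℂ) →ₗ[ℝ] ℂ).comp (φ : E →ₗ[ℝ] (Fin d → ℂ)))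
  have h1 : HasDerivAt (fun t : ℝ => L (endDeriv (E := E) (fun x : M => torusExp (t • ξ) • x) p u))
      (L u') 0 := L.hasFDerivAt.comp_hasDerivAt (0 : ℝ) h
  have h2 : (fun t : ℝ => L (endDeriv (E := E) (fun x : M => torusExp (t • ξ) • x) p u)) =
      fun t : ℝ => Complex.exp ((t * weightPairing (α i) ξ : ℝ) * Complex.I) * φ u i := by
    funext t
    refine (hφ _ u i).trans ?_
    rw [character_torusExp, Circle.coe_exp]
    congr 4
    rw [weightPairing, Finset.mul_sum]
    refine Finset.sum_congr rfl fun j _ => ?_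
    simp only [Pi.smul_apply, smul_eq_mul]
    ring
  rw [h2] at h1
  have h3 : HasDerivAt (fun t : ℝ => ((t * weightPairing (α i) ξ : ℝ) : ℂ) * Complex.I)
      (weightPairing (α i) ξ * Complex.I) 0 := by
    have := ((hasDerivAt_id (0:ℝ)).mul_const (weightPairing (α i) ξ)).ofReal_comp
    simpa using this.mul_const Complex.I
  have h4 := h3.cexp.mul_const (φ u i)
  have h5 := h1.unique h4
  have h6 : L u' = φ u' i := rfl
  rw [← h6, h5, zero_mul, Complex.ofReal_zero, zero_mul, Complex.exp_zero]
  ring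

lemma sum_dite_eq_sum_subtype {ι : Type*} [Fintype ι] (P : ι → Prop) [DecidablePred P]
    (f : {i // P i} → ℝ) : ∑ i, (if h : P i then f ⟨i, h⟩ else 0) = ∑ i, f i := by
  rw [← Fintype.sum_subtype_add_sum_subtype P]
  have h1 : ∀ i : {i // P i}, (if h : P (i : ι) then f ⟨i, h⟩ else 0) = f i := fun i => by
    rw [dif_pos i.2]
  have h2 : ∀ i : {i // ¬ P i}, (if h : P (i : ι) then f ⟨i, h⟩ else 0) = 0 := fun i => by
    rw [dif_neg i.2]
  rw [Finset.sum_congr rfl fun i _ => h1 i, Finset.sum_congr rfl fun i _ => h2 i]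
  simp

lemma one_lt_rank_complex_euclidean {ι : Type*} [Fintype ι] [Nonempty ι] :
    1 < Module.rank ℝ (EuclideanSpace ℂ ι) := by
  have h1 : Module.finrank ℝ (EuclideanSpace ℂ ι) = Module.finrank ℝ (ι → ℂ) :=
    (WithLp.linearEquiv 2 ℝ (ι → ℂ)).finrank_eq
  have h2 : Module.finrank ℝ (ι → ℂ) = Fintype.card ι * 2 := by
    rw [Module.finrank_pi_fintype]
    simp [Complex.finrank_real_complex]
  have h3 : 1 < Module.finrank ℝ (EuclideanSpace ℂ ι) := by
    rw [h1, h2]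
    have := Fintype.card_pos (α := ι)
    omega
  rw [← Module.finrank_eq_rank]
  exact_mod_cast h3

variable [IsManifold 𝓘(ℝ, E) ∞ M]

/-- At a fixed point of the torus, the restriction of `Φ^ξ` to a component of the fixed point set of
`K` has a nondegenerate critical point, whose negative directions are the weight spaces of the
weights which are trivial on `K` and positive on `ξ`. These spaces are complex, so that either the
point is a strict minimum or the negative directions do not separate. -/
lemma isLocalPass_and_isStrictMin_of_mem_fixedPoints
    (hA : ContMDiffSMul (torusModel n) 𝓘(ℝ, E) ∞ (Torus n) M) (hΦ : IsMomentMap Ω n Φ) [Finite K]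
    {y₀ p : M} (hpY : p ∈ fixedComponent M K y₀) (hp : p ∈ MulAction.fixedPoints (Torus n) M)
    (hα : IsIsotropyWeights Ω n p α) {ξ : Fin n → ℝ} (h0 : ∀ i, weightPairing (α i) ξ ≠ 0) :
    ((∃ i, (∀ k ∈ K, character (α i) k = 1) ∧ 0 < weightPairing (α i) ξ) →
      IsLocalPass (fun z : fixedComponent M K y₀ => Φ z ξ) ⟨p, hpY⟩) ∧
    ((¬ ∃ i, (∀ k ∈ K, character (α i) k = 1) ∧ 0 < weightPairing (α i) ξ) →
      IsStrictMin (fun z : fixedComponent M K y₀ => Φ z ξ) ⟨p, hpY⟩) := by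
  classical
  obtain ⟨φ, hφω, hφ⟩ := hα.exists_equiv
  obtain ⟨e, he⟩ := exists_isLinearChart (E := E) hA K (fixedComponent_subset _ _ hpY)
  obtain ⟨A, hAd, hAu⟩ := exists_linearized_field (E := E) hA hp ξ
  set a : Fin d → ℝ := fun i => weightPairing (α i) ξ with ha
  let P : Fin d → Prop := fun i => (∀ k ∈ K, character (α i) k = 1) ∧ 0 < a i
  let Q : Fin d → Prop := fun i => (∀ k ∈ K, character (α i) k = 1) ∧ a i < 0
  -- with this scaling the Hessian becomes twice the difference of the squared norms
  let s : Fin d → ℝ := fun i => √(2 / |a i|)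
  have hs0 : ∀ i, s i ≠ 0 := fun i => by
    have : 0 < |a i| := abs_pos.2 (h0 i)
    exact (Real.sqrt_pos.2 (by positivity)).ne'
  have hs2 : ∀ i, |a i| * s i ^ 2 = 2 := fun i => by
    have : 0 < |a i| := abs_pos.2 (h0 i)
    rw [Real.sq_sqrt (by positivity)]
    field_simp
  let N₁ := EuclideanSpace ℂ {i // P i}
  let N₂ := EuclideanSpace ℂ {i // Q i}
  let c : N₁ × N₂ →ₗ[ℝ] (Fin d → ℂ) := LinearMap.pi fun i =>
    if h : P i then s i • ((LinearMap.proj ⟨i, h⟩ : ({i // P i} → ℂ) →ₗ[ℝ] ℂ) ∘ₗ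
      (WithLp.linearEquiv 2 ℝ ({i // P i} → ℂ)).toLinearMap ∘ₗ LinearMap.fst ℝ N₁ N₂)
    else if h : Q i then s i • ((LinearMap.proj ⟨i, h⟩ : ({i // Q i} → ℂ) →ₗ[ℝ] ℂ) ∘ₗ
      (WithLp.linearEquiv 2 ℝ ({i // Q i} → ℂ)).toLinearMap ∘ₗ LinearMap.snd ℝ N₁ N₂)
    else 0
  have hPQ : ∀ i, P i → ¬ Q i := fun i h h' => lt_asymm h.2 h'.2
  have hcP : ∀ z (i) (h : P i), c z i = s i * z.1 ⟨i, h⟩ := fun z i h => by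
    simp [c, dif_pos h]
  have hcQ : ∀ z (i) (h : Q i), c z i = s i * z.2 ⟨i, h⟩ := fun z i h => by
    simp [c, dif_pos h, dif_neg fun h' => hPQ i h' h]
  have hc0 : ∀ z i, ¬ P i → ¬ Q i → c z i = 0 := fun z i h h' => by
    simp [c, dif_neg h, dif_neg h']
  let ι : N₁ × N₂ →L[ℝ] E :=
    LinearMap.toContinuousLinearMap ((φ.symm : (Fin d → ℂ) →ₗ[ℝ] E) ∘ₗ c)
  have hφι : ∀ z, φ (ι z) = c z := fun z => φ.apply_symm_apply (c z)
  let r : E →L[ℝ] N₁ × N₂ := LinearMap.toContinuousLinearMap (LinearMap.prod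
    ((WithLp.linearEquiv 2 ℝ ({i // P i} → ℂ)).symm.toLinearMap ∘ₗ LinearMap.pi fun i =>
      (s i)⁻¹ • ((LinearMap.proj (i : Fin d) : (Fin d → ℂ) →ₗ[ℝ] ℂ) ∘ₗ φ.toLinearMap))
    ((WithLp.linearEquiv 2 ℝ ({i // Q i} → ℂ)).symm.toLinearMap ∘ₗ LinearMap.pi fun i =>
      (s i)⁻¹ • ((LinearMap.proj (i : Fin d) : (Fin d → ℂ) →ₗ[ℝ] ℂ) ∘ₗ φ.toLinearMap)))
  have hr1 : ∀ w i, (r w).1 i = (s i : ℂ)⁻¹ * φ w i := fun w i => by simp [r]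
  have hr2 : ∀ w i, (r w).2 i = (s i : ℂ)⁻¹ * φ w i := fun w i => by simp [r]
  have hι : ∀ z, ι z ∈ fixedTangent E K p := fun z => by
    rw [mem_fixedTangent_iff hφ]
    intro i hi
    rw [hφι]
    exact hc0 z i (fun h => hi h.1) fun h => hi h.1
  have hr : ∀ w ∈ fixedTangent E K p, ι (r w) = w := fun w hw => by
    rw [mem_fixedTangent_iff hφ] at hw
    apply φ.injective
    rw [hφι]
    ext i
    have hsi : (s i : ℂ) ≠ 0 := by exact_mod_cast hs0 i
    by_cases hi : ∀ k ∈ K, character (α i) k = 1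
    · rcases lt_or_gt_of_ne (h0 i) with h | h
      · rw [hcQ _ i ⟨hi, h⟩, hr2]; field_simp
      · rw [hcP _ i ⟨hi, h⟩, hr1]; field_simp
    · rw [hw i hi]
      exact hc0 _ i (fun h => hi h.1) fun h => hi h.1
  obtain ⟨ψ, hψ0, h1, h2, h3⟩ := he.exists_parametrization hpY ι r hι hr
  set F : E → ℝ := fun w => Φ (e.symm w) ξ with hF
  have hFc : ContDiffAt ℝ 2 F 0 := he.contDiffAt_momentMap hΦ ξ
  let D : N₁ × N₂ → N₁ × N₂ →L[ℝ] ℝ := fun z => (fderiv ℝ F (ι z)).comp ι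
  let pull : (E →L[ℝ] ℝ) →L[ℝ] (N₁ × N₂ →L[ℝ] ℝ) :=
    (ContinuousLinearMap.compL ℝ (N₁ × N₂) E ℝ).flip ι
  let H : N₁ × N₂ →L[ℝ] N₁ × N₂ →L[ℝ] ℝ := pull.comp ((fderiv ℝ (fderiv ℝ F) 0).comp ι)
  have hHz : ∀ z v, H z v = Ω.omega p (A (ι z)) (ι v) := fun z v =>
    he.hessian_momentMap hA hΦ hp ξ hAd (ι z) (ι v)
  have hDh : ∀ᶠ z in 𝓝 0,
      HasFDerivAt ((fun z : fixedComponent M K y₀ => Φ z ξ) ∘ ψ) (D z) z := by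
    have hι0 : Tendsto ι (𝓝 0) (𝓝 0) := by
      have := ι.continuous.tendsto 0
      rwa [map_zero] at this
    filter_upwards [h3.eventually_nhds, hι0.eventually (hFc.eventually (by simp))] with z hz hz'
    refine HasFDerivAt.congr_of_eventuallyEq
      ((hz'.differentiableAt (by simp)).hasFDerivAt.comp z ι.hasFDerivAt) ?_
    filter_upwards [hz] with w hw
    simp only [Function.comp_apply, hw]
    rfl
  have hD0 : D 0 = 0 := by
    refine ContinuousLinearMap.ext fun v => ?_
    have h4 := he.hasFDerivAt_momentMap hΦ ξ (ι v)
    have h5 := congrArg (fun T : (Fin n → ℝ) →L[ℝ] E => T ξ)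
      (infinitesimalAction_eq_zero_of_mem_fixedPoints (E := E) hp)
    have h6 : Ω.omega p (infinitesimalAction (E := E) n p ξ) (ι v) = 0 := by
      refine (congrArg (fun u : E => Ω.omega p u (ι v)) h5).trans ?_
      show Ω.bilin p (0 : E) (ι v) = 0
      simp
    show fderiv ℝ F (ι 0) (ι v) = 0
    rw [map_zero, h4, h6]
  have hH : HasFDerivAt D H 0 := by
    have h4 : HasFDerivAt (fderiv ℝ F) (fderiv ℝ (fderiv ℝ F) 0) (ι 0) := by
      rw [map_zero]
      exact ((hFc.fderiv_right (m := 1) (by norm_num)).differentiableAt (by simp)).hasFDerivAt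
    exact pull.hasFDerivAt.comp (0 : N₁ × N₂) (h4.comp (0 : N₁ × N₂) ι.hasFDerivAt)
  have hsymm : ∀ z v, H z v = H v z := by
    intro z v
    have : IsSymmSndFDerivAt ℝ F 0 := hFc.isSymmSndFDerivAt (by
      rw [minSmoothness_of_isRCLikeNormedField])
    exact this (ι z) (ι v)
  have hQ : ∀ z, H z z = 2 * (‖z.2‖ ^ 2 - ‖z.1‖ ^ 2) := by
    intro z
    rw [hHz, hφω, EuclideanSpace.norm_sq_eq, EuclideanSpace.norm_sq_eq, mul_sub, Finset.mul_sum,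
      Finset.mul_sum, ← sum_dite_eq_sum_subtype Q, ← sum_dite_eq_sum_subtype P,
      ← Finset.sum_sub_distrib]
    refine Finset.sum_congr rfl fun i _ => ?_
    rw [map_linearized_field hφ (hAu (ι z)) i, hφι]
    have hterm : (starRingEnd ℂ (Complex.I * (a i : ℂ) * c z i) * c z i).im
        = -(a i * ‖c z i‖ ^ 2) := by
      rw [Complex.sq_norm, Complex.normSq_apply]
      simp
      ring
    refine hterm.trans ?_
    by_cases hP : P i
    · rw [dif_neg (hPQ i hP), dif_pos hP, hcP z i hP, norm_mul, mul_pow]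
      have := hs2 i
      rw [abs_of_pos hP.2] at this
      simp only [Complex.norm_real, Real.norm_eq_abs, sq_abs]
      rw [← this]; ring
    · by_cases hQ : Q i
      · rw [dif_pos hQ, dif_neg hP, hcQ z i hQ, norm_mul, mul_pow]
        have := hs2 i
        rw [abs_of_neg hQ.2] at this
        simp only [Complex.norm_real, Real.norm_eq_abs, sq_abs]
        rw [← this]; ring
      · rw [dif_neg hQ, dif_neg hP, hc0 z i hP hQ]
        simp
  constructor
  · rintro ⟨i, hi⟩
    rw [← hψ0]
    refine IsLocalPass.of_comp h1 h2 ?_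
    have : Nonempty {i // P i} := ⟨⟨i, hi⟩⟩
    exact isLocalPass_of_saddle hDh hD0 hH hsymm hQ one_lt_rank_complex_euclidean
  · intro hn
    rw [← hψ0]
    refine IsStrictMin.of_comp h2 ?_
    have : IsEmpty {i // P i} := ⟨fun i => hn ⟨i, i.2⟩⟩
    exact isStrictMin_of_hessian hDh hD0 hH hsymm hQ

end Critical

/-! ### Extrema of the moment map on fixed components -/

lemma mod2Reduction_ne_zero {n : ℕ} {a : Fin n → ℤ} (h : mod2Reduction a ≠ 0) : a ≠ 0 := by
  rintro rfl
  exact h (by ext j; simp [mod2Reduction])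

lemma finite_of_le_realTorus {n : ℕ} {K : Subgroup (Torus n)} (hK : K ≤ realTorus n) : Finite K :=
  ((finite_realTorus n).subset hK).to_subtype

section Extrema

variable {E : Type*} [NormedAddCommGroup E] [NormedSpace ℝ E] [FiniteDimensional ℝ E]
  {M : Type*} [TopologicalSpace M] [ChartedSpace E M] [IsManifold 𝓘(ℝ, E) ∞ M]
  {n d : ℕ} [MulAction (Torus n) M]
  {Ω : SymplecticForm E M} {Φ : M → ((Fin n → ℝ) →L[ℝ] ℝ)} {K : Subgroup (Torus n)}

omit [FiniteDimensional ℝ E] [IsManifold 𝓘(ℝ, E) ∞ M] in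
lemma IsMomentMap.continuous (hΦ : IsMomentMap Ω n Φ) (ξ : Fin n → ℝ) :
    Continuous fun z : M => Φ z ξ := (hΦ.contMDiff ξ).continuous

/-- The fixed points of the torus have nonzero weights. -/
def HasNonzeroWeights (Ω : SymplecticForm E M) (n d : ℕ) [MulAction (Torus n) M] : Prop :=
  ∀ p ∈ MulAction.fixedPoints (Torus n) M,
    ∃ α : Fin d → Fin n → ℤ, IsIsotropyWeights Ω n p α ∧ ∀ i, α i ≠ 0

variable [T2Space M]

/-- On a fixed component, every point is either a strict minimum or a pass of `Φ^ξ`. -/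
lemma isStrictMin_or_isLocalPass (hτ : IsHamiltonianAction Ω n) (hΦ : IsMomentMap Ω n Φ)
    (hW : HasNonzeroWeights Ω n d) [Finite K] {y₀ : M} {ξ : Fin n → ℝ} (hξ : IsGenerator ξ)
    (z : fixedComponent M K y₀) :
    ((z : M) ∈ MulAction.fixedPoints (Torus n) M ∧
      IsStrictMin (fun z : fixedComponent M K y₀ => Φ z ξ) z) ∨
      IsLocalPass (fun z : fixedComponent M K y₀ => Φ z ξ) z := by
  by_cases hz : (z : M) ∈ MulAction.fixedPoints (Torus n) M
  · obtain ⟨α, hα, hα0⟩ := hW z hz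
    have h := isLocalPass_and_isStrictMin_of_mem_fixedPoints hτ.smooth hΦ z.2 hz hα
      (ξ := ξ) fun i => hξ.sum_ne_zero (hα0 i)
    by_cases hi : ∃ i, (∀ k ∈ K, character (α i) k = 1) ∧ 0 < weightPairing (α i) ξ
    · exact Or.inr (h.1 hi)
    · exact Or.inl ⟨hz, h.2 hi⟩
  · refine Or.inr (isLocalPass_of_infinitesimalAction_ne_zero hτ hΦ z.2 fun h0 => hz ?_)
    exact mem_fixedPoints_of_infinitesimalAction_eq_zero hτ.smooth hξ h0

variable [CompactSpace M]

/-- On a fixed component, `Φ^ξ` has at most one strict minimum. -/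
lemma eq_of_isStrictMin (hτ : IsHamiltonianAction Ω n) (hΦ : IsMomentMap Ω n Φ)
    (hfin : (MulAction.fixedPoints (Torus n) M).Finite)
    (hW : HasNonzeroWeights Ω n d) [Finite K] {y₀ : M} {ξ : Fin n → ℝ} (hξ : IsGenerator ξ)
    {p q : fixedComponent M K y₀}
    (hp : IsStrictMin (fun z : fixedComponent M K y₀ => Φ z ξ) p)
    (hq : IsStrictMin (fun z : fixedComponent M K y₀ => Φ z ξ) q) : p = q := by
  have hcl := isClosed_fixedComponent hτ.smooth K y₀
  have h1 : CompactSpace (fixedComponent M K y₀) := isCompact_iff_compactSpace.1 hcl.isCompact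
  have h2 : ConnectedSpace (fixedComponent M K y₀) := by
    rw [← isConnected_iff_connectedSpace]
    exact ⟨⟨p, p.2⟩, isPreconnected_connectedComponentIn⟩
  have h3 := locallyConnectedSpace_fixedComponent hτ.smooth K y₀
  refine IsStrictMin.unique ((hΦ.continuous ξ).comp continuous_subtype_val) ?_ ?_ hp hq
  · refine (hfin.preimage (f := ((↑) : fixedComponent M K y₀ → M))
      Subtype.val_injective.injOn).subset fun z hz => ?_
    rcases isStrictMin_or_isLocalPass hτ hΦ hW hξ z with h | h
    · exact h.1
    · exact absurd hz h.isPass.not_isStrictMin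
  · intro z
    exact (isStrictMin_or_isLocalPass hτ hΦ hW hξ z).imp And.right IsLocalPass.isPass

/-- The minimum of `Φ^ξ` on a fixed component is attained at a fixed point of the torus. -/
lemma exists_fixedPoint_isMin (hτ : IsHamiltonianAction Ω n) (hΦ : IsMomentMap Ω n Φ)
    (hW : HasNonzeroWeights Ω n d) [Finite K] {y₀ : M} (hy₀ : y₀ ∈ fixedSet M K)
    {ξ : Fin n → ℝ} (hξ : IsGenerator ξ) :
    ∃ q ∈ fixedComponent M K y₀, q ∈ MulAction.fixedPoints (Torus n) M ∧
      ∀ z ∈ fixedComponent M K y₀, Φ q ξ ≤ Φ z ξ := by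
  obtain ⟨q, hq, hmin⟩ := (isClosed_fixedComponent hτ.smooth K y₀).isCompact.exists_isMinOn
    ⟨y₀, mem_fixedComponent_self hy₀⟩ (hΦ.continuous ξ).continuousOn
  have hmin' : ∀ z ∈ fixedComponent M K y₀, Φ q ξ ≤ Φ z ξ := fun z hz => hmin hz
  refine ⟨q, hq, ?_, hmin'⟩
  rcases isStrictMin_or_isLocalPass hτ hΦ hW hξ ⟨q, hq⟩ with h | h
  · exact h.1
  · obtain ⟨z, hz⟩ := h.isPass.exists_lt
    exact absurd hz (not_lt.2 (hmin' z z.2))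

end Extrema

/-! ### The involution fixes the fixed points of the torus -/

section Involution

variable {E : Type*} [NormedAddCommGroup E] [NormedSpace ℝ E]
  {M : Type*} [TopologicalSpace M] [ChartedSpace E M]
  {n d : ℕ} [MulAction (Torus n) M]
  {Ω : SymplecticForm E M} {Φ : M → ((Fin n → ℝ) →L[ℝ] ℝ)} {K : Subgroup (Torus n)} {σ : M → M}

lemma involution_mem_fixedSet (hσ : IsCompatibleAntisymplecticInvolution Ω n σ) {p : M}
    (hp : p ∈ fixedSet M K) : σ p ∈ fixedSet M K := by
  intro g hg
  have := hσ.compatible g⁻¹ p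
  rwa [hp g⁻¹ (inv_mem hg), inv_inv, eq_comm] at this

/-- If the involution maps some point of a fixed component to the component, then it preserves the
component. -/
lemma involution_mem_fixedComponent (hσ : IsCompatibleAntisymplecticInvolution Ω n σ) {y₀ q z : M}
    (hq : q ∈ fixedComponent M K y₀) (hσq : σ q ∈ fixedComponent M K y₀)
    (hz : z ∈ fixedComponent M K y₀) : σ z ∈ fixedComponent M K y₀ := by
  have h1 : σ '' fixedComponent M K y₀ ⊆ connectedComponentIn (fixedSet M K) (σ q) := by
    refine IsPreconnected.subset_connectedComponentIn
      (isPreconnected_connectedComponentIn.image _ hσ.smooth.continuous.continuousOn)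
      (mem_image_of_mem _ hq) ?_
    rintro _ ⟨w, hw, rfl⟩
    exact involution_mem_fixedSet hσ (fixedComponent_subset _ _ hw)
  have h2 := h1 (mem_image_of_mem _ hz)
  rwa [fixedComponent, connectedComponentIn_eq hσq]

/-- The moment map is invariant under the involution: the difference of a component and its
pullback is locally constant, and the involution changes its sign. -/
lemma IsMomentMap.apply_involution [IsManifold 𝓘(ℝ, E) ∞ M] [ConnectedSpace M]
    (hA : ContMDiffSMul (torusModel n) 𝓘(ℝ, E) ∞ (Torus n) M)
    (hΦ : IsMomentMap Ω n Φ) (hσ : IsCompatibleAntisymplecticInvolution Ω n σ) (ξ : Fin n → ℝ)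
    (x : M) : Φ (σ x) ξ = Φ x ξ := by
  have hf := (hΦ.contMDiff ξ).mdifferentiable (by simp)
  have hs := hσ.smooth.mdifferentiable (by simp)
  have hd : ∀ x, HasMFDerivAt 𝓘(ℝ, E) 𝓘(ℝ, ℝ) (fun y : M => Φ (σ y) ξ - Φ y ξ) x
      (0 : E →L[ℝ] ℝ) := by
    intro x
    let S : E →L[ℝ] E := mfderiv 𝓘(ℝ, E) 𝓘(ℝ, E) σ x
    let T : E →L[ℝ] ℝ := mfderiv 𝓘(ℝ, E) 𝓘(ℝ, ℝ) (fun y : M => Φ y ξ) (σ x)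
    let T' : E →L[ℝ] ℝ := mfderiv 𝓘(ℝ, E) 𝓘(ℝ, ℝ) (fun y : M => Φ y ξ) x
    have h1 : HasMFDerivAt 𝓘(ℝ, E) 𝓘(ℝ, ℝ) (fun y : M => Φ (σ y) ξ) x (T.comp S) :=
      (hf (σ x)).hasMFDerivAt.comp x (hs x).hasMFDerivAt
    have h2 : HasMFDerivAt 𝓘(ℝ, E) 𝓘(ℝ, ℝ) (fun y : M => Φ (σ y) ξ - Φ y ξ) x (T.comp S - T') :=
      h1.sub (hf x).hasMFDerivAt
    refine h2.congr_mfderiv ?_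
    have h3 : T.comp S - T' = 0 := by
      refine ContinuousLinearMap.ext fun v => ?_
      have e1 : T (S v) = Ω.omega (σ x) (infinitesimalAction (E := E) n (σ x) ξ) (S v) :=
        hΦ.2.2 ξ (σ x) (S v)
      have e2 : T' v = Ω.omega x (infinitesimalAction (E := E) n x ξ) v := hΦ.2.2 ξ x v
      have e3 : S (infinitesimalAction (E := E) n x ξ) = -infinitesimalAction (E := E) n (σ x) ξ :=
        mfderiv_involution_infinitesimalAction hA hσ.smooth hσ.compatible x ξ
      have e4 : Ω.omega (σ x) (S (infinitesimalAction (E := E) n x ξ)) (S v)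
          = -Ω.omega x (infinitesimalAction (E := E) n x ξ) v := hσ.antisymplectic x _ v
      have e5 : Ω.omega (σ x) (-infinitesimalAction (E := E) n (σ x) ξ) (S v)
          = -Ω.omega (σ x) (infinitesimalAction (E := E) n (σ x) ξ) (S v) := by
        have := LinearMap.congr_fun
          ((Ω.bilin (σ x)).map_neg (infinitesimalAction (E := E) n (σ x) ξ)) (S v)
        exact this
      have e6 := (congrArg (fun u : E => Ω.omega (σ x) u (S v)) e3).symm.trans e4
      have e7 := neg_injective (e5.symm.trans e6)
      show T (S v) - T' v = 0
      rw [e1, e2, e7, sub_self]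
    exact h3
  have hlc := isLocallyConstant_of_mfderiv_eq_zero (fun x => (hd x).mdifferentiableAt)
    (fun x => (hd x).mfderiv)
  have h1 := hlc.apply_eq_of_preconnectedSpace x (σ x)
  simp only [hσ.involutive x] at h1
  linarith

variable [FiniteDimensional ℝ E] [IsManifold 𝓘(ℝ, E) ∞ M] [T2Space M] [CompactSpace M]
  [ConnectedSpace M]

/-- A strict minimum of `Φ^ξ` on an invariant fixed component is fixed by the involution. -/
lemma involution_eq_of_isStrictMin (hτ : IsHamiltonianAction Ω n) (hΦ : IsMomentMap Ω n Φ)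
    (hσ : IsCompatibleAntisymplecticInvolution Ω n σ)
    (hfin : (MulAction.fixedPoints (Torus n) M).Finite)
    (hW : HasNonzeroWeights Ω n d) [Finite K] {y₀ : M} {ξ : Fin n → ℝ} (hξ : IsGenerator ξ)
    {q : M} (hq : q ∈ fixedComponent M K y₀) (hσq : σ q ∈ fixedComponent M K y₀)
    {p : fixedComponent M K y₀}
    (hp : IsStrictMin (fun z : fixedComponent M K y₀ => Φ z ξ) p) : σ p = p := by
  have hmaps : ∀ z ∈ fixedComponent M K y₀, σ z ∈ fixedComponent M K y₀ := fun z hz =>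
    involution_mem_fixedComponent hσ hq hσq hz
  let s : fixedComponent M K y₀ ≃ₜ fixedComponent M K y₀ :=
    { toFun := fun z => ⟨σ z, hmaps z z.2⟩
      invFun := fun z => ⟨σ z, hmaps z z.2⟩
      left_inv := fun z => Subtype.ext (hσ.involutive z)
      right_inv := fun z => Subtype.ext (hσ.involutive z)
      continuous_toFun := (hσ.smooth.continuous.comp continuous_subtype_val).subtype_mk _
      continuous_invFun := (hσ.smooth.continuous.comp continuous_subtype_val).subtype_mk _ }
  have hfs : (fun z : fixedComponent M K y₀ => Φ z ξ) ∘ s =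
      fun z : fixedComponent M K y₀ => Φ z ξ := by
    funext z
    exact hΦ.apply_involution hτ.smooth hσ ξ z
  have hsp : IsStrictMin (fun z : fixedComponent M K y₀ => Φ z ξ) (s p) := by
    refine IsStrictMin.of_comp (s.map_nhds_eq p) ?_
    rwa [hfs]
  have := eq_of_isStrictMin hτ hΦ hfin hW hξ hsp hp
  exact congrArg Subtype.val this

/-- If the reduced weights at the fixed points of the torus are nonzero and pairwise distinct, then
the involution fixes these points. Otherwise consider the lowest fixed point `p` which is moved. If
it has no positive weight, it is the unique minimum. If it has a positive weight, then on the
component through `p` of the fixed point set of the kernel of the reduced weight, `p` is the unique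
maximum, and the minimum is a lower fixed point of the torus, so the component is invariant. -/
theorem involution_eq_of_mem_fixedPoints (hτ : IsHamiltonianAction Ω n)
    (hσ : IsCompatibleAntisymplecticInvolution Ω n σ)
    (hfin : (MulAction.fixedPoints (Torus n) M).Finite)
    (hW : ∀ p ∈ MulAction.fixedPoints (Torus n) M, ∃ α : Fin d → Fin n → ℤ,
      IsIsotropyWeights Ω n p α ∧ Function.Injective (fun i => mod2Reduction (α i)) ∧
      ∀ i, mod2Reduction (α i) ≠ 0) {p : M} (hp : p ∈ MulAction.fixedPoints (Torus n) M) :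
    σ p = p := by
  obtain ⟨Φ, hΦ⟩ : ∃ Φ, IsMomentMap Ω n Φ := hτ.exists_momentMap
  obtain ⟨ξ, hξ⟩ := exists_isGenerator n
  have hW' : HasNonzeroWeights Ω n d := fun p hp => by
    obtain ⟨α, h1, -, h2⟩ := hW p hp
    exact ⟨α, h1, fun i => mod2Reduction_ne_zero (h2 i)⟩
  by_contra hne
  obtain ⟨p, ⟨hp, hne⟩, hmin⟩ := (hfin.sep fun p => σ p ≠ p).exists_minimalFor (fun p => Φ p ξ) _
    ⟨p, hp, hne⟩
  have hmin' : ∀ q ∈ MulAction.fixedPoints (Torus n) M, Φ q ξ < Φ p ξ → σ q = q := by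
    intro q hq hlt
    by_contra hq'
    exact absurd (hmin ⟨hq, hq'⟩ hlt.le) (not_le.2 hlt)
  obtain ⟨α, hα, hinj, hα0⟩ := hW p hp
  have hα' : ∀ i, α i ≠ 0 := fun i => mod2Reduction_ne_zero (hα0 i)
  by_cases hpos : ∃ i, 0 < weightPairing (α i) ξ
  · obtain ⟨i, hi⟩ := hpos
    have : Finite (realKernel (α i)) := finite_of_le_realTorus fun g hg => hg.1
    have hpK : p ∈ fixedSet M (realKernel (α i)) := mem_fixedSet_of_mem_fixedPoints hp
    have hpY := mem_fixedComponent_self hpK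
    obtain ⟨q, hqY, hq, hqmin⟩ := exists_fixedPoint_isMin hτ hΦ hW' hpK hξ
    have h1 := (isLocalPass_and_isStrictMin_of_mem_fixedPoints hτ.smooth hΦ hpY hp hα
      (ξ := ξ) fun i => hξ.sum_ne_zero (hα' i)).1 ⟨i, fun k hk => hk.2, hi⟩
    obtain ⟨z, hz⟩ := h1.isPass.exists_lt
    have hσq : σ q = q := hmin' q hq ((hqmin z z.2).trans_lt hz)
    have h2 := (isLocalPass_and_isStrictMin_of_mem_fixedPoints hτ.smooth hΦ hpY hp hα
      (ξ := -ξ) fun i => hξ.neg.sum_ne_zero (hα' i)).2 (by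
        rintro ⟨j, hj, hj'⟩
        have hji : j = i := hinj (mod2Reduction_eq_of_trivial
          (fun g hg h hh hgK hhK => mul_mem_realKernel hg hh hgK hhK) hj (fun k hk => hk.2)
          (hα0 j) (hα0 i))
        rw [hji] at hj'
        have : weightPairing (α i) (-ξ) = -weightPairing (α i) ξ := by
          simp [weightPairing]
        linarith)
    exact hne (involution_eq_of_isStrictMin hτ hΦ hσ hfin hW' hξ.neg hqY (by rwa [hσq]) h2)
  · have hbot : Finite (⊥ : Subgroup (Torus n)) := inferInstance
    have huniv : fixedSet M (⊥ : Subgroup (Torus n)) = univ := by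
      refine eq_univ_of_forall fun x k hk => ?_
      rw [Subgroup.mem_bot.1 hk, one_smul]
    have hY : ∀ x, x ∈ fixedComponent M (⊥ : Subgroup (Torus n)) p := by
      intro x
      rw [fixedComponent, huniv, connectedComponentIn_univ,
        PreconnectedSpace.connectedComponent_eq_univ]
      trivial
    have h2 := (isLocalPass_and_isStrictMin_of_mem_fixedPoints hτ.smooth hΦ (hY p) hp hα
      (ξ := ξ) fun i => hξ.sum_ne_zero (hα' i)).2 fun ⟨i, hi⟩ => hpos ⟨i, hi.2⟩
    exact hne (involution_eq_of_isStrictMin hτ hΦ hσ hfin hW' hξ (hY p) (hY _) h2)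

end Involution

/-! ### The residual action on the real locus -/

section OrbitTangent

variable {E : Type*} [NormedAddCommGroup E] [NormedSpace ℝ E]
  {M : Type*} [TopologicalSpace M] [ChartedSpace E M]
  {n d : ℕ} [MulAction (Torus n) M]
  {Ω : SymplecticForm E M} {Φ : M → ((Fin n → ℝ) →L[ℝ] ℝ)} {K : Subgroup (Torus n)} {σ : M → M}

/-- The orbits of the torus are isotropic, because the moment map is invariant. -/
lemma omega_infinitesimalAction (hA : ContMDiffSMul (torusModel n) 𝓘(ℝ, E) ∞ (Torus n) M)
    (hΦ : IsMomentMap Ω n Φ) (x : M) (ξ η : Fin n → ℝ) :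
    Ω.omega x (infinitesimalAction (E := E) n x ξ) (infinitesimalAction (E := E) n x η) = 0 := by
  let T : E →L[ℝ] ℝ := mfderiv 𝓘(ℝ, E) 𝓘(ℝ, ℝ) (fun y : M => Φ y ξ) x
  have h1 : HasMFDerivAt 𝓘(ℝ, E) 𝓘(ℝ, ℝ) (fun y : M => Φ y ξ)
      (torusExp (0 : Fin n → ℝ) • x) T := by
    rw [torusExp_zero, one_smul]
    exact ((hΦ.contMDiff ξ).mdifferentiable (by simp) x).hasMFDerivAt
  have h2 : HasMFDerivAt 𝓘(ℝ, Fin n → ℝ) 𝓘(ℝ, ℝ) (fun η : Fin n → ℝ => Φ (torusExp η • x) ξ) 0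
      (T.comp (infinitesimalAction (E := E) n x)) :=
    h1.comp (0 : Fin n → ℝ) (hasMFDerivAt_orbitMap hA x)
  have h3 : (fun η : Fin n → ℝ => Φ (torusExp η • x) ξ) = fun _ => Φ x ξ := by
    funext η
    rw [hΦ.2.1]
  rw [h3] at h2
  have h4 : T.comp (infinitesimalAction (E := E) n x) = (0 : (Fin n → ℝ) →L[ℝ] ℝ) :=
    hasMFDerivAt_unique h2 (hasMFDerivAt_const _ _)
  have h5 := congrArg (fun S : (Fin n → ℝ) →L[ℝ] ℝ => S η) h4
  exact (hΦ.2.2 ξ x (infinitesimalAction (E := E) n x η)).symm.trans h5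

/-- If at most one weight is trivial on `K`, then the fixed tangent space has dimension at most
two. -/
lemma finrank_fixedTangent_le_two {α : Fin d → Fin n → ℤ} {p : M}
    (hα : IsIsotropyWeights Ω n p α)
    (hK : ∀ i j, (∀ k ∈ K, character (α i) k = 1) → (∀ k ∈ K, character (α j) k = 1) → i = j) :
    Module.finrank ℝ (fixedTangent E K p) ≤ 2 := by
  obtain ⟨φ, -, hφ⟩ := hα.exists_equiv
  by_cases h : ∃ i, ∀ k ∈ K, character (α i) k = 1
  · obtain ⟨i, hi⟩ := h
    let L : fixedTangent E K p →ₗ[ℝ] ℂ :=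
      (LinearMap.proj i : (Fin d → ℂ) →ₗ[ℝ] ℂ) ∘ₗ φ.toLinearMap ∘ₗ (fixedTangent E K p).subtype
    have hL : Function.Injective L := by
      rw [← LinearMap.ker_eq_bot, LinearMap.ker_eq_bot']
      intro v hv
      apply Subtype.ext
      apply φ.injective
      ext j
      rw [ZeroMemClass.coe_zero, map_zero]
      by_cases hj : ∀ k ∈ K, character (α j) k = 1
      · rw [← hK i j hi hj]
        exact hv
      · exact (mem_fixedTangent_iff hφ).1 v.2 j hj
    have := LinearMap.finrank_le_finrank_of_injective hL
    rwa [Complex.finrank_real_complex] at this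
  · have : fixedTangent E K p = ⊥ := by
      rw [Submodule.eq_bot_iff]
      intro v hv
      apply φ.injective
      ext j
      rw [map_zero]
      exact (mem_fixedTangent_iff hφ).1 hv j fun hj => h ⟨j, hj⟩
    rw [this]
    simp

lemma infinitesimalAction_mem_fixedTangent
    (hA : ContMDiffSMul (torusModel n) 𝓘(ℝ, E) ∞ (Torus n) M) {x : M} (hx : x ∈ fixedSet M K)
    (ξ : Fin n → ℝ) : (infinitesimalAction (E := E) n x ξ : E) ∈ fixedTangent E K x :=
  fun k hk => endDeriv_smul_infinitesimalAction hA (hx k hk) ξ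

variable [FiniteDimensional ℝ E]

/-- An isotropic orbit in a symplectic surface has dimension at most one. -/
lemma orbitDim_le_one (hτ : IsHamiltonianAction Ω n) (hΦ : IsMomentMap Ω n Φ) [Finite K] {x : M}
    (hx : x ∈ fixedSet M K) (h2 : Module.finrank ℝ (fixedTangent E K x) ≤ 2) :
    orbitDim E n x ≤ 1 := by
  by_contra hlt
  let L : (Fin n → ℝ) →L[ℝ] E := infinitesimalAction (E := E) n x
  have hlt' : 2 ≤ Module.finrank ℝ L.range := not_le.1 hlt
  have hle : L.range ≤ fixedTangent E K x := by
    rintro _ ⟨ξ, rfl⟩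
    exact infinitesimalAction_mem_fixedTangent hτ.smooth hx ξ
  have heq : L.range = fixedTangent E K x :=
    Submodule.eq_of_le_of_finrank_le hle (h2.trans hlt')
  have hne : L.range ≠ ⊥ := by
    intro h
    rw [h, finrank_bot] at hlt'
    omega
  obtain ⟨u, hu, hu0⟩ := Submodule.exists_mem_ne_zero_of_ne_bot hne
  obtain ⟨v, hv, hv0⟩ := exists_mem_fixedTangent_omega_ne_zero hτ hx (hle hu) hu0
  rw [← heq] at hv
  obtain ⟨ξ, rfl⟩ := hu
  obtain ⟨η, rfl⟩ := hv
  exact hv0 (omega_infinitesimalAction hτ.smooth hΦ x ξ η)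

end OrbitTangent

section RealOrbits

/-- In a closed subgroup of the line, the classes of order two form at most one nonzero class. -/
lemma add_mem_of_two_mul_mem {Λ : AddSubgroup ℝ} (hΛ : IsClosed (Λ : Set ℝ)) {s t : ℝ}
    (hs : 2 * s ∈ Λ) (ht : 2 * t ∈ Λ) (hs' : s ∉ Λ) (ht' : t ∉ Λ) : s + t ∈ Λ := by
  rcases Λ.dense_or_cyclic with h | ⟨a, ha⟩
  · have : (Λ : Set ℝ) = univ := by rw [← hΛ.closure_eq, h.closure_eq]
    have h1 : s ∈ (Λ : Set ℝ) := by rw [this]; trivial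
    exact absurd h1 hs'
  · have key : ∀ r, r ∈ Λ ↔ ∃ m : ℤ, m * a = r := by
      intro r
      rw [ha, AddSubgroup.mem_closure_singleton]
      simp
    have odd : ∀ r, 2 * r ∈ Λ → r ∉ Λ → ∃ m : ℤ, (m + 1 / 2) * a = r := by
      intro r hr hr'
      obtain ⟨m, hm⟩ := (key _).1 hr
      rcases Int.even_or_odd' m with ⟨l, rfl | rfl⟩
      · refine absurd ((key r).2 ⟨l, ?_⟩) hr'
        push_cast at hm
        linarith
      · refine ⟨l, ?_⟩
        push_cast at hm
        linarith
    obtain ⟨l, hl⟩ := odd s hs hs'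
    obtain ⟨m, hm⟩ := odd t ht ht'
    refine (key _).2 ⟨l + m + 1, ?_⟩
    rw [← hl, ← hm]
    push_cast
    ring

variable {M : Type*} {n : ℕ} [MulAction (Torus n) M]

lemma encard_orbit_le_two_iff {x : M} :
    (MulAction.orbit (realTorus n) x).encard ≤ 2 ↔
      ∀ g ∈ realTorus n, ∀ h ∈ realTorus n, g • x ≠ x → h • x ≠ x → (g * h) • x = x := by
  have hgg : ∀ g ∈ realTorus n, ∀ y : M, g • g • y = y := fun g hg y => by
    rw [smul_smul, ← sq, mem_realTorus_iff.1 hg, one_smul]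
  constructor
  · intro hle g hg h hh hgx hhx
    by_contra hne
    have hne' : g • x ≠ h • x := by
      intro he
      rw [mul_smul, ← he, hgg g hg] at hne
      exact hne rfl
    have hsub : {x, g • x, h • x} ⊆ MulAction.orbit (realTorus n) x := by
      rintro y (rfl | rfl | rfl)
      · exact MulAction.mem_orbit_self _
      · exact ⟨⟨g, hg⟩, rfl⟩
      · exact ⟨⟨h, hh⟩, rfl⟩
    have h3 : ({x, g • x, h • x} : Set M).encard = 3 := by
      rw [encard_insert_of_notMem, encard_pair hne']
      · norm_num
      · simp [hgx.symm, hhx.symm]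
    have := (encard_le_encard hsub).trans hle
    rw [h3] at this
    exact absurd this (by norm_num)
  · intro H
    by_cases hall : ∀ g ∈ realTorus n, g • x = x
    · have hsub : MulAction.orbit (realTorus n) x ⊆ {x} := by
        rintro _ ⟨g, rfl⟩
        exact hall g g.2
      refine (encard_le_encard hsub).trans ?_
      rw [encard_singleton]
      norm_num
    · push Not at hall
      obtain ⟨g, hg, hgx⟩ := hall
      have hsub : MulAction.orbit (realTorus n) x ⊆ {x, g • x} := by
        rintro _ ⟨h, rfl⟩
        by_cases hhx : (h : Torus n) • x = x
        · exact Or.inl hhx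
        · refine Or.inr ?_
          have h1 := H g hg h h.2 hgx hhx
          rw [mul_smul] at h1
          have h2 := congrArg (fun y => g • y) h1
          simp only [hgg g hg] at h2
          exact h2
      refine (encard_le_encard hsub).trans ?_
      rw [encard_pair (Ne.symm hgx)]

end RealOrbits

section Skeleta

variable {E : Type*} [NormedAddCommGroup E] [NormedSpace ℝ E]
  {M : Type*} [TopologicalSpace M] [ChartedSpace E M] [IsManifold 𝓘(ℝ, E) ∞ M] [T2Space M]
  {n d : ℕ} [MulAction (Torus n) M]
  {Ω : SymplecticForm E M} {σ : M → M}

/-- Points with at most one-dimensional torus orbit have `G_ℝ`-orbit of at most two points: modulo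
the Lie algebra of the stabilizer, the stabilizer is a closed subgroup of a line. -/
lemma encard_orbit_le_two_of_orbitDim (hA : ContMDiffSMul (torusModel n) 𝓘(ℝ, E) ∞ (Torus n) M)
    {x : M} (h1 : orbitDim E n x ≤ 1) : (MulAction.orbit (realTorus n) x).encard ≤ 2 := by
  rw [encard_orbit_le_two_iff]
  have := continuousSMul_torus hA
  let L : (Fin n → ℝ) →L[ℝ] E := infinitesimalAction (E := E) n x
  have hker : ∀ ξ, L ξ = 0 → torusExp ξ • x = x := fun ξ hξ => by
    simpa using smul_eq_of_infinitesimalAction_eq_zero (E := E) hA hξ 1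
  have hfr : Module.finrank ℝ L.range ≤ 1 := h1
  obtain ⟨⟨u, e, he⟩, hu⟩ := finrank_le_one_iff.1 hfr
  have hc : ∀ ξ, ∃ c : ℝ, L (ξ - c • e) = 0 := by
    intro ξ
    obtain ⟨c, hc⟩ := hu ⟨L ξ, ξ, rfl⟩
    refine ⟨c, ?_⟩
    have h2 : c • u = L ξ := congrArg Subtype.val hc
    have h3 : L e = u := he
    rw [map_sub, map_smul, h3, h2, sub_self]
  let Λ : AddSubgroup ℝ :=
    { carrier := {t | torusExp (t • e) • x = x}
      add_mem' := by
        intro s t hs ht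
        have hs' : torusExp (s • e) • x = x := hs
        have ht' : torusExp (t • e) • x = x := ht
        show torusExp ((s + t) • e) • x = x
        rw [add_smul, torusExp_add, mul_smul, ht', hs']
      zero_mem' := by
        show torusExp ((0 : ℝ) • e) • x = x
        rw [zero_smul, torusExp_zero, one_smul]
      neg_mem' := by
        intro t ht
        have ht' : torusExp (t • e) • x = x := ht
        show torusExp ((-t) • e) • x = x
        rw [neg_smul, torusExp_neg, inv_smul_eq_iff, ht'] }
  have hΛ : IsClosed (Λ : Set ℝ) := by
    have hc : Continuous fun t : ℝ => torusExp (t • e) • x :=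
      (continuous_torusExp.comp (continuous_id.smul continuous_const)).smul continuous_const
    exact isClosed_eq hc continuous_const
  have hmem : ∀ ξ c, L (ξ - c • e) = 0 → (torusExp ξ • x = x ↔ c ∈ Λ) := by
    intro ξ c h0
    have h2 : torusExp ξ • x = torusExp (c • e) • x := by
      conv_lhs => rw [← add_sub_cancel (c • e) ξ, torusExp_add, mul_smul, hker _ h0]
    rw [h2]
    rfl
  intro g hg h hh hgx hhx
  obtain ⟨ξ, rfl⟩ := torusExp_surjective g
  obtain ⟨η, rfl⟩ := torusExp_surjective h
  obtain ⟨s, hs⟩ := hc ξ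
  obtain ⟨t, ht⟩ := hc η
  have htwo : ∀ (ξ : Fin n → ℝ) (c : ℝ), torusExp ξ ∈ realTorus n → L (ξ - c • e) = 0 →
      2 * c ∈ Λ := by
    intro ξ c hξ h0
    rw [← hmem (ξ + ξ)]
    · rw [torusExp_add, ← sq, mem_realTorus_iff.1 hξ, one_smul]
    · have : ξ + ξ - (2 * c) • e = (ξ - c • e) + (ξ - c • e) := by module
      rw [this, map_add, h0, add_zero]
  rw [← torusExp_add, hmem (ξ + η) (s + t)]
  · refine add_mem_of_two_mul_mem hΛ (htwo ξ s hg hs) (htwo η t hh ht) ?_ ?_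
    · rwa [← hmem ξ s hs]
    · rwa [← hmem η t ht]
  · have : ξ + η - (s + t) • e = (ξ - s • e) + (η - t • e) := by module
    rw [this, map_add, hs, ht, add_zero]

lemma realLocus_inter_oneSkeleton_subset
    (hA : ContMDiffSMul (torusModel n) 𝓘(ℝ, E) ∞ (Torus n) M) (σ : M → M) :
    realLocus σ ∩ oneSkeleton E M n ⊆ realOneSkeleton n σ :=
  fun _ hx => ⟨hx.1, encard_orbit_le_two_of_orbitDim hA hx.2⟩

variable [FiniteDimensional ℝ E] [CompactSpace M]

/-- If the reduced weights are nonzero, the points fixed by `G_ℝ` are fixed by the torus: the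
component of the fixed point set of `G_ℝ` contains a fixed point of the torus, where the fixed
tangent space vanishes. -/
lemma mem_fixedPoints_of_mem_fixedSet_realTorus (hτ : IsHamiltonianAction Ω n)
    (hW : ∀ p ∈ MulAction.fixedPoints (Torus n) M, ∃ α : Fin d → Fin n → ℤ,
      IsIsotropyWeights Ω n p α ∧ ∀ i, mod2Reduction (α i) ≠ 0) {x : M}
    (hx : x ∈ fixedSet M (realTorus n)) : x ∈ MulAction.fixedPoints (Torus n) M := by
  obtain ⟨Φ, hΦ⟩ : ∃ Φ, IsMomentMap Ω n Φ := hτ.exists_momentMap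
  obtain ⟨ξ, hξ⟩ := exists_isGenerator n
  have hW' : HasNonzeroWeights Ω n d := fun p hp => by
    obtain ⟨α, h1, h2⟩ := hW p hp
    exact ⟨α, h1, fun i => mod2Reduction_ne_zero (h2 i)⟩
  have : Finite (realTorus n) := finite_of_le_realTorus le_rfl
  obtain ⟨q, hqY, hq, -⟩ := exists_fixedPoint_isMin hτ hΦ hW' hx hξ
  obtain ⟨α, hα, hα0⟩ := hW q hq
  obtain ⟨φ, -, hφ⟩ := hα.exists_equiv
  have hbot : fixedTangent E (realTorus n) q = ⊥ := by
    rw [Submodule.eq_bot_iff]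
    intro v hv
    apply φ.injective
    ext j
    rw [map_zero]
    exact (mem_fixedTangent_iff hφ).1 hv j fun hj => hα0 j (mod2Reduction_eq_zero_iff.2 hj)
  have h0 := finrank_fixedTangent_eq (E := E) hτ.smooth (realTorus n) (mem_fixedComponent_self hx)
    hqY
  rw [hbot, finrank_bot, Submodule.finrank_eq_zero] at h0
  refine mem_fixedPoints_of_infinitesimalAction_eq_zero hτ.smooth hξ ?_
  have h1 := infinitesimalAction_mem_fixedTangent hτ.smooth hx ξ
  rw [h0] at h1
  exact (Submodule.mem_bot ℝ).1 h1

/-- If the reduced weights are nonzero and pairwise distinct, a point whose `G_ℝ`-orbit has at most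
two points lies in the one-skeleton: near a fixed point of the torus the fixed point set of its
stabilizer in `G_ℝ` is at most a surface. -/
lemma orbitDim_le_one_of_encard_orbit (hτ : IsHamiltonianAction Ω n)
    (hW : ∀ p ∈ MulAction.fixedPoints (Torus n) M, ∃ α : Fin d → Fin n → ℤ,
      IsIsotropyWeights Ω n p α ∧ Function.Injective (fun i => mod2Reduction (α i)) ∧
      ∀ i, mod2Reduction (α i) ≠ 0) {x : M}
    (hx : (MulAction.orbit (realTorus n) x).encard ≤ 2) : orbitDim E n x ≤ 1 := by
  obtain ⟨Φ, hΦ⟩ : ∃ Φ, IsMomentMap Ω n Φ := hτ.exists_momentMap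
  obtain ⟨ξ, hξ⟩ := exists_isGenerator n
  have hW' : HasNonzeroWeights Ω n d := fun p hp => by
    obtain ⟨α, h1, -, h2⟩ := hW p hp
    exact ⟨α, h1, fun i => mod2Reduction_ne_zero (h2 i)⟩
  rw [encard_orbit_le_two_iff] at hx
  let K : Subgroup (Torus n) := realTorus n ⊓ MulAction.stabilizer (Torus n) x
  have : Finite K := finite_of_le_realTorus inf_le_left
  have hxK : x ∈ fixedSet M K := fun k hk => hk.2
  have hK : ∀ g ∈ realTorus n, ∀ h ∈ realTorus n, g ∉ K → h ∉ K → g * h ∈ K := by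
    intro g hg h hh hgK hhK
    exact ⟨mul_mem hg hh, hx g hg h hh (fun h0 => hgK ⟨hg, h0⟩) fun h0 => hhK ⟨hh, h0⟩⟩
  obtain ⟨q, hqY, hq, -⟩ := exists_fixedPoint_isMin hτ hΦ hW' hxK hξ
  obtain ⟨α, hα, hinj, hα0⟩ := hW q hq
  refine orbitDim_le_one hτ hΦ hxK ?_
  rw [finrank_fixedTangent_eq (E := E) hτ.smooth K (mem_fixedComponent_self hxK) hqY]
  exact finrank_fixedTangent_le_two hα fun i j hi hj =>
    hinj (mod2Reduction_eq_of_trivial hK hi hj (hα0 i) (hα0 j))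

end Skeleta

/-! ### Symplectic representations of the torus -/

section Character

variable {n : ℕ}

lemma torusExp_eq_prod (ξ : Fin n → ℝ) : torusExp ξ = ∏ j, torusExp (Pi.single j (ξ j)) := by
  funext i
  rw [Finset.prod_apply, Finset.prod_eq_single i]
  · simp [torusExp]
  · intro j _ hj
    simp [torusExp, Pi.single_eq_of_ne hj.symm]
  · simp

/-- A multiplicative function on the line which is differentiable at zero is an exponential. -/
lemma eq_cexp_of_differentiableAt {h : ℝ → ℂ} (h0 : h 0 = 1) (hadd : ∀ s t, h (s + t) = h s * h t)
    (hd : DifferentiableAt ℝ h 0) : ∃ c : ℂ, ∀ t : ℝ, h t = Complex.exp (t * c) := by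
  set c := deriv h 0 with hc
  have hder : ∀ t, HasDerivAt h (h t * c) t := by
    intro t
    have h1 : HasDerivAt (fun s : ℝ => h (s - t)) c t := by
      have h2 : HasDerivAt h c (t - t) := by rw [sub_self]; exact hd.hasDerivAt
      exact h2.comp_sub_const t t
    refine (h1.const_mul (h t)).congr_of_eventuallyEq (Eventually.of_forall fun s => ?_)
    show h s = h t * h (s - t)
    rw [← hadd, add_sub_cancel]
  have hexp : ∀ t : ℝ, HasDerivAt (fun s : ℝ => Complex.exp (s * -c)) (Complex.exp (t * -c) * -c) t := by
    intro t
    have : HasDerivAt (fun s : ℝ => (s : ℂ) * -c) (-c) t := by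
      simpa using ((hasDerivAt_id t).ofReal_comp).mul_const (-c)
    exact this.cexp
  have hk : ∀ t : ℝ, h t * Complex.exp (t * -c) = 1 := by
    intro t
    have hz : ∀ t : ℝ, HasDerivAt (fun s : ℝ => h s * Complex.exp (s * -c)) 0 t := by
      intro t
      convert! (hder t).mul (hexp t) using 1
      ring
    have := is_const_of_deriv_eq_zero (fun t => (hz t).differentiableAt) (fun t => (hz t).deriv) t 0
    simpa [h0] using this
  refine ⟨c, fun t => ?_⟩
  rw [← mul_one (Complex.exp _), ← hk t, mul_left_comm, ← Complex.exp_add]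
  simp

/-- The differentiable characters of the torus are the `character a`. -/
lemma exists_character_eq (χ : Torus n → ℂ) (h1 : χ 1 = 1) (hmul : ∀ g h, χ (g * h) = χ g * χ h)
    (hd : ∀ j, DifferentiableAt ℝ (fun t : ℝ => χ (torusExp (Pi.single j t))) 0) :
    ∃ a : Fin n → ℤ, ∀ g, χ g = character a g := by
  have hj : ∀ j, ∃ m : ℤ, ∀ t : ℝ, χ (torusExp (Pi.single j t)) =
      Complex.exp (t * (m * Complex.I)) := by
    intro j
    obtain ⟨c, hc⟩ := eq_cexp_of_differentiableAt (h := fun t : ℝ => χ (torusExp (Pi.single j t)))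
      (by simp [h1]) (fun s t => by rw [Pi.single_add, torusExp_add, hmul]) (hd j)
    have h2 : torusExp (Pi.single j (2 * Real.pi) : Fin n → ℝ) = 1 := by
      funext i
      by_cases hij : i = j
      · subst hij
        simp [torusExp]
      · simp [torusExp, Pi.single_eq_of_ne hij]
    have h3 := hc (2 * Real.pi)
    simp only [h2, h1] at h3
    obtain ⟨m, hm⟩ := Complex.exp_eq_one_iff.1 h3.symm
    refine ⟨m, fun t => ?_⟩
    have h4 : c = m * Complex.I := by
      have hpi : (2 * Real.pi : ℂ) ≠ 0 := by
        exact_mod_cast (by positivity : (2 * Real.pi : ℝ) ≠ 0)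
      apply mul_left_cancel₀ hpi
      push_cast at hm
      rw [hm]
      ring
    rw [hc t, h4]
  choose a ha using hj
  refine ⟨a, fun g => ?_⟩
  obtain ⟨ξ, rfl⟩ := torusExp_surjective g
  let χ' : Torus n →* ℂ := { toFun := χ, map_one' := h1, map_mul' := hmul }
  have h2 : χ (torusExp ξ) = ∏ j, χ (torusExp (Pi.single j (ξ j))) := by
    conv_lhs => rw [torusExp_eq_prod ξ]
    exact map_prod χ' _ _
  rw [h2, character_torusExp, Circle.coe_exp, Complex.ofReal_sum, Finset.sum_mul, Complex.exp_sum]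
  refine Finset.prod_congr rfl fun j _ => ?_
  rw [ha j]
  congr 1
  push_cast
  ring

end Character

section Plane

variable {V : Type*} [AddCommGroup V] [Module ℝ V] [FiniteDimensional ℝ V]

open Module.End in
/-- An orthogonal symplectic representation of a commutative group contains an invariant symplectic
plane, on which the group acts by rotations. With `S` the skew operator relating the two forms, take
a joint eigenvector of the commuting symmetric operators `S²`, `ρ(g) + ρ(g)⁻¹` and
`S(ρ(g) - ρ(g)⁻¹)`. -/
lemma exists_invariant_plane {G : Type*} [CommGroup G] [Nontrivial V] (β B : LinearMap.BilinForm ℝ V)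
    (ρ : G →* Module.End ℝ V) (hβ : ∀ v, β v v = 0) (hnd : ∀ v, (∀ w, β v w = 0) → v = 0)
    (hβρ : ∀ g v w, β (ρ g v) (ρ g w) = β v w) (hB : ∀ v w, B v w = B w v)
    (hpos : ∀ v, v ≠ 0 → 0 < B v v) (hBρ : ∀ g v w, B (ρ g v) (ρ g w) = B v w) :
    ∃ u u' : V, β u u' = 1 ∧
      ∀ g, ∃ c e : ℝ, ρ g u = c • u + e • u' ∧ ρ g u' = c • u' - e • u := by
  have hBnd : B.Nondegenerate := by
    refine ⟨fun v hv => ?_, fun v hv => ?_⟩ <;>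
    · by_contra h
      exact (hpos v h).ne' (hv v)
  let S : Module.End ℝ V := LinearMap.BilinForm.symmCompOfNondegenerate β B hBnd
  have hS : ∀ v w, B (S v) w = β v w := fun v w =>
    LinearMap.BilinForm.symmCompOfNondegenerate_left_apply β hBnd w v
  have hext : ∀ v v', (∀ w, B v w = B v' w) → v = v' := by
    intro v v' h
    by_contra hne
    have := hpos (v - v') (sub_ne_zero.2 hne)
    rw [LinearMap.map_sub₂, h, sub_self] at this
    exact lt_irrefl _ this
  have hswap : ∀ v w, β v w = -β w v := by
    intro v w
    have h := hβ (v + w)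
    simp only [map_add, LinearMap.add_apply, hβ] at h
    linarith
  have hskew : ∀ v w, B (S v) w = -B v (S w) := by
    intro v w
    rw [hS, hswap, ← hS, hB]
  have hinv : ∀ g v, ρ g (ρ g⁻¹ v) = v := fun g v => by
    rw [← Module.End.mul_apply, ← map_mul, mul_inv_cancel, map_one, Module.End.one_apply]
  have hSρ : ∀ g, Commute S (ρ g) := by
    intro g
    refine LinearMap.ext fun v => hext _ _ fun w => ?_
    rw [Module.End.mul_apply, Module.End.mul_apply, hS]
    conv_lhs => rw [← hinv g w, hβρ, ← hS]
    conv_rhs => rw [← hinv g w, hBρ]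
  have hρρ : ∀ g h, Commute (ρ g) (ρ h) := fun g h => by
    rw [commute_iff_eq, ← map_mul, ← map_mul, mul_comm]
  have hadj : ∀ g v w, B (ρ g v) w = B v (ρ g⁻¹ w) := fun g v w => by
    conv_lhs => rw [← hinv g w, hBρ]
  let core : InnerProductSpace.Core ℝ V :=
    { inner := fun v w => B v w
      conj_inner_symm := fun v w => hB w v
      re_inner_nonneg := fun v => by
        by_cases h : v = 0
        · simp [h]
        · exact (hpos v h).le
      add_left := fun u v w => by simp
      smul_left := fun u v r => by simp
      definite := fun v hv => by
        by_contra h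
        exact (hpos v h).ne' hv }
  let _ : NormedAddCommGroup V := core.toNormedAddCommGroup
  let _ : InnerProductSpace ℝ V := InnerProductSpace.ofCore core.toCore
  let T : Option G ⊕ G → Module.End ℝ V := fun i => match i with
    | Sum.inl none => S * S
    | Sum.inl (some g) => ρ g + ρ g⁻¹
    | Sum.inr g => S * (ρ g - ρ g⁻¹)
  have key : ∀ X : Module.End ℝ V, Commute X S → (∀ h, Commute X (ρ h)) → ∀ i, Commute X (T i) := by
    rintro X h1 h2 ((_ | g) | g)
    · exact h1.mul_right h1
    · exact (h2 _).add_right (h2 _)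
    · exact h1.mul_right ((h2 _).sub_right (h2 _))
  have hcomm : Pairwise (Function.onFun Commute T) := fun i j _ =>
    key _ (key S (Commute.refl S) hSρ i).symm
      (fun h => (key (ρ h) (hSρ h).symm (hρρ h) i).symm) j
  have hsymm : ∀ i, (T i).IsSymmetric := by
    rintro ((_ | g) | g) v w
    · show B (S (S v)) w = B v (S (S w))
      rw [hskew, hskew, neg_neg]
    · show B (ρ g v + ρ g⁻¹ v) w = B v (ρ g w + ρ g⁻¹ w)
      rw [map_add, map_add, LinearMap.add_apply, hadj, hadj, inv_inv, add_comm]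
    · show B (S (ρ g v - ρ g⁻¹ v)) w = B v (S (ρ g w - ρ g⁻¹ w))
      have hc : ∀ g, ρ g (S w) = S (ρ g w) := fun g => (LinearMap.congr_fun (hSρ g).eq w).symm
      rw [hskew, map_sub, LinearMap.sub_apply, hadj, hadj, inv_inv, map_sub, map_sub, hc, hc]
      ring
  have htop := LinearMap.IsSymmetric.iSup_iInf_eq_top_of_commute hsymm hcomm
  obtain ⟨χ, hχ⟩ : ∃ χ : Option G ⊕ G → ℝ, (⨅ i, eigenspace (T i) (χ i)) ≠ ⊥ := by
    by_contra hn
    push Not at hn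
    simp only [hn, iSup_bot] at htop
    exact bot_ne_top htop
  obtain ⟨u, hu, hu0⟩ := Submodule.exists_mem_ne_zero_of_ne_bot hχ
  have hTu : ∀ i, T i u = χ i • u := fun i =>
    mem_eigenspace_iff.1 ((Submodule.mem_iInf _).1 hu i)
  set l : ℝ := χ (Sum.inl none) with hl
  have hSS : S (S u) = l • u := hTu (Sum.inl none)
  have hSu : S u ≠ 0 := by
    intro h
    refine hu0 (hnd u fun w => ?_)
    rw [← hS, h, map_zero, LinearMap.zero_apply]
  have hBu := hpos u hu0
  have hBS := hpos _ hSu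
  have hlB : B (S u) (S u) = -l * B u u := by
    have := hskew (S u) u
    rw [hSS, map_smul, LinearMap.smul_apply, smul_eq_mul] at this
    linarith
  have hlneg : l < 0 := by
    rw [hlB] at hBS
    by_contra hge
    nlinarith
  set s : ℝ := √(-l) with hs
  have hs0 : 0 < s := Real.sqrt_pos.2 (by linarith)
  have hs2 : s ^ 2 = -l := Real.sq_sqrt (by linarith)
  set r : ℝ := √(s / B (S u) (S u)) with hr
  have hr2 : r ^ 2 = s / B (S u) (S u) := Real.sq_sqrt (by positivity)
  have hr0 : r ≠ 0 := (Real.sqrt_pos.2 (by positivity)).ne'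
  refine ⟨r • u, (r / s) • S u, ?_, fun g => ?_⟩
  · rw [map_smul, map_smul, LinearMap.smul_apply, ← hS, smul_eq_mul, smul_eq_mul]
    have : r * (r / s) * B (S u) (S u) = r ^ 2 * B (S u) (S u) / s := by ring
    rw [mul_comm (r / s), mul_assoc, mul_comm _ (r / s), ← mul_assoc, this, hr2]
    field_simp
  · have h1 : ρ g u + ρ g⁻¹ u = χ (Sum.inl (some g)) • u := hTu (Sum.inl (some g))
    have h2 : S (ρ g u - ρ g⁻¹ u) = χ (Sum.inr g) • u := hTu (Sum.inr g)
    set a := χ (Sum.inl (some g))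
    set b := χ (Sum.inr g)
    have hSS' : ∀ v, S (S (ρ g v)) = ρ g (S (S v)) := fun v => by
      have hc : ∀ w, S (ρ g w) = ρ g (S w) := fun w => LinearMap.congr_fun (hSρ g).eq w
      rw [hc, hc]
    have hSS'' : ∀ v, S (S (ρ g⁻¹ v)) = ρ g⁻¹ (S (S v)) := fun v => by
      have hc : ∀ w, S (ρ g⁻¹ w) = ρ g⁻¹ (S w) := fun w => LinearMap.congr_fun (hSρ g⁻¹).eq w
      rw [hc, hc]
    have h3 : l • (ρ g u - ρ g⁻¹ u) = b • S u := by
      have := congrArg S h2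
      rw [map_sub, map_sub, hSS', hSS'', hSS, map_smul, map_smul, map_smul] at this
      rw [smul_sub]
      exact this
    have h4 : ρ g u - ρ g⁻¹ u = (b / l) • S u := by
      rw [div_eq_inv_mul, mul_smul, ← h3, smul_smul, inv_mul_cancel₀ hlneg.ne, one_smul]
    have h5 : ρ g u = (a / 2) • u + (b / (2 * l)) • S u := by
      have : (2 : ℝ) • ρ g u = a • u + (b / l) • S u := by
        rw [← h1, ← h4]
        module
      calc ρ g u = (1 / 2 : ℝ) • (2 : ℝ) • ρ g u := by module
        _ = _ := by
          rw [this, smul_add, smul_smul, smul_smul]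
          congr 2 <;> ring
    have h6 : ρ g (S u) = (a / 2) • S u + (b / 2) • u := by
      have hc : ρ g (S u) = S (ρ g u) := (LinearMap.congr_fun (hSρ g).eq u).symm
      rw [hc, h5, map_add, map_smul, map_smul, hSS, smul_smul]
      congr 2
      have := hlneg.ne
      field_simp
    refine ⟨a / 2, b * s / (2 * l), ?_, ?_⟩
    · rw [map_smul, h5, smul_add, smul_smul, smul_smul, smul_smul, smul_smul]
      congr 2
      · ring
      · field_simp
    · rw [map_smul, h6, smul_add, smul_smul, smul_smul, smul_smul, smul_smul, sub_eq_add_neg,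
        ← neg_smul]
      congr 2
      · ring
      · have : l = -s ^ 2 := by linarith
        rw [this]
        field_simp

end Plane

section Decomposition

variable {n : ℕ}

/-- An orthogonal symplectic representation of the torus, with differentiable matrix coefficients,
decomposes into weight lines. -/
theorem exists_weight_decomposition (N : ℕ) : ∀ (V : Type*) [AddCommGroup V] [Module ℝ V]
    [FiniteDimensional ℝ V] (β B : LinearMap.BilinForm ℝ V) (ρ : Torus n →* Module.End ℝ V),
    Module.finrank ℝ V = N → (∀ v, β v v = 0) → (∀ v, (∀ w, β v w = 0) → v = 0) →
    (∀ g v w, β (ρ g v) (ρ g w) = β v w) → (∀ v w, B v w = B w v) → (∀ v, v ≠ 0 → 0 < B v v) →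
    (∀ g v w, B (ρ g v) (ρ g w) = B v w) →
    (∀ (f : V →ₗ[ℝ] ℝ) (v : V) (j : Fin n),
      DifferentiableAt ℝ (fun t : ℝ => f (ρ (torusExp (Pi.single j t)) v)) 0) →
    ∃ (m : ℕ) (α : Fin m → Fin n → ℤ) (φ : V →ₗ[ℝ] (Fin m → ℂ)), N = 2 * m ∧
      (∀ v w, β v w = ∑ i, (starRingEnd ℂ (φ v i) * φ w i).im) ∧
      ∀ g v i, φ (ρ g v) i = (character (α i) g : ℂ) * φ v i := by
  induction N using Nat.strong_induction_on with
  | _ N ih =>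
    intro V _ _ _ β B ρ hN hβ hnd hβρ hB hpos hBρ hd
    by_cases hV : Nontrivial V
    swap
    · have hsub := not_nontrivial_iff_subsingleton.1 hV
      refine ⟨0, Fin.elim0, 0, ?_, fun v w => ?_, fun g v i => i.elim0⟩
      · rw [← hN, Module.finrank_zero_of_subsingleton]
      · rw [Subsingleton.elim v 0]
        simp
    obtain ⟨u, u', huu, hρu⟩ := exists_invariant_plane β B ρ hβ hnd hβρ hB hpos hBρ
    have hswap : ∀ v w, β v w = -β w v := by
      intro v w
      have h := hβ (v + w)
      simp only [map_add, LinearMap.add_apply, hβ] at h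
      linarith
    have huu' : β u' u = -1 := by rw [hswap, huu]
    -- the symplectic complement of the plane
    let L : V →ₗ[ℝ] ℝ × ℝ := (β u).prod (β u')
    let W : Submodule ℝ V := LinearMap.ker L
    have hW : ∀ v, v ∈ W ↔ β u v = 0 ∧ β u' v = 0 := fun v => by
      simp [W, L, LinearMap.mem_ker]
    have hWfr : Module.finrank ℝ W + 2 = N := by
      have hsurj : LinearMap.range L = ⊤ := by
        rw [LinearMap.range_eq_top]
        rintro ⟨s, t⟩
        refine ⟨s • u' - t • u, ?_⟩
        simp [L, hβ, huu, huu']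
      have h1 := L.finrank_range_add_finrank_ker
      rw [hsurj, finrank_top, Module.finrank_prod, Module.finrank_self] at h1
      show Module.finrank ℝ (LinearMap.ker L) + 2 = N
      omega
    have hinv : ∀ g v, ρ g (ρ g⁻¹ v) = v := fun g v => by
      rw [← Module.End.mul_apply, ← map_mul, mul_inv_cancel, map_one, Module.End.one_apply]
    have hadj : ∀ g v w, β v (ρ g w) = β (ρ g⁻¹ v) w := fun g v w => by
      conv_lhs => rw [← hinv g v, hβρ]
    have hWρ : ∀ g, ∀ v ∈ W, ρ g v ∈ W := by
      intro g v hv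
      obtain ⟨h1, h2⟩ := (hW v).1 hv
      obtain ⟨c, e, h3, h4⟩ := hρu g⁻¹
      rw [hW, hadj, hadj, h3, h4]
      simp [h1, h2]
    let π₀ : V →ₗ[ℝ] V := LinearMap.id - (β.flip u').smulRight u - (β u).smulRight u'
    have hπ₀ : ∀ v, π₀ v = v - β v u' • u - β u v • u' := fun v => by simp [π₀]
    have hπ₀W : ∀ v, π₀ v ∈ W := fun v => by
      rw [hW, hπ₀]
      simp [hβ, huu, huu', hswap v u']
    let π : V →ₗ[ℝ] W := π₀.codRestrict W hπ₀W
    have hπ : ∀ v, (π v : V) = v - β v u' • u - β u v • u' := hπ₀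
    have hdec : ∀ v, v = π v + (β v u' • u + β u v • u') := fun v => by
      rw [hπ]
      abel
    let ρ' : Torus n →* Module.End ℝ W :=
      { toFun := fun g => (ρ g).restrict (hWρ g)
        map_one' := by ext v; simp
        map_mul' := fun g h => by ext v; simp }
    have hρ' : ∀ g (v : W), (ρ' g v : V) = ρ g v := fun g v => rfl
    have hWperp : ∀ v ∈ W, β v u = 0 ∧ β v u' = 0 := fun v hv => by
      obtain ⟨h1, h2⟩ := (hW v).1 hv
      rw [hswap v u, hswap v u', h1, h2]
      simp
    have hπW : ∀ v (hv : v ∈ W), π v = ⟨v, hv⟩ := fun v hv => by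
      ext
      rw [hπ, (hWperp v hv).2, ((hW v).1 hv).1]
      simp
    obtain ⟨m, α, φ, hm, hφβ, hφρ⟩ := ih (Module.finrank ℝ W) (by omega) W
      (β.domRestrict₁₂ W W) (B.domRestrict₁₂ W W) ρ' rfl (fun v => hβ v)
      (by
        intro v hv
        ext
        refine hnd v fun w => ?_
        have h1 : β v (π w) = 0 := hv (π w)
        obtain ⟨h2, h3⟩ := hWperp v v.2
        rw [hdec w, map_add, h1, map_add, map_smul, map_smul, h2, h3]
        simp)
      (fun g v w => hβρ g v w) (fun v w => hB v w)
      (fun v hv => hpos v fun h => hv (by ext; exact h)) (fun g v w => hBρ g v w)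
      (by
        intro f v j
        refine (hd (f ∘ₗ π) v j).congr_of_eventuallyEq (Eventually.of_forall fun t => ?_)
        show f _ = f (π _)
        rw [hπW _ (hWρ _ v v.2)]
        rfl)
    -- the complex coordinate of the plane
    let a : V → ℂ := fun v => ⟨β v u', β u v⟩
    let aL : V →ₗ[ℝ] ℂ :=
      { toFun := a
        map_add' := fun v w => by apply Complex.ext <;> simp [a]
        map_smul' := fun c v => by apply Complex.ext <;> simp [a] }
    have haL : ∀ v, aL v = ⟨β v u', β u v⟩ := fun v => rfl
    have haW : ∀ v ∈ W, aL v = 0 := fun v hv => by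
      rw [haL, (hWperp v hv).2, ((hW v).1 hv).1]
      rfl
    have hau : aL u = 1 := by
      rw [haL, huu, hβ]
      rfl
    have hau' : aL u' = Complex.I := by
      rw [haL, huu, hβ]
      rfl
    let χ : Torus n → ℂ := fun g => aL (ρ g u)
    have hχ : ∀ g v, aL (ρ g v) = χ g * aL v := by
      intro g v
      obtain ⟨c, e, h1, h2⟩ := hρu g
      have h3 : χ g = c + e * Complex.I := by
        show aL (ρ g u) = _
        rw [h1, map_add, map_smul, map_smul, hau, hau']
        simp
      have h4 : aL (ρ g u') = χ g * Complex.I := by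
        rw [h3, h2, map_sub, map_smul, map_smul, hau, hau']
        simp only [Complex.real_smul]
        linear_combination (-(e : ℂ)) * Complex.I_sq
      have h5 : aL v = β v u' + β u v * Complex.I := by
        apply Complex.ext <;> simp [haL]
      conv_lhs => rw [hdec v]
      rw [map_add, map_add, haW _ (hWρ g _ (π v).2), map_add, map_add, map_smul, map_smul,
        map_smul, map_smul, h4, h5]
      show 0 + (β v u' • χ g + β u v • (χ g * Complex.I)) = _
      simp only [Complex.real_smul]
      ring
    obtain ⟨b, hb⟩ := exists_character_eq χ (by simp [χ, hau])
      (fun g h => by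
        show aL (ρ (g * h) u) = _
        rw [map_mul, Module.End.mul_apply, hχ])
      (fun j => by
        have h1 := (hd (β.flip u') u j).hasDerivAt.ofReal_comp
        have h2 := (hd (β u) u j).hasDerivAt.ofReal_comp
        refine (h1.add (h2.mul_const Complex.I)).differentiableAt.congr_of_eventuallyEq
          (Eventually.of_forall fun t => ?_)
        apply Complex.ext <;> simp [χ, haL])
    refine ⟨m + 1, Fin.cons b α, LinearMap.pi (Fin.cons aL fun i => LinearMap.proj i ∘ₗ φ ∘ₗ π),
      by omega, fun v w => ?_, fun g v i => ?_⟩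
    · rw [Fin.sum_univ_succ]
      have h1 : β (π v) (π w) = ∑ i, (starRingEnd ℂ (φ (π v) i) * φ (π w) i).im :=
        hφβ (π v) (π w)
      have h2 : β v w = β v u' * β u w - β u v * β w u' + β (π v) (π w) := by
        obtain ⟨h3, h4⟩ := hWperp _ (π v).2
        obtain ⟨h5, h6⟩ := (hW _).1 (π w).2
        conv_lhs => rw [hdec v, hdec w]
        simp only [map_add, map_smul, LinearMap.add_apply, LinearMap.smul_apply, smul_eq_mul, h3,
          h4, h5, h6, hβ, huu, huu']
        ring
      simp only [LinearMap.pi_apply, Fin.cons_zero, Fin.cons_succ, LinearMap.comp_apply,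
        LinearMap.proj_apply]
      rw [h2, h1, haL, haL]
      simp
      ring
    · refine Fin.cases ?_ (fun i => ?_) i
      · simp only [LinearMap.pi_apply, Fin.cons_zero]
        rw [hχ, hb]
      · simp only [LinearMap.pi_apply, Fin.cons_succ, LinearMap.comp_apply, LinearMap.proj_apply]
        have h1 : π (ρ g v) = ρ' g (π v) := by
          ext
          rw [hρ']
          have h2 := congrArg (fun x => π (ρ g x)) (hdec v)
          obtain ⟨c, e, h3, h4⟩ := hρu g
          have hu : π u = 0 := by
            ext
            rw [hπ, huu, hβ]
            simp
          have hu' : π u' = 0 := by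
            ext
            rw [hπ, huu, hβ]
            simp
          simp only [map_add, map_smul, map_sub, h3, h4, hu, hu'] at h2
          rw [h2, hπW _ (hWρ g _ (π v).2)]
          simp
        rw [h1, hφρ]

end Decomposition

/-! ### The weights of the isotropy representation -/

lemma isQuotientMap_torusExp (n : ℕ) : IsQuotientMap (torusExp : (Fin n → ℝ) → Torus n) := by
  have : IsOpenMap (torusExp : (Fin n → ℝ) → Torus n) :=
    IsOpenMap.piMap (f := fun _ : Fin n => (Circle.exp : ℝ → Circle))
      (fun _ => isLocalHomeomorph_circleExp.isOpenMap)
      (Eventually.of_forall fun _ z => ⟨z.1.arg, Circle.exp_arg z⟩)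
  exact this.isQuotientMap continuous_torusExp torusExp_surjective

section Weights

variable {E : Type*} [NormedAddCommGroup E] [NormedSpace ℝ E]
  {M : Type*} [TopologicalSpace M] [ChartedSpace E M] [IsManifold 𝓘(ℝ, E) ∞ M]
  {n d : ℕ} [MulAction (Torus n) M] {Ω : SymplecticForm E M}

lemma contDiff_endDeriv_torusExp (hA : ContMDiffSMul (torusModel n) 𝓘(ℝ, E) ∞ (Torus n) M) {p : M}
    (hp : p ∈ MulAction.fixedPoints (Torus n) M) :
    ContDiff ℝ 1 (fun ξ : Fin n → ℝ => endDeriv (E := E) (fun x : M => torusExp ξ • x) p) := by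
  rw [← contMDiff_iff_contDiff]
  intro ξ₀
  have : IsManifold 𝓘(ℝ, E) 1 M := IsManifold.of_le (n := ∞) (by norm_num)
  have h := ContMDiffAt.mfderiv (I := 𝓘(ℝ, E)) (I' := 𝓘(ℝ, E)) (J := 𝓘(ℝ, Fin n → ℝ))
    (x₀ := ξ₀) (m := 1) (n := ∞)
    (fun (ξ : Fin n → ℝ) (x : M) => torusExp ξ • x) (fun _ => p)
    (contMDiff_torusExp_smul hA).contMDiffAt contMDiffAt_const two_le_infty
  have hfix : (fun ξ : Fin n → ℝ => torusExp ξ • p) = fun _ => p := funext fun ξ => hp _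
  refine h.congr_of_eventuallyEq (Eventually.of_forall fun ξ => ?_)
  rw [hfix]
  have h1 := inTangentCoordinates_eq (I := 𝓘(ℝ, E)) (I' := 𝓘(ℝ, E)) (N := Fin n → ℝ)
    (fun _ => p) (fun _ => p)
    (fun ξ => endDeriv (E := E) (fun x : M => torusExp ξ • x) p) (x₀ := ξ₀) (x := ξ)
    (mem_chart_source E p) (mem_chart_source E p)
  refine Eq.trans ?_ h1.symm
  ext v
  simp only [ContinuousLinearMap.comp_apply]
  rw [(tangentBundleCore 𝓘(ℝ, E) M).coordChange_self _ _ (mem_chart_source E p),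
    (tangentBundleCore 𝓘(ℝ, E) M).coordChange_self _ _ (mem_chart_source E p)]

lemma continuous_endDeriv_smul (hA : ContMDiffSMul (torusModel n) 𝓘(ℝ, E) ∞ (Torus n) M) {p : M}
    (hp : p ∈ MulAction.fixedPoints (Torus n) M) :
    Continuous (fun g : Torus n => endDeriv (E := E) (fun x : M => g • x) p) := by
  rw [(isQuotientMap_torusExp n).continuous_iff]
  exact (contDiff_endDeriv_torusExp hA hp).continuous

/-- The isotropy representation at a fixed point. -/
def isotropyRep (hA : ContMDiffSMul (torusModel n) 𝓘(ℝ, E) ∞ (Torus n) M) {p : M}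
    (hp : p ∈ MulAction.fixedPoints (Torus n) M) : Torus n →* Module.End ℝ E where
  toFun g := (endDeriv (E := E) (fun x : M => g • x) p).toLinearMap
  map_one' := by
    rw [endDeriv_one_smul]
    rfl
  map_mul' g h := by
    rw [endDeriv_smul_mul hA g h (hp h)]
    rfl

/-- A representation of the torus with continuous matrix coefficients on a finite-dimensional space
preserves an inner product, obtained by averaging over the Haar measure. -/
lemma exists_invariant_innerProduct {V : Type*} [AddCommGroup V] [Module ℝ V]
    [FiniteDimensional ℝ V] (ρ : Torus n →* Module.End ℝ V)
    (hρ : ∀ (f : V →ₗ[ℝ] ℝ) (v : V), Continuous fun g => f (ρ g v)) :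
    ∃ B : LinearMap.BilinForm ℝ V, (∀ v w, B v w = B w v) ∧ (∀ v, v ≠ 0 → 0 < B v v) ∧
      ∀ g v w, B (ρ g v) (ρ g w) = B v w := by
  let _ : MeasurableSpace (Torus n) := borel _
  have : BorelSpace (Torus n) := ⟨rfl⟩
  let μ : Measure (Torus n) := Measure.haar
  let b := Module.finBasis ℝ V
  let F : V → V → Torus n → ℝ := fun v w g => ∑ i, b.coord i (ρ g v) * b.coord i (ρ g w)
  have hF : ∀ v w, Continuous (F v w) := fun v w =>
    continuous_finsetSum _ fun i _ => (hρ _ v).mul (hρ _ w)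
  have hFi : ∀ v w, Integrable (F v w) μ := fun v w =>
    (hF v w).integrable_of_hasCompactSupport (HasCompactSupport.of_compactSpace _)
  have hFs : ∀ v w, F v w = F w v := fun v w => by
    funext g
    exact Finset.sum_congr rfl fun i _ => mul_comm _ _
  have hFa : ∀ u v w, F (u + v) w = fun g => F u w g + F v w g := fun u v w => by
    funext g
    simp only [F, map_add, add_mul, Finset.sum_add_distrib]
  have hFm : ∀ (c : ℝ) v w, F (c • v) w = fun g => c * F v w g := fun c v w => by
    funext g
    simp only [F, map_smul, smul_eq_mul, Finset.mul_sum, mul_assoc]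
  have hadd : ∀ u v w, ∫ g, F (u + v) w g ∂μ = ∫ g, F u w g ∂μ + ∫ g, F v w g ∂μ := by
    intro u v w
    rw [hFa, integral_add (hFi u w) (hFi v w)]
  have hmul : ∀ (c : ℝ) v w, ∫ g, F (c • v) w g ∂μ = c * ∫ g, F v w g ∂μ := by
    intro c v w
    rw [hFm, integral_const_mul]
  refine ⟨LinearMap.mk₂ ℝ (fun v w => ∫ g, F v w g ∂μ) hadd hmul
    (fun u v w => ?_) (fun c v w => ?_), fun v w => ?_, fun v hv => ?_, fun g v w => ?_⟩
  · rw [hFs, hadd, hFs v, hFs w]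
  · rw [hFs, hmul, hFs w]
    rfl
  · simp only [LinearMap.mk₂_apply]
    rw [hFs]
  · simp only [LinearMap.mk₂_apply]
    refine (hF v v).integral_pos_of_hasCompactSupport_nonneg_nonzero (x := 1)
      (HasCompactSupport.of_compactSpace _) (fun g => ?_) ?_
    · exact Finset.sum_nonneg fun i _ => mul_self_nonneg _
    · intro h0
      refine hv (b.ext_elem fun i => ?_)
      have h1 : ∑ i, b.coord i v * b.coord i v = 0 := by
        simpa only [F, map_one, Module.End.one_apply] using h0
      have h2 := (Finset.sum_eq_zero_iff_of_nonneg fun i _ => mul_self_nonneg _).1 h1 i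
        (Finset.mem_univ i)
      simpa using h2
  · simp only [LinearMap.mk₂_apply]
    have h1 : F (ρ g v) (ρ g w) = fun h => F v w (g * h) := by
      funext h
      simp only [F, mul_comm g h, map_mul, Module.End.mul_apply]
    rw [h1]
    exact integral_mul_left_eq_self (F v w) g

variable [FiniteDimensional ℝ E]

/-- The isotropy representation at a fixed point has weights. -/
theorem exists_isIsotropyWeights (hτ : IsHamiltonianAction Ω n) {p : M}
    (hp : p ∈ MulAction.fixedPoints (Torus n) M) (hd : Module.finrank ℝ E = 2 * d) :
    ∃ α : Fin d → Fin n → ℤ, IsIsotropyWeights Ω n p α := by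
  have hA := hτ.smooth
  let ρ := isotropyRep (E := E) hA hp
  have hρ : ∀ (f : E →ₗ[ℝ] ℝ) (v : E), ∃ T : (E →L[ℝ] E) →L[ℝ] ℝ, ∀ g,
      f (ρ g v) = T (endDeriv (E := E) (fun x : M => g • x) p) := fun f v =>
    ⟨(LinearMap.toContinuousLinearMap f).comp (ContinuousLinearMap.apply ℝ E v), fun g => rfl⟩
  obtain ⟨B, hB, hpos, hBρ⟩ := exists_invariant_innerProduct ρ fun f v => by
    obtain ⟨T, hT⟩ := hρ f v
    simp only [hT]
    exact T.continuous.comp (continuous_endDeriv_smul hA hp)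
  obtain ⟨m, α, φ, hm, hφω, hφρ⟩ := exists_weight_decomposition _ E (Ω.bilin p) B ρ hd
    (fun v => Ω.omega_self p v) (fun v hv => Ω.nondegenerate p v hv)
    (fun g v w => hτ.omega_smul (hp g) v w) hB hpos hBρ (fun f v j => by
      obtain ⟨T, hT⟩ := hρ f v
      simp only [hT]
      have h1 : Differentiable ℝ fun ξ : Fin n → ℝ =>
          endDeriv (E := E) (fun x : M => torusExp ξ • x) p :=
        (contDiff_endDeriv_torusExp hA hp).differentiable (by simp)
      have h2 : Differentiable ℝ fun t : ℝ => (Pi.single j t : Fin n → ℝ) :=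
        (LinearMap.toContinuousLinearMap (LinearMap.single ℝ (fun _ : Fin n => ℝ) j)).differentiable
      exact (T.differentiable.comp (h1.comp h2)) 0)
  obtain rfl : d = m := by omega
  have hinj : Function.Injective φ := by
    rw [← LinearMap.ker_eq_bot, LinearMap.ker_eq_bot']
    intro v hv
    refine Ω.nondegenerate p v fun w => ?_
    refine (hφω v w).trans ?_
    simp [hv]
  have hfr : Module.finrank ℝ E = Module.finrank ℝ (Fin d → ℂ) := by
    rw [hd, Module.finrank_pi_fintype]
    simp [Complex.finrank_real_complex, mul_comm]
  exact ⟨α, φ.linearEquivOfInjective hinj hfr, hφω, hφρ⟩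

end Weights

/-! ### The real tangent space at a fixed point -/

section RealTangent

variable {E : Type*} [NormedAddCommGroup E] [NormedSpace ℝ E]
  {M : Type*} [TopologicalSpace M] [ChartedSpace E M]
  {n d : ℕ} [MulAction (Torus n) M] {Ω : SymplecticForm E M} {K : Subgroup (Torus n)} {σ : M → M}

lemma endDeriv_involution_involutive (hσ : IsCompatibleAntisymplecticInvolution Ω n σ) {p : M}
    (hp : σ p = p) (v : E) : endDeriv σ p (endDeriv σ p v) = v := by
  have hs := hσ.smooth.mdifferentiable (by simp) p
  have h := endDeriv_comp (E := E) hs hs hp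
  rw [hσ.involutive.comp_self, endDeriv_id] at h
  exact (congrArg (fun T : E →L[ℝ] E => T v) h).symm

lemma omega_endDeriv_involution (hσ : IsCompatibleAntisymplecticInvolution Ω n σ) {p : M}
    (hp : σ p = p) (u v : E) :
    Ω.omega p (endDeriv σ p u) (endDeriv σ p v) = -Ω.omega p u v := by
  have h : Ω.omega (σ p) (endDeriv σ p u) (endDeriv σ p v) = -Ω.omega p u v :=
    hσ.antisymplectic p u v
  rwa [hp] at h

lemma endDeriv_involution_mem_fixedTangent
    (hA : ContMDiffSMul (torusModel n) 𝓘(ℝ, E) ∞ (Torus n) M)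
    (hσ : IsCompatibleAntisymplecticInvolution Ω n σ) (hK : K ≤ realTorus n) {p : M}
    (hp : σ p = p) (hpK : p ∈ fixedSet M K) {v : E} (hv : v ∈ fixedTangent E K p) :
    endDeriv σ p v ∈ fixedTangent E K p := by
  intro k hk
  have hs := hσ.smooth.mdifferentiable (by simp) p
  have hkd := mdifferentiableAt_smul (E := E) hA k p
  have h1 := endDeriv_comp (E := E) hs hkd hp
  have h2 := endDeriv_comp (E := E) hkd hs (hpK k hk)
  have h3 : (fun y : M => k • y) ∘ σ = σ ∘ fun y : M => k • y := by
    funext y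
    simp only [Function.comp_apply]
    rw [hσ.compatible, inv_eq_self_of_mem_realTorus (hK hk)]
  rw [h3, h2] at h1
  have h4 := congrArg (fun T : E →L[ℝ] E => T v) h1
  have h5 : endDeriv σ p (endDeriv (fun y : M => k • y) p v) =
    endDeriv (fun y : M => k • y) p (endDeriv σ p v) := h4
  rw [← h5, hv k hk]

variable (E) in
/-- The vectors of the fixed tangent space of `K` which are fixed by the differential of `σ`. -/
def realFixedTangent (K : Subgroup (Torus n)) (σ : M → M) (p : M) : Submodule ℝ E :=
  fixedTangent E K p ⊓ LinearMap.eqLocus (endDeriv (E := E) σ p).toLinearMap LinearMap.id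

lemma mem_realFixedTangent {p : M} {v : E} :
    v ∈ realFixedTangent E K σ p ↔ v ∈ fixedTangent E K p ∧ endDeriv σ p v = v := Iff.rfl

variable [FiniteDimensional ℝ E]

/-- The real part is at least half of the fixed tangent space: the two eigenspaces of the
antisymplectic involution are isotropic, and so the form embeds one into the dual of the other. -/
lemma finrank_fixedTangent_le_two_mul (hτ : IsHamiltonianAction Ω n)
    (hσ : IsCompatibleAntisymplecticInvolution Ω n σ) (hK : K ≤ realTorus n) {p : M}
    (hp : σ p = p) (hpK : p ∈ fixedSet M K) :
    Module.finrank ℝ (fixedTangent E K p) ≤ 2 * Module.finrank ℝ (realFixedTangent E K σ p) := by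
  have : Finite K := finite_of_le_realTorus hK
  set T := fixedTangent E K p
  set T' := realFixedTangent E K σ p
  set D : E →L[ℝ] E := endDeriv σ p with hD
  have hDD : ∀ v, D (D v) = v := endDeriv_involution_involutive hσ hp
  have hDT : ∀ v ∈ T, D v ∈ T := fun v hv =>
    endDeriv_involution_mem_fixedTangent hτ.smooth hσ hK hp hpK hv
  have hom : ∀ u v, Ω.bilin p (D u) (D v) = -Ω.bilin p u v := omega_endDeriv_involution hσ hp
  let A : T →ₗ[ℝ] T' := LinearMap.codRestrict T' ((LinearMap.id + D.toLinearMap) ∘ₗ T.subtype)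
    fun v => by
      refine mem_realFixedTangent.2 ⟨T.add_mem v.2 (hDT v v.2), ?_⟩
      show D ((v : E) + D v) = v + D v
      rw [map_add, hDD, add_comm]
  have hA : ∀ v : T, (A v : E) = v + D v := fun v => rfl
  have hker : ∀ v : T, v ∈ LinearMap.ker A → D v = -v := fun v hv => by
    have h1 : (v : E) + D v = 0 := by
      rw [← hA, LinearMap.mem_ker.1 hv]
      rfl
    exact (neg_eq_of_add_eq_zero_right h1).symm
  let C : LinearMap.ker A →ₗ[ℝ] Module.Dual ℝ T' :=
    { toFun := fun u => (Ω.bilin p ((u : T) : E)) ∘ₗ T'.subtype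
      map_add' := fun u v => by ext w; simp
      map_smul' := fun c u => by ext w; simp }
  have hC : Function.Injective C := by
    rw [← LinearMap.ker_eq_bot, LinearMap.ker_eq_bot']
    intro u hu
    by_contra hne
    have hu0 : ((u : T) : E) ≠ 0 := fun h => hne (by ext; exact h)
    obtain ⟨v, hv, hv0⟩ := exists_mem_fixedTangent_omega_ne_zero hτ hpK u.1.2 hu0
    have h1 : Ω.bilin p ((u : T) : E) (v + D v) = 0 := LinearMap.congr_fun hu (A ⟨v, hv⟩)
    have h2 : Ω.bilin p ((u : T) : E) (v - D v) = 0 := by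
      have h3 := hom (u : T) (v - D v)
      rw [map_sub D, hDD, hker _ u.2] at h3
      have h4 : D v - v = -(v - D v) := by abel
      rw [h4, map_neg, map_neg, LinearMap.neg_apply, neg_neg] at h3
      linarith
    rw [map_add] at h1
    rw [map_sub] at h2
    refine hv0 ?_
    rw [← Ω.bilin_apply]
    linarith
  have h1 := A.finrank_range_add_finrank_ker
  have h2 : Module.finrank ℝ (LinearMap.range A) ≤ Module.finrank ℝ T' := Submodule.finrank_le _
  have h3 := LinearMap.finrank_le_finrank_of_injective hC
  rw [Subspace.dual_finrank_eq] at h3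
  omega

lemma finrank_fixedTangent_pos {α : Fin d → Fin n → ℤ} {p : M}
    (hα : IsIsotropyWeights Ω n p α) {i : Fin d} (hi : ∀ k ∈ K, character (α i) k = 1) :
    0 < Module.finrank ℝ (fixedTangent E K p) := by
  obtain ⟨φ, -, hφ⟩ := hα.exists_equiv
  have hmem : φ.symm (Pi.single i 1) ∈ fixedTangent E K p := by
    rw [mem_fixedTangent_iff hφ]
    intro j hj
    rw [φ.apply_symm_apply, Pi.single_eq_of_ne]
    rintro rfl
    exact hj hi
  have : Nontrivial (fixedTangent E K p) := ⟨⟨⟨_, hmem⟩, 0, fun h => by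
    have h1 : φ.symm (Pi.single i 1) = 0 := congrArg Subtype.val h
    have h2 := congrFun (φ.symm.map_eq_zero_iff.1 h1) i
    simp at h2⟩⟩
  exact Module.finrank_pos

lemma four_le_finrank_fixedTangent {α : Fin d → Fin n → ℤ} {p : M}
    (hα : IsIsotropyWeights Ω n p α) {i j : Fin d} (hij : i ≠ j)
    (hi : ∀ k ∈ K, character (α i) k = 1) (hj : ∀ k ∈ K, character (α j) k = 1) :
    4 ≤ Module.finrank ℝ (fixedTangent E K p) := by
  obtain ⟨φ, -, hφ⟩ := hα.exists_equiv
  let c : ℂ × ℂ →ₗ[ℝ] (Fin d → ℂ) := LinearMap.coprod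
    (LinearMap.single ℝ (fun _ : Fin d => ℂ) i) (LinearMap.single ℝ (fun _ : Fin d => ℂ) j)
  have hc : ∀ z, c z = Pi.single i z.1 + Pi.single j z.2 := fun z => rfl
  let A : ℂ × ℂ →ₗ[ℝ] fixedTangent E K p :=
    LinearMap.codRestrict _ ((φ.symm : (Fin d → ℂ) →ₗ[ℝ] E) ∘ₗ c) fun z => by
      rw [mem_fixedTangent_iff hφ]
      intro k hk
      have h1 : k ≠ i := by rintro rfl; exact hk hi
      have h2 : k ≠ j := by rintro rfl; exact hk hj
      show φ (φ.symm (c z)) k = 0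
      rw [φ.apply_symm_apply, hc]
      simp [h1, h2]
  have hA : Function.Injective A := by
    rw [← LinearMap.ker_eq_bot, LinearMap.ker_eq_bot']
    intro z hz
    have h1 : φ.symm (c z) = 0 := congrArg Subtype.val hz
    have h2 := φ.symm.map_eq_zero_iff.1 h1
    rw [hc] at h2
    have h3 := congrFun h2 i
    have h4 := congrFun h2 j
    ext1
    · simpa [hij, Pi.single_eq_of_ne hij] using h3
    · simpa [hij, Pi.single_eq_of_ne hij.symm] using h4
  have := LinearMap.finrank_le_finrank_of_injective hA
  rw [Module.finrank_prod, Complex.finrank_real_complex] at this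
  omega

end RealTangent

section RealChart

variable {E : Type*} [NormedAddCommGroup E] [NormedSpace ℝ E]
  {M : Type*} [TopologicalSpace M] [ChartedSpace E M]
  {n : ℕ} [MulAction (Torus n) M] {Ω : SymplecticForm E M} {K : Subgroup (Torus n)} {σ : M → M}

/-- The chart `e` at `p` is linear for the involution `σ`. -/
def IsRealChart (σ : M → M) (p : M) (e : OpenPartialHomeomorph M E) : Prop :=
  ∀ x ∈ e.source, σ x ∈ e.source ∧ e (σ x) = endDeriv σ p (e x)

/-- Since the involution commutes with the elements of order two of the torus, there is a chart which
is linear for both. -/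
lemma exists_isRealChart [IsManifold 𝓘(ℝ, E) ∞ M] [CompleteSpace E]
    (hA : ContMDiffSMul (torusModel n) 𝓘(ℝ, E) ∞ (Torus n) M)
    (hσ : IsCompatibleAntisymplecticInvolution Ω n σ) (hK : K ≤ realTorus n) {p : M}
    (hp : σ p = p) (hpK : p ∈ fixedSet M K) :
    ∃ e : OpenPartialHomeomorph M E, IsLinearChart K p e ∧ IsRealChart σ p e := by
  have : Finite K := finite_of_le_realTorus hK
  let s : Equiv.Perm M := hσ.involutive.toPerm
  have hs : s * s = 1 := by
    ext x
    exact hσ.involutive x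
  let ι : ℤˣ →* Equiv.Perm M :=
    { toFun := fun u => if u = 1 then 1 else s
      map_one' := by simp
      map_mul' := fun u v => by
        rcases Int.units_eq_one_or u with rfl | rfl <;> rcases Int.units_eq_one_or v with rfl | rfl
          <;> simp [hs] }
  have hι : ∀ u, (ι u = 1) ∨ (ι u = s) := fun u => by
    by_cases hu : u = 1
    · exact Or.inl (if_pos hu)
    · exact Or.inr (if_neg hu)
  have hne : (-1 : ℤˣ) ≠ 1 := by decide
  have hιs : ι (-1) = s :=
    (if_neg hne : (if (-1 : ℤˣ) = 1 then (1 : Equiv.Perm M) else s) = s)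
  have hcomm : ∀ (k : K) (u : ℤˣ), Commute (MulAction.toPermHom K M k) (ι u) := by
    intro k u
    rcases hι u with h | h
    · rw [h]; exact Commute.one_right _
    · rw [h]
      ext x
      show (k : Torus n) • σ x = σ ((k : Torus n) • x)
      rw [hσ.compatible, inv_eq_self_of_mem_realTorus (hK k.2)]
  let ρ : K × ℤˣ →* Equiv.Perm M := MonoidHom.noncommCoprod (MulAction.toPermHom K M) ι hcomm
  have hρ : ∀ k u x, ρ (k, u) x = (k : Torus n) • ι u x := fun k u x => rfl
  obtain ⟨e, h1, h2, h3, h4, h5, h6⟩ := exists_linearizing_chart (E := E) ρ (p := p)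
    (by
      rintro ⟨k, u⟩
      have h0 : ContMDiff 𝓘(ℝ, E) 𝓘(ℝ, E) ∞ (ι u) := by
        rcases hι u with h | h
        · rw [h]; exact contMDiff_id
        · rw [h]; exact hσ.smooth
      exact (contMDiff_const_smul' hA (k : Torus n)).comp h0)
    (by
      rintro ⟨k, u⟩
      rw [hρ]
      rcases hι u with h | h
      · rw [h]; exact hpK k k.2
      · rw [h]
        show (k : Torus n) • σ p = p
        rw [hp]
        exact hpK k k.2)
  have hk : ∀ k (hk : k ∈ K), (ρ (⟨k, hk⟩, 1) : M → M) = fun y => k • y := fun k hk => by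
    funext y
    rw [hρ, map_one]
    rfl
  have hs' : (ρ (1, -1) : M → M) = σ := by
    funext y
    rw [hρ, hιs, Subgroup.coe_one, one_smul]
    rfl
  refine ⟨e, ⟨h1, h2, h3, h4, fun k hkK x hx => ?_, fun k hkK x hx => ?_, h6⟩, fun x hx => ?_⟩
  · have := (h5 (⟨k, hkK⟩, 1) x hx).1
    rwa [hk] at this
  · have := (h5 (⟨k, hkK⟩, 1) x hx).2
    rwa [hk] at this
  · have := h5 (1, -1) x hx
    rwa [hs'] at this

variable {p : M} {e : OpenPartialHomeomorph M E}

lemma IsRealChart.involution_symm (he : IsRealChart σ p e) {z : E} (hz : z ∈ e.target) :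
    σ (e.symm z) = e.symm (endDeriv σ p z) := by
  obtain ⟨h1, h2⟩ := he _ (e.map_target hz)
  rw [e.right_inv hz] at h2
  rw [← h2, e.left_inv h1]

/-- Real tangent vectors correspond to points of the real locus fixed by `K`. -/
lemma IsLinearChart.symm_mem_fixedSet (he : IsLinearChart K p e) {z : E} (hz : z ∈ e.target)
    (hzK : z ∈ fixedTangent E K p) : e.symm z ∈ fixedSet M K := by
  rw [he.mem_fixedSet_iff (e.map_target hz), e.right_inv hz]
  exact hzK

lemma IsLinearChart.exists_smul_not_mem (he : IsLinearChart K p e) {S : Set M} (hS : S.Finite)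
    {w : E} (hw : w ≠ 0) : ∃ t : ℝ, t • w ∈ e.target ∧ e.symm (t • w) ∉ S := by
  by_contra hn
  push Not at hn
  have hc : Continuous fun t : ℝ => t • w := continuous_id.smul continuous_const
  have hU : (fun t : ℝ => t • w) ⁻¹' e.target ∈ 𝓝 (0 : ℝ) :=
    (e.open_target.preimage hc).mem_nhds (by
      show (0 : ℝ) • w ∈ e.target
      rw [zero_smul]
      exact he.zero_mem_target)
  refine infinite_of_injOn_mapsTo (f := fun t : ℝ => e.symm (t • w)) (t := S) (fun s hs t ht hst => ?_)
    (fun t ht => hn t ht) (infinite_of_mem_nhds (0 : ℝ) hU) hS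
  exact smul_left_injective ℝ hw (e.symm.injOn hs ht hst)

end RealChart

/-! ### The dimension of the one-skeleton near a fixed point -/

lemma finrank_le_dimH_of_hasStrictFDerivAt {N E : Type*} [NormedAddCommGroup N] [NormedSpace ℝ N]
    [FiniteDimensional ℝ N] [NormedAddCommGroup E] [NormedSpace ℝ E] [FiniteDimensional ℝ E]
    {F : N → E} {F' : N →L[ℝ] E} (hF : HasStrictFDerivAt F F' 0) (hinj : Function.Injective F')
    {S : Set E} (hS : ∀ᶠ z in 𝓝 0, F z ∈ S) : (Module.finrank ℝ N : ENNReal) ≤ dimH S := by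
  obtain ⟨R₀, hR₀⟩ := LinearMap.exists_leftInverse_of_injective (F' : N →ₗ[ℝ] E)
    (LinearMap.ker_eq_bot.2 hinj)
  let R : E →L[ℝ] N := LinearMap.toContinuousLinearMap R₀
  -- a linear left inverse of the derivative makes `F` a local homeomorphism
  have hRF : HasStrictFDerivAt (R ∘ F)
      ((ContinuousLinearEquiv.refl ℝ N : N ≃L[ℝ] N) : N →L[ℝ] N) 0 := by
    refine (R.hasStrictFDerivAt.comp (0 : N) hF).congr_fderiv ?_
    ext v
    exact LinearMap.congr_fun hR₀ v
  have hnhds : R '' S ∈ 𝓝 (R (F 0)) := by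
    have h := hRF.map_nhds_eq_of_equiv
    have h1 : (R ∘ F) '' {z | F z ∈ S} ∈ 𝓝 ((R ∘ F) 0) := by
      rw [← h]
      exact image_mem_map hS
    refine mem_of_superset h1 ?_
    rintro _ ⟨z, hz, rfl⟩
    exact mem_image_of_mem R hz
  rw [← Real.dimH_of_mem_nhds hnhds]
  exact R.lipschitz.dimH_image_le S

section OneSkeleton

variable {E : Type*} [NormedAddCommGroup E] [NormedSpace ℝ E] [FiniteDimensional ℝ E]
  {M : Type*} [TopologicalSpace M] [ChartedSpace E M]
  {n d : ℕ} [MulAction (Torus n) M] {Ω : SymplecticForm E M} {K : Subgroup (Torus n)} {σ : M → M}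

omit [FiniteDimensional ℝ E] in
lemma smul_mem_oneSkeleton (hA : ContMDiffSMul (torusModel n) 𝓘(ℝ, E) ∞ (Torus n) M) {x : M}
    (hx : x ∈ oneSkeleton E M n) (g : Torus n) : g • x ∈ oneSkeleton E M n := by
  let L : (Fin n → ℝ) →L[ℝ] E := infinitesimalAction (E := E) n x
  let L' : (Fin n → ℝ) →L[ℝ] E := infinitesimalAction (E := E) n (g • x)
  let D : E →L[ℝ] E := mfderiv 𝓘(ℝ, E) 𝓘(ℝ, E) (fun y : M => g • y) x
  have h1 : L'.range ≤ L.range.map D.toLinearMap := by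
    rintro _ ⟨ξ, rfl⟩
    exact ⟨L ξ, ⟨ξ, rfl⟩, mfderiv_smul_infinitesimalAction hA g x ξ⟩
  have h2 : Module.finrank ℝ L'.range ≤ Module.finrank ℝ L.range :=
    (Submodule.finrank_mono h1).trans (Submodule.finrank_map_le _ _)
  have h3 : Module.finrank ℝ L.range ≤ 1 := hx
  exact h2.trans h3

variable [IsManifold 𝓘(ℝ, E) ∞ M] [T2Space M]

/-- If the points of the real locus near `p` which are fixed by `K` lie in the one-skeleton, then
the union of their torus orbits does, and it has larger dimension: at a point of the real locus the
orbit is transverse to the real locus, since `σ` acts by `-1` on its tangent space. -/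
lemma finrank_realFixedTangent_lt_subsetDim (hτ : IsHamiltonianAction Ω n)
    (hσ : IsCompatibleAntisymplecticInvolution Ω n σ) {p : M} {e : OpenPartialHomeomorph M E}
    (he : IsLinearChart K p e) (heσ : IsRealChart σ p e)
    (hfin : (MulAction.fixedPoints (Torus n) M).Finite)
    (hpos : 0 < Module.finrank ℝ (realFixedTangent E K σ p))
    (hS : ∀ z ∈ realFixedTangent E K σ p, z ∈ e.target → e.symm z ∈ oneSkeleton E M n) :
    ((Module.finrank ℝ (realFixedTangent E K σ p) + 1 : ℕ) : ENNReal) ≤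
      subsetDim E (oneSkeleton E M n) := by
  have hA := hτ.smooth
  set T := realFixedTangent E K σ p with hT
  obtain ⟨ξ, hξ⟩ := exists_isGenerator n
  -- a point `x₀` of the real locus which is not fixed by the torus
  obtain ⟨w, hw, hw0⟩ := Submodule.exists_mem_ne_zero_of_ne_bot
    (p := T) (by rintro h; rw [h, finrank_bot] at hpos; exact lt_irrefl _ hpos)
  obtain ⟨t, ht, htS⟩ := he.exists_smul_not_mem hfin hw0
  set w₀ := t • w with hw₀
  have hw₀T : w₀ ∈ T := T.smul_mem t hw
  have hDw₀ : endDeriv σ p w₀ = w₀ := (mem_realFixedTangent.1 hw₀T).2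
  set x₀ := e.symm w₀ with hx₀
  have hσx₀ : σ x₀ = x₀ := by
    rw [hx₀, heσ.involution_symm ht, hDw₀]
  let X : E := infinitesimalAction (E := E) n x₀ ξ
  have hX : X ≠ 0 := fun h =>
    htS (mem_fixedPoints_of_infinitesimalAction_eq_zero hA hξ h)
  -- the derivatives at `x₀` of the inverse of `e`, of the preferred chart and of `σ`
  have hsym : ContMDiffAt 𝓘(ℝ, E) 𝓘(ℝ, E) 2 e.symm w₀ :=
    he.contMDiffOn_symm.contMDiffAt (e.open_target.mem_nhds ht)
  let L : E →L[ℝ] E := mfderiv 𝓘(ℝ, E) 𝓘(ℝ, E) e.symm w₀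
  have hL : HasMFDerivAt 𝓘(ℝ, E) 𝓘(ℝ, E) e.symm w₀ L :=
    (hsym.mdifferentiableAt (by simp)).hasMFDerivAt
  have hLinj : Function.Injective L := he.mDifferentiable.symm.mfderiv_injective ht
  set ϕ := extChartAt 𝓘(ℝ, E) x₀ with hϕ
  let P : E →L[ℝ] E := mfderiv 𝓘(ℝ, E) 𝓘(ℝ, E) ϕ x₀
  have hP : HasMFDerivAt 𝓘(ℝ, E) 𝓘(ℝ, E) ϕ x₀ P :=
    (mdifferentiableAt_extChartAt (mem_chart_source E x₀)).hasMFDerivAt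
  have hPinj : Function.Injective P :=
    (isInvertible_mfderiv_extChartAt (I := 𝓘(ℝ, E)) (mem_extChartAt_source x₀)).injective
  let D : E →L[ℝ] E := endDeriv σ x₀
  have hDL : ∀ v ∈ T, D (L v) = L v := by
    intro v hv
    have h1 : HasMFDerivAt 𝓘(ℝ, E) 𝓘(ℝ, E) σ (e.symm w₀) D :=
      (hσ.smooth.mdifferentiable (by simp) x₀).hasMFDerivAt
    have h2 : HasMFDerivAt 𝓘(ℝ, E) 𝓘(ℝ, E) (σ ∘ e.symm) w₀ (D.comp L) := h1.comp w₀ hL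
    let D₀ : E →L[ℝ] E := endDeriv σ p
    have h3 : HasMFDerivAt 𝓘(ℝ, E) 𝓘(ℝ, E) e.symm (D₀ w₀) L := by
      rw [hDw₀]; exact hL
    have h4 : HasMFDerivAt 𝓘(ℝ, E) 𝓘(ℝ, E) (e.symm ∘ D₀) w₀ (L.comp D₀) :=
      h3.comp w₀ (D₀.hasMFDerivAt (x := w₀))
    have h5 := h4.congr_of_eventuallyEq (f₁ := σ ∘ e.symm) (by
      filter_upwards [e.open_target.mem_nhds ht] with z hz
      exact heσ.involution_symm hz)
    have h6 : D.comp L = L.comp D₀ := hasMFDerivAt_unique h2 h5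
    have h7 : D (L v) = L (D₀ v) := congrArg (fun T : E →L[ℝ] E => T v) h6
    rw [h7]
    exact congrArg L (mem_realFixedTangent.1 hv).2
  have hDX : D X = -X := by
    have h := mfderiv_involution_infinitesimalAction hA hσ.smooth hσ.compatible x₀ ξ
    rw [hσx₀] at h
    exact h
  -- the union of the orbits, parametrized near `x₀`
  let F : T × ℝ → E := fun z => ϕ (torusExp (z.2 • ξ) • e.symm (w₀ + z.1))
  have hF : ContDiffAt ℝ 2 F 0 := by
    refine ContMDiffAt.contDiffAt ?_
    have h1 : ContMDiffAt 𝓘(ℝ, T × ℝ) 𝓘(ℝ, Fin n → ℝ) 2 (fun z : T × ℝ => z.2 • ξ) 0 :=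
      ContDiffAt.contMDiffAt (by fun_prop)
    have h2 : ContMDiffAt 𝓘(ℝ, T × ℝ) 𝓘(ℝ, E) 2 (fun z : T × ℝ => e.symm (w₀ + z.1)) 0 := by
      refine ContMDiffAt.comp (I' := 𝓘(ℝ, E)) (M' := E) (g := e.symm)
        (f := fun z : T × ℝ => w₀ + (z.1 : E)) (0 : T × ℝ) ?_ ?_
      · have : w₀ + ((0 : T × ℝ).1 : E) = w₀ := by simp
        rw [this]
        exact hsym
      · exact ContDiffAt.contMDiffAt
          (contDiff_const.add (T.subtypeL.contDiff.comp contDiff_fst)).contDiffAt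
    have h3 : ContMDiffAt 𝓘(ℝ, T × ℝ) 𝓘(ℝ, E) 2
        (fun z : T × ℝ => torusExp (z.2 • ξ) • e.symm (w₀ + z.1)) 0 :=
      (((contMDiff_torusExp_smul hA).of_le two_le_infty).contMDiffAt).comp (0 : T × ℝ)
        (h1.prodMk h2)
    refine ContMDiffAt.comp (g := ϕ) (0 : T × ℝ) ?_ h3
    have : torusExp ((0 : T × ℝ).2 • ξ) • e.symm (w₀ + ((0 : T × ℝ).1 : E)) = x₀ := by simp [hx₀]
    rw [this]
    exact contMDiffAt_extChartAt.of_le two_le_infty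
  have hFs := hF.hasStrictFDerivAt (by simp)
  have hFL : ∀ v : T, fderiv ℝ F 0 (v, 0) = P (L v) := by
    intro v
    have h1 : HasFDerivAt (fun v : T => F (v, 0))
        ((fderiv ℝ F 0).comp (ContinuousLinearMap.inl ℝ T ℝ)) 0 :=
      HasFDerivAt.comp (g := F) (0 : T) hFs.hasFDerivAt (hasFDerivAt_prodMk_left (𝕜 := ℝ) (0 : T) (0:ℝ))
    have h2 : HasMFDerivAt 𝓘(ℝ, T) 𝓘(ℝ, E) (fun v : T => w₀ + (v : E)) 0 T.subtypeL :=
      HasFDerivAt.hasMFDerivAt (T.subtypeL.hasFDerivAt.const_add w₀)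
    have h3 : HasMFDerivAt 𝓘(ℝ, T) 𝓘(ℝ, E) (fun v : T => e.symm (w₀ + v)) 0 (L.comp T.subtypeL) := by
      refine HasMFDerivAt.comp (g := e.symm) (0 : T) ?_ h2
      rwa [ZeroMemClass.coe_zero, add_zero]
    have h4 : HasMFDerivAt 𝓘(ℝ, T) 𝓘(ℝ, E) (fun v : T => ϕ (e.symm (w₀ + v))) 0
        (P.comp (L.comp T.subtypeL)) := by
      refine HasMFDerivAt.comp (g := ϕ) (0 : T) ?_ h3
      rwa [ZeroMemClass.coe_zero, add_zero]
    have h5 : HasFDerivAt (fun v : T => F (v, 0)) (P.comp (L.comp T.subtypeL)) 0 := by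
      have h6 : (fun v : T => F (v, 0)) = fun v : T => ϕ (e.symm (w₀ + v)) := by
        funext v
        simp [F]
      rw [h6]
      exact h4.hasFDerivAt
    exact congrArg (fun A : T →L[ℝ] E => A v) (h1.unique h5)
  have hFX : ∀ s : ℝ, fderiv ℝ F 0 (0, s) = s • P X := by
    intro s
    have h1 : HasFDerivAt (fun s : ℝ => F (0, s))
        ((fderiv ℝ F 0).comp (ContinuousLinearMap.inr ℝ T ℝ)) 0 :=
      HasFDerivAt.comp (g := F) (0 : ℝ) hFs.hasFDerivAt (hasFDerivAt_prodMk_right (𝕜 := ℝ) (0 : T) (0:ℝ))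
    have h2 : HasMFDerivAt 𝓘(ℝ, ℝ) 𝓘(ℝ, Fin n → ℝ) (fun t : ℝ => t • ξ) 0
        (ContinuousLinearMap.toSpanSingleton ℝ ξ) :=
      HasFDerivAt.hasMFDerivAt (ContinuousLinearMap.toSpanSingleton ℝ ξ).hasFDerivAt
    let A : (Fin n → ℝ) →L[ℝ] E := infinitesimalAction (E := E) n x₀
    have h3 : HasMFDerivAt 𝓘(ℝ, ℝ) 𝓘(ℝ, E) (fun t : ℝ => torusExp (t • ξ) • x₀) 0
        (A.comp (ContinuousLinearMap.toSpanSingleton ℝ ξ)) := by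
      refine HasMFDerivAt.comp (g := fun η : Fin n → ℝ => torusExp η • x₀) (0 : ℝ) ?_ h2
      rw [zero_smul]
      exact hasMFDerivAt_orbitMap hA x₀
    have h4 : HasMFDerivAt 𝓘(ℝ, ℝ) 𝓘(ℝ, E) (fun t : ℝ => ϕ (torusExp (t • ξ) • x₀)) 0
        (P.comp (A.comp (ContinuousLinearMap.toSpanSingleton ℝ ξ))) := by
      refine HasMFDerivAt.comp (g := ϕ) (0 : ℝ) ?_ h3
      rwa [zero_smul, torusExp_zero, one_smul]
    have h5 : HasFDerivAt (fun s : ℝ => F (0, s))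
        (P.comp (A.comp (ContinuousLinearMap.toSpanSingleton ℝ ξ))) 0 := by
      have h6 : (fun s : ℝ => F (0, s)) = fun t : ℝ => ϕ (torusExp (t • ξ) • x₀) := by
        funext s
        simp [F, hx₀]
      rw [h6]
      exact h4.hasFDerivAt
    have h7 : fderiv ℝ F 0 (0, s) = P (A (s • ξ)) :=
      congrArg (fun B : ℝ →L[ℝ] E => B s) (h1.unique h5)
    rw [h7, map_smul, map_smul]
    rfl
  have hinj : Function.Injective (fderiv ℝ F 0) := by
    rw [injective_iff_map_eq_zero]
    rintro ⟨v, s⟩ hvs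
    have h1 : ((v, s) : T × ℝ) = (v, 0) + (0, s) := by simp
    rw [h1, map_add, hFL, hFX, ← map_smul, ← map_add] at hvs
    have h2 : L v + s • X = 0 := hPinj (by rw [hvs, map_zero])
    have h3 : D (L v + s • X) = L v - s • X := by
      rw [map_add, map_smul, hDL v v.2, hDX, smul_neg, sub_eq_add_neg]
    rw [h2, map_zero] at h3
    have h4 : L v = s • X := (sub_eq_zero.1 h3.symm)
    rw [h4, ← two_smul ℝ, smul_smul] at h2
    have h5 : s = 0 := by
      have := (smul_eq_zero.1 h2).resolve_right hX
      linarith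
    have h6 : (v : E) = 0 := hLinj (by rw [h4, h5, zero_smul, map_zero])
    ext
    · exact h6
    · exact h5
  have hFS : ∀ᶠ z in 𝓝 0, F z ∈ ϕ '' (oneSkeleton E M n ∩ ϕ.source) := by
    have h1 : ContinuousAt (fun z : T × ℝ => w₀ + (z.1 : E)) 0 := by fun_prop
    have h2 : ∀ᶠ z : T × ℝ in 𝓝 0, w₀ + (z.1 : E) ∈ e.target :=
      h1.eventually_mem (by simpa using e.open_target.mem_nhds ht)
    have := continuousSMul_torus (E := E) hA
    have h3 : ContinuousAt (fun z : T × ℝ => torusExp (z.2 • ξ) • e.symm (w₀ + (z.1 : E))) 0 := by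
      refine ContinuousAt.smul (f := fun z : T × ℝ => torusExp (z.2 • ξ)) ?_ ?_
      · exact (continuous_torusExp.comp (continuous_snd.smul continuous_const)).continuousAt
      · refine ContinuousAt.comp (g := e.symm) ?_ h1
        exact e.continuousAt_symm (by simpa using ht)
    have h4 : ∀ᶠ z : T × ℝ in 𝓝 0, torusExp (z.2 • ξ) • e.symm (w₀ + (z.1 : E)) ∈ ϕ.source := by
      refine h3.eventually_mem ?_
      have : torusExp ((0 : T × ℝ).2 • ξ) • e.symm (w₀ + ((0 : T × ℝ).1 : E)) = x₀ := by simp [hx₀]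
      rw [this]
      exact extChartAt_source_mem_nhds x₀
    filter_upwards [h2, h4] with z hz hz'
    exact mem_image_of_mem ϕ ⟨smul_mem_oneSkeleton hA (hS _ (T.add_mem hw₀T z.1.2) hz) _, hz'⟩
  have hle := finrank_le_dimH_of_hasStrictFDerivAt hFs hinj hFS
  rw [Module.finrank_prod, Module.finrank_self] at hle
  exact hle.trans (le_iSup (fun c : M =>
    dimH (extChartAt 𝓘(ℝ, E) c '' (oneSkeleton E M n ∩ (extChartAt 𝓘(ℝ, E) c).source))) x₀)

omit [T2Space M] in
/-- If the points of the real locus fixed by `G_ℝ` are the fixed points of the torus, then the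
reduced weights are nonzero: a weight which is trivial on `G_ℝ` yields a curve of points fixed by
`G_ℝ` and `σ`. -/
lemma mod2Reduction_ne_zero_of_realFixedPoints (hτ : IsHamiltonianAction Ω n)
    (hσ : IsCompatibleAntisymplecticInvolution Ω n σ)
    (hfin : (MulAction.fixedPoints (Torus n) M).Finite)
    (hX : realFixedPoints n σ = MulAction.fixedPoints (Torus n) M) {p : M}
    (hp : p ∈ MulAction.fixedPoints (Torus n) M) {α : Fin d → Fin n → ℤ}
    (hα : IsIsotropyWeights Ω n p α) (i : Fin d) : mod2Reduction (α i) ≠ 0 := by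
  intro hi
  have hσp : σ p = p := by
    rw [← hX] at hp
    exact hp.1
  have hpK : p ∈ fixedSet M (realTorus n) := mem_fixedSet_of_mem_fixedPoints hp
  obtain ⟨e, he, heσ⟩ := exists_isRealChart (E := E) hτ.smooth hσ le_rfl hσp hpK
  have h1 := finrank_fixedTangent_pos hα (mod2Reduction_eq_zero_iff.1 hi)
  have h2 := finrank_fixedTangent_le_two_mul hτ hσ le_rfl hσp hpK
  have hne : realFixedTangent E (realTorus n) σ p ≠ ⊥ := by
    intro h
    rw [h, finrank_bot] at h2
    omega
  obtain ⟨w, hw, hw0⟩ := Submodule.exists_mem_ne_zero_of_ne_bot hne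
  obtain ⟨t, ht, htS⟩ := he.exists_smul_not_mem hfin hw0
  have hwt := (realFixedTangent E (realTorus n) σ p).smul_mem t hw
  refine htS ?_
  rw [← hX]
  refine ⟨?_, fun g => he.symm_mem_fixedSet ht (mem_realFixedTangent.1 hwt).1 g g.2⟩
  show σ (e.symm (t • w)) = e.symm (t • w)
  rw [heσ.involution_symm ht, (mem_realFixedTangent.1 hwt).2]

/-- If the real one-skeleton lies in the one-skeleton, which has dimension at most two, then the
reduced weights are pairwise distinct. -/
lemma injective_mod2Reduction_of_realOneSkeleton (hτ : IsHamiltonianAction Ω n)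
    (hσ : IsCompatibleAntisymplecticInvolution Ω n σ)
    (hfin : (MulAction.fixedPoints (Torus n) M).Finite)
    (hdim : subsetDim E (oneSkeleton E M n) ≤ 2)
    (hX : realOneSkeleton n σ ⊆ oneSkeleton E M n) {p : M}
    (hp : p ∈ MulAction.fixedPoints (Torus n) M) (hσp : σ p = p) {α : Fin d → Fin n → ℤ}
    (hα : IsIsotropyWeights Ω n p α) : Function.Injective fun i => mod2Reduction (α i) := by
  intro i j hij
  by_contra hne
  let K := realKernel (α i)
  have hK : K ≤ realTorus n := fun g hg => hg.1
  have hpK : p ∈ fixedSet M K := mem_fixedSet_of_mem_fixedPoints hp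
  obtain ⟨e, he, heσ⟩ := exists_isRealChart (E := E) hτ.smooth hσ hK hσp hpK
  have h1 : 4 ≤ Module.finrank ℝ (fixedTangent E K p) :=
    four_le_finrank_fixedTangent hα hne (fun k hk => hk.2) fun k hk => by
      rw [← mod2Reduction_eq_iff.1 hij k hk.1]
      exact hk.2
  have h2 := finrank_fixedTangent_le_two_mul hτ hσ hK hσp hpK
  have h3 := finrank_realFixedTangent_lt_subsetDim hτ hσ he heσ hfin (by omega) fun z hz hzt => by
    obtain ⟨hzK, hzσ⟩ := mem_realFixedTangent.1 hz
    refine hX ⟨?_, ?_⟩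
    · show σ (e.symm z) = e.symm z
      rw [heσ.involution_symm hzt, hzσ]
    · rw [encard_orbit_le_two_iff]
      have hfix := he.symm_mem_fixedSet hzt hzK
      intro g hg h hh hgx hhx
      exact hfix _ (mul_mem_realKernel hg hh (fun h' => hgx (hfix _ h')) fun h' => hhx (hfix _ h'))
  have h4 : ((3 : ℕ) : ENNReal) ≤ 2 := by
    refine le_trans ?_ (h3.trans hdim)
    exact_mod_cast (by omega : 3 ≤ Module.finrank ℝ (realFixedTangent E K σ p) + 1)
  norm_num at h4

end OneSkeleton

end RealGKM

end

theorem mainTheorem10 (n d : ℕ) (M : Type*) [TopologicalSpace M] [T2Space M] [CompactSpace M]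
    [ConnectedSpace M] [ChartedSpace (EuclideanSpace ℝ (Fin (2 * d))) M]
    [IsManifold (𝓡 (2 * d)) ∞ M]
    (Ω : RealGKM.SymplecticForm (EuclideanSpace ℝ (Fin (2 * d))) M)
    [MulAction (RealGKM.Torus n) M] (hτ : RealGKM.IsHamiltonianAction Ω n)
    (σ : M → M) (hσ : RealGKM.IsCompatibleAntisymplecticInvolution Ω n σ)
    (hfin : (MulAction.fixedPoints (RealGKM.Torus n) M).Finite)
    (hdim : RealGKM.subsetDim (EuclideanSpace ℝ (Fin (2 * d)))
      (RealGKM.oneSkeleton (EuclideanSpace ℝ (Fin (2 * d))) M n) ≤ 2) :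
    (RealGKM.realFixedPoints n σ = MulAction.fixedPoints (RealGKM.Torus n) M ∧
      RealGKM.realOneSkeleton n σ = RealGKM.realLocus σ ∩
        RealGKM.oneSkeleton (EuclideanSpace ℝ (Fin (2 * d))) M n) ↔
    ∀ p ∈ MulAction.fixedPoints (RealGKM.Torus n) M,
      ∃ α : Fin d → Fin n → ℤ, RealGKM.IsIsotropyWeights Ω n p α ∧
        Function.Injective (fun i => RealGKM.mod2Reduction (α i)) ∧
        ∀ i, RealGKM.mod2Reduction (α i) ≠ 0 := by 
  have hA := hτ.smooth
  constructor
  · rintro ⟨hX0, hX1⟩ p hp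
    have hσp : σ p = p := by
      rw [← hX0] at hp
      exact hp.1
    obtain ⟨α, hα⟩ := RealGKM.exists_isIsotropyWeights hτ hp (finrank_euclideanSpace_fin)
    refine ⟨α, hα, ?_, RealGKM.mod2Reduction_ne_zero_of_realFixedPoints hτ hσ hfin hX0 hp hα⟩
    exact RealGKM.injective_mod2Reduction_of_realOneSkeleton hτ hσ hfin hdim
      (hX1.subset.trans Set.inter_subset_right) hp hσp hα
  · intro hW
    have hW0 : ∀ p ∈ MulAction.fixedPoints (RealGKM.Torus n) M, ∃ α : Fin d → Fin n → ℤ,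
        RealGKM.IsIsotropyWeights Ω n p α ∧ ∀ i, RealGKM.mod2Reduction (α i) ≠ 0 := fun p hp => by
      obtain ⟨α, h1, -, h2⟩ := hW p hp
      exact ⟨α, h1, h2⟩
    refine ⟨Set.Subset.antisymm ?_ ?_, Set.Subset.antisymm ?_ ?_⟩
    · rintro x ⟨-, hx⟩
      exact RealGKM.mem_fixedPoints_of_mem_fixedSet_realTorus hτ hW0 fun k hk => hx ⟨k, hk⟩
    · intro x hx
      exact ⟨RealGKM.involution_eq_of_mem_fixedPoints hτ hσ hfin hW hx, fun g => hx g⟩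
    · rintro x ⟨hxX, hx⟩
      exact ⟨hxX, RealGKM.orbitDim_le_one_of_encard_orbit hτ hW hx⟩
    · exact RealGKM.realLocus_inter_oneSkeleton_subset hA σ
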